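/- Let $k$ be a field of characteristic zero and let $A=k\langle x,y\rangle/(x^2,\;y^2x-xy^2-xyx)$ be the super Jordan plane, augmented by $x,y\mapsto 0$, so that $k$ is an $A$-bimodule. Let $P_\bullet A$ be the complex of free $A$-bimodules with $P_0A=A\otimes A$, $P_1A=A\otimes k\{x,y\}\otimes A$, $P_nA=A\otimes k\{x^n,y^2x^{n-1}\}\otimes A$ for $n\ge 2$, with differentials $P_n A\to P_{n-1}A$ $$1\otimes x\otimes 1\mapsto x\otimes 1-1\otimes x,\qquad 1\otimes y\otimes 1\mapsto y\otimes 1-1\otimes y,$$ $$1\otimes x^n\otimes 1\mapsto x\otimes x^{n-1}\otimes 1+(-1)^n\,1\otimes x^{n-1}\otimes x\quad(n\ge2),$$ $$1\otimes y^2x\otimes 1\mapsto y^2\otimes x\otimes 1+y\otimes y\otimes x+1\otimes y\otimes yx-(xy\otimes y\otimes 1+x\otimes y\otimes y+1\otimes x\otimes y^2)-(xy\otimes x\otimes 1+x\otimes y\otimes x+1\otimes x\otimes yx),$$ $$1\otimes y^2x^n\otimes 1\mapsto y^2\otimes x^n\otimes 1+(-1)^{n+1}\,1\otimes y^2x^{n-1}\otimes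 x-(x\otimes y^2x^{n-1}\otimes 1+xy\otimes x^n\otimes 1+1\otimes x^n\otimes y^2+1\otimes x^n\otimes yx)\quad(n\ge 2).$$ Let $H^\bullet(A,k)$ be the Hochschild cohomology of $A$ with coefficients in $k$, computed by the bar resolution $B_\bullet A$, with the cup product induced by $(\varphi\smile\psi)(a_1,\dots,a_{n+m})=\varphi(a_1,\dots,a_n)\,\psi(a_{n+1},\dots,a_{n+m})$. There is a morphism of complexes of bimodules $f\colon P_\bullet A\to B_\bullet A$ with $f_0=\mathrm{id}_{A\otimes A}$; and for every such $f$, pulling back along $f$ is, for every $n\ge0$, an isomorphism $H^n(A,k)\cong\operatorname{Hom}_{A^e}(P_nA,k)$. Through it, let $\eta^0\in H^0(A,k)$ be the class with $\eta^0(1\otimes1)=1$; let $\eta^1,\omega^1\in H^1(A,k)$ be the classes dual to $1\otimes x\otimes 1$, $1\otimes y\otimes 1$; and for $n\ge2$ let $\eta^n,\omega^n\in H^n(A,k)$ be the classes dual to $1\otimes x^n\otimes1$, $1\otimes y^2x^{n-1}\otimes 1$. Then: 1. $\eta^0$ is the unit of $H^\bullet(A,k)$ and a basis of $H^0(A,k)$,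 and $\{\eta^n,\omega^n\}$ is a basis of $H^n(A,k)$ for every $n\ge1$. 2. $\eta^p\smile\eta^q=\eta^{p+q}$ and $\omega^p\smile\omega^q=0$ for all $p,q\ge1$; $\;\omega^1\smile\eta^q=0=\eta^q\smile\omega^1$ for all $q\ge1$; $\;\omega^p\smile\eta^q=\omega^{p+q}=(-1)^q\,\eta^q\smile\omega^p$ for all $p\ge2$, $q\ge1$. 3. The $k$-algebra $H^\bullet(A,k)$ is generated by $\eta^1,\omega^1,\omega^2$, and there is an isomorphism of algebras $$k\langle \eta^1,\omega^1,\omega^2\rangle\big/\big((\omega^1)^2,(\omega^2)^2,\omega^1\omega^2,\omega^2\omega^1,\omega^1\eta^1,\eta^1\omega^1,\omega^2\eta^1+\eta^1\omega^2\big)\;\cong\;H^\bullet(A,k)$$ sending each generator to the class of the same name (hence graded, with $\eta^1,\omega^1$ in degree $1$ and $\omega^2$ in degree $2$). 4. $\dim_k\operatorname{Ext}^n_A(k,k)=2$ for all $n\ge1$, and the Yoneda algebra $E(A)=\bigoplus_n\operatorname{Ext}^n_A(k,k)$ is isomorphic to $H^\bullet(A,k)$ as a graded algebra. In particular $E(A)$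 is generated by the images of $\eta^1,\omega^1$ (degree $1$) and $\omega^2$ (degree $2$), and has the presentation in 3. Consequently $A$ is $\mathcal K_2$, i.e. $E(A)$ is generated as a $k$-algebra in degrees $1$ and $2$. -/

import Mathlib

open scoped TensorProduct DirectSum
open MulOpposite (op)
open CategoryTheory

universe w v u

noncomputable section

namespace Yoneda

section Hochschild

variable (k : Type u) [Field k] (A : Type u) [Ring A] [Algebra k A]

def Env : Type u := A ⊗[k] Aᵐᵒᵖ

instance : Ring (Env k A) := inferInstanceAs (Ring (A ⊗[k] Aᵐᵒᵖ))

instance : Algebra k (Env k A) := inferInstanceAs (Algebra k (A ⊗[k] Aᵐᵒᵖ))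

variable {A} in
/-- The element `a ⊗ op b` of the enveloping algebra. -/
def Env.mk (a b : A) : Env k A := (a ⊗ₜ[k] op b : A ⊗[k] Aᵐᵒᵖ)

namespace Env

variable {k A}

lemma add_mk (a a' b : A) : mk k (a + a') b = mk k a b + mk k a' b := TensorProduct.add_tmul _ _ _

lemma mk_add (a b b' : A) : mk k a (b + b') = mk k a b + mk k a b' := TensorProduct.tmul_add _ _ _

lemma smul_mk (c : k) (a b : A) : mk k (c • a) b = c • mk k a b := (TensorProduct.smul_tmul' c a _).symm

lemma mk_smul (c : k) (a b : A) : mk k a (c • b) = c • mk k a b := TensorProduct.tmul_smul c a (op b)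

lemma mk_mul_mk (a b a' b' : A) : mk k a b * mk k a' b' = mk k (a * a') (b' * b) :=
  Algebra.TensorProduct.tmul_mul_tmul _ _ _ _

lemma mk_one_one : mk k (1 : A) 1 = 1 := rfl

end Env

abbrev Cochain (M : Type u) [AddCommGroup M] [Module k M] (n : ℕ) : Type u :=
  MultilinearMap k (fun _ : Fin n => A) M

variable {k A} {M : Type u} [AddCommGroup M] [Module k M] [Module (Env k A) M]
  [IsScalarTower k (Env k A) M]

variable (k) in
lemma exists_contractNth_update {n : ℕ} (i : Fin n) (a : Fin (n + 1) → A) (j : Fin (n + 1)) :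
    ∃ (l : Fin n) (L : A →ₗ[k] A), ∀ v : A,
      Fin.contractNth i.castSucc (· * ·) (Function.update a j v) =
        Function.update (Fin.contractNth i.castSucc (· * ·) a) l (L v) := by
  rcases lt_trichotomy (j : ℕ) i with h | h | h
  · refine ⟨⟨j, by omega⟩, LinearMap.id, fun v => ?_⟩
    ext l
    simp only [Fin.contractNth, Function.update_apply, Fin.ext_iff, Fin.val_castSucc, Fin.val_succ,
      LinearMap.id_apply]
    split_ifs <;> first | rfl | omega
  · refine ⟨i, LinearMap.mulRight k (a i.succ), fun v => ?_⟩
    ext l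
    simp only [Fin.contractNth, Function.update_apply, Fin.ext_iff, Fin.val_castSucc, Fin.val_succ,
      LinearMap.mulRight_apply]
    split_ifs <;> first | rfl | omega | skip
    all_goals (have hl : l = i := Fin.ext (by omega)); rw [hl]
  · by_cases h' : (j : ℕ) = i + 1
    · refine ⟨i, LinearMap.mulLeft k (a i.castSucc), fun v => ?_⟩
      ext l
      simp only [Fin.contractNth, Function.update_apply, Fin.ext_iff, Fin.val_castSucc,
        Fin.val_succ, LinearMap.mulLeft_apply]
      split_ifs <;> first | rfl | omega | skip
      all_goals (have hl : l = i := Fin.ext (by omega)); rw [hl]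
    · refine ⟨⟨j - 1, by omega⟩, LinearMap.id, fun v => ?_⟩
      ext l
      simp only [Fin.contractNth, Function.update_apply, Fin.ext_iff, Fin.val_castSucc,
        Fin.val_succ, LinearMap.id_apply]
      split_ifs <;> first | rfl | omega

/-- `(a₀,…,aₙ) ↦ φ(a₀,…,aᵢaᵢ₊₁,…,aₙ)`. -/
def contractCochain {n : ℕ} (φ : Cochain k A M n) (i : Fin n) : Cochain k A M (n + 1) where
  toFun a := φ (Fin.contractNth i.castSucc (· * ·) a)
  map_update_add' {inst} a j v w := by
    rw [Subsingleton.elim inst (instDecidableEqFin _)]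
    obtain ⟨l, L, h⟩ := exists_contractNth_update k i a j
    simp only [h, map_add, MultilinearMap.map_update_add]
  map_update_smul' {inst} a j c v := by
    rw [Subsingleton.elim inst (instDecidableEqFin _)]
    obtain ⟨l, L, h⟩ := exists_contractNth_update k i a j
    simp only [h, map_smul, MultilinearMap.map_update_smul]

/-- `(a₀,…,aₙ) ↦ a₀ φ(a₁,…,aₙ)`. -/
def leftCochain {n : ℕ} (φ : Cochain k A M n) : Cochain k A M (n + 1) where
  toFun a := Env.mk k (a 0) 1 • φ (Fin.tail a)
  map_update_add' {inst} a j v w := by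
    rw [Subsingleton.elim inst (instDecidableEqFin _)]
    refine Fin.cases ?_ (fun j => ?_) j
    · simp [Env.add_mk, add_smul]
    · simp [(Fin.succ_ne_zero _).symm, Fin.tail_update_succ]
  map_update_smul' {inst} a j c v := by
    rw [Subsingleton.elim inst (instDecidableEqFin _)]
    refine Fin.cases ?_ (fun j => ?_) j
    · simp [Env.smul_mk]
    · simp [(Fin.succ_ne_zero _).symm, Fin.tail_update_succ, smul_comm c]

/-- `(a₀,…,aₙ) ↦ φ(a₀,…,aₙ₋₁) aₙ`. -/
def rightCochain {n : ℕ} (φ : Cochain k A M n) : Cochain k A M (n + 1) where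
  toFun a := Env.mk k 1 (a (Fin.last n)) • φ (Fin.init a)
  map_update_add' {inst} a j v w := by
    rw [Subsingleton.elim inst (instDecidableEqFin _)]
    refine Fin.lastCases ?_ (fun j => ?_) j
    · simp [Env.mk_add, add_smul]
    · simp [(Fin.castSucc_lt_last _).ne', Fin.init_update_castSucc]
  map_update_smul' {inst} a j c v := by
    rw [Subsingleton.elim inst (instDecidableEqFin _)]
    refine Fin.lastCases ?_ (fun j => ?_) j
    · simp [Env.mk_smul]
    · simp [(Fin.castSucc_lt_last _).ne', Fin.init_update_castSucc, smul_comm c]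

variable (k A M) in
/-- The Hochschild differential `C^n(A, M) → C^{n+1}(A, M)`,
`(δφ)(a₀,…,aₙ) = a₀φ(a₁,…,aₙ) + ∑_{i<n} (-1)^{i+1} φ(…,aᵢaᵢ₊₁,…) + (-1)^{n+1} φ(a₀,…,aₙ₋₁)aₙ`. -/
def δ (n : ℕ) : Cochain k A M n →ₗ[k] Cochain k A M (n + 1) where
  toFun φ := leftCochain φ + ∑ i : Fin n, (-1 : k) ^ ((i : ℕ) + 1) • contractCochain φ i
    + (-1 : k) ^ (n + 1) • rightCochain φ
  map_add' φ ψ := by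
    ext a
    simp [leftCochain, contractCochain, rightCochain, Finset.sum_add_distrib]
    abel
  map_smul' c φ := by
    ext a
    simp [leftCochain, contractCochain, rightCochain, Finset.smul_sum, smul_comm c]

lemma δ_apply {n : ℕ} (φ : Cochain k A M n) (a : Fin (n + 1) → A) :
    δ k A M n φ a = Env.mk k (a 0) 1 • φ (Fin.tail a)
      + ∑ i : Fin n, (-1 : k) ^ ((i : ℕ) + 1) • φ (Fin.contractNth i.castSucc (· * ·) a)
      + (-1 : k) ^ (n + 1) • Env.mk k 1 (a (Fin.last n)) • φ (Fin.init a) := by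
  simp [δ, leftCochain, contractCochain, rightCochain]

/-! ### The bar resolution -/

variable (k A) in
/-- The term `B_n A = A ⊗ A^{⊗n} ⊗ A` of the bar resolution, written as the `Aᵉ`-module
`Aᵉ ⊗ A^{⊗n}`; the element `a ⊗ t ⊗ b` is `Env.mk k a b ⊗ₜ t`. -/
abbrev Bar (n : ℕ) : Type u := Env k A ⊗[k] (⨂[k] _ : Fin n, A)

/-- The bimodule map `B_n A → M`, `a ⊗ (a₁ ⊗ ⋯ ⊗ aₙ) ⊗ b ↦ a φ(a₁,…,aₙ) b`. -/
def barLift {n : ℕ} (φ : Cochain k A M n) : Bar k A n →ₗ[Env k A] M :=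
  TensorProduct.AlgebraTensorModule.lift
    (LinearMap.toSpanSingleton (Env k A) ((⨂[k] _ : Fin n, A) →ₗ[k] M) (PiTensorProduct.lift φ))

lemma barLift_tmul {n : ℕ} (φ : Cochain k A M n) (e : Env k A) (t : ⨂[k] _ : Fin n, A) :
    barLift φ (e ⊗ₜ[k] t) = e • PiTensorProduct.lift φ t := rfl

lemma barLift_add {n : ℕ} (φ ψ : Cochain k A M n) : barLift (φ + ψ) = barLift φ + barLift ψ := by
  refine LinearMap.ext fun z => ?_
  induction z using TensorProduct.induction_on with
  | zero => simp
  | tmul e t => simp [barLift_tmul]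
  | add z w hz hw => rw [map_add, map_add, hz, hw]

lemma barLift_smul {n : ℕ} (c : k) (φ : Cochain k A M n) : barLift (c • φ) = c • barLift φ := by
  refine LinearMap.ext fun z => ?_
  induction z using TensorProduct.induction_on with
  | zero => simp
  | tmul e t => simp [barLift_tmul, smul_comm c]
  | add z w hz hw => rw [map_add, map_add, hz, hw]

variable (k A) in
/-- `(a₁,…,aₙ) ↦ 1 ⊗ (a₁ ⊗ ⋯ ⊗ aₙ) ⊗ 1`. -/
def barOne (n : ℕ) : Cochain k A (Bar k A n) n :=
  (TensorProduct.mk k (Env k A) (⨂[k] _ : Fin n, A) 1).compMultilinearMap (PiTensorProduct.tprod k)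

@[simp] lemma barLift_barOne {n : ℕ} (φ : Cochain k A M n) (a : Fin n → A) :
    barLift φ (barOne k A n a) = φ a := by
  simp [barLift, barOne]

variable (k A) in
/-- The differential of the bar resolution: `1 ⊗ a₀ ⊗ ⋯ ⊗ aₙ ⊗ 1` goes to
`a₀ ⊗ a₁ ⊗ ⋯ ⊗ 1 + ∑_{i<n} (-1)^{i+1} 1 ⊗ ⋯ ⊗ aᵢaᵢ₊₁ ⊗ ⋯ ⊗ 1 + (-1)^{n+1} 1 ⊗ a₀ ⊗ ⋯ ⊗ aₙ`. -/
def barD (n : ℕ) : Bar k A (n + 1) →ₗ[Env k A] Bar k A n :=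
  barLift (δ k A (Bar k A n) n (barOne k A n))

lemma barLift_comp_barD {n : ℕ} (φ : Cochain k A M n) (z : Bar k A (n + 1)) :
    barLift φ (barD k A n z) = barLift (δ k A M n φ) z := by
  suffices h : barLift φ ∘ₗ barD k A n = barLift (δ k A M n φ) from LinearMap.congr_fun h z
  apply TensorProduct.AlgebraTensorModule.curry_injective
  apply LinearMap.ext_ring
  apply PiTensorProduct.ext
  ext a
  change barLift φ (barD k A n (barOne k A (n+1) a)) = barLift (δ k A M n φ) (barOne k A (n+1) a)
  rw [barD, barLift_barOne, barLift_barOne, δ_apply, δ_apply]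
  simp only [map_add, map_sum, LinearMap.map_smul_of_tower, map_smul, barLift_barOne]



variable (k A M) in
/-- Hochschild cocycles. -/
def cocycles (n : ℕ) : Submodule k (Cochain k A M n) := LinearMap.ker (δ k A M n)

variable (k A M) in
/-- Hochschild coboundaries. -/
def coboundaries : (n : ℕ) → Submodule k (Cochain k A M n)
  | 0 => ⊥
  | n + 1 => LinearMap.range (δ k A M n)

variable (k A M) in
/-- The Hochschild cohomology `H^n(A, M)`. -/
def HH (n : ℕ) : Type u :=
  cocycles k A M n ⧸ (coboundaries k A M n).submoduleOf (cocycles k A M n)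

instance (n : ℕ) : AddCommGroup (HH k A M n) :=
  inferInstanceAs (AddCommGroup (_ ⧸ (coboundaries k A M n).submoduleOf (cocycles k A M n)))

instance (n : ℕ) : Module k (HH k A M n) :=
  inferInstanceAs (Module k (_ ⧸ (coboundaries k A M n).submoduleOf (cocycles k A M n)))

/-- The cohomology class of a cocycle. -/
def HH.mk {n : ℕ} : cocycles k A M n →ₗ[k] HH k A M n :=
  Submodule.mkQ ((coboundaries k A M n).submoduleOf (cocycles k A M n))

lemma HH.mk_surjective {n : ℕ} : Function.Surjective (HH.mk (k := k) (A := A) (M := M) (n := n)) :=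
  Submodule.mkQ_surjective _

/-- The linear map out of `H^n(A, M)` induced by a linear map vanishing on coboundaries. -/
def HH.lift {N : Type*} [AddCommGroup N] [Module k N] {n : ℕ} (L : cocycles k A M n →ₗ[k] N)
    (hL : ∀ φ : cocycles k A M n, (φ : Cochain k A M n) ∈ coboundaries k A M n → L φ = 0) :
    HH k A M n →ₗ[k] N :=
  Submodule.liftQ ((coboundaries k A M n).submoduleOf (cocycles k A M n)) L fun φ hφ => hL φ hφ

@[simp] lemma HH.lift_mk {N : Type*} [AddCommGroup N] [Module k N] {n : ℕ}
    (L : cocycles k A M n →ₗ[k] N)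
    (hL : ∀ φ : cocycles k A M n, (φ : Cochain k A M n) ∈ coboundaries k A M n → L φ = 0)
    (φ : cocycles k A M n) : HH.lift L hL (HH.mk φ) = L φ := rfl

lemma HH.mk_eq_zero {n : ℕ} (z : cocycles k A M n) :
    HH.mk z = 0 ↔ (z : Cochain k A M n) ∈ coboundaries k A M n := by
  exact Submodule.Quotient.mk_eq_zero ((coboundaries k A M n).submoduleOf (cocycles k A M n))

end Hochschild

section Augmented

variable {k : Type u} [Field k] {A : Type u} [Ring A] [Algebra k A]

/-- The field `k` as an `A`-bimodule through the augmentation `ε`. -/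
def Aug (_ε : A →ₐ[k] k) : Type u := k

variable (ε : A →ₐ[k] k)

instance : CommRing (Aug ε) := inferInstanceAs (CommRing k)
instance : Algebra k (Aug ε) := inferInstanceAs (Algebra k k)
instance : Module A (Aug ε) := Module.compHom k ε.toRingHom

/-- `a ⊗ op b ↦ ε(a) ε(b)`. -/
def envAug : Env k A →ₐ[k] k :=
  (Algebra.TensorProduct.lift ε (AlgHom.fromOpposite ε fun _ _ => Commute.all _ _)
    (fun _ _ => Commute.all _ _) : A ⊗[k] Aᵐᵒᵖ →ₐ[k] k)

instance : Module (Env k A) (Aug ε) := Module.compHom k (envAug ε).toRingHom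

lemma env_smul_def (e : Env k A) (c : Aug ε) : e • c = (envAug ε e • c : Aug ε) := rfl

lemma env_mk_smul (a b : A) (c : Aug ε) :
    Env.mk k a b • c = (ε a * ε b) • c := by
  rfl

instance : IsScalarTower k (Env k A) (Aug ε) where
  smul_assoc r e c := by simp only [env_smul_def, map_smul, smul_assoc]

/-- Hochschild cochains with coefficients in `k`. -/
abbrev AugCochain (n : ℕ) : Type u := Cochain k A (Aug ε) n

variable {ε}

/-- The cup product `(φ ⌣ ψ)(a₁,…,aₙ₊ₘ) = φ(a₁,…,aₙ) ψ(aₙ₊₁,…,aₙ₊ₘ)` of cochains. -/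
def cup {n m : ℕ} (φ : AugCochain ε n) (ψ : AugCochain ε m) : AugCochain ε (n + m) :=
  ((LinearMap.mul' k (Aug ε)).compMultilinearMap (φ.domCoprod ψ)).domDomCongr finSumFinEquiv

lemma cup_apply {n m : ℕ} (φ : AugCochain ε n) (ψ : AugCochain ε m) (a : Fin (n + m) → A) :
    cup φ ψ a = φ (fun i => a (Fin.castAdd m i)) * ψ (fun j => a (Fin.natAdd n j)) := by
  simp [cup]

lemma δ_cup {n m : ℕ} (φ : AugCochain ε n) (ψ : AugCochain ε m) (a : Fin (n + m + 1) → A) :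
    δ k A (Aug ε) (n + m) (cup φ ψ) a =
      δ k A (Aug ε) n φ (fun i => a ⟨i, by omega⟩) * ψ (fun j => a ⟨n + 1 + j, by omega⟩) +
      (-1 : k) ^ n • (φ (fun i => a ⟨i, by omega⟩) *
        δ k A (Aug ε) m ψ (fun j => a ⟨n + j, by omega⟩)) := by
  simp only [δ_apply, cup_apply, env_mk_smul, map_one, mul_one, one_mul, Fin.sum_univ_add]
  have e1 : ∀ i : Fin n, (fun l : Fin n => Fin.contractNth (Fin.castAdd m i).castSucc (· * ·) a
      (Fin.castAdd m l)) = Fin.contractNth i.castSucc (· * ·) (fun l : Fin (n+1) => a ⟨l, by omega⟩) := by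
    intro i; ext l
    simp only [Fin.contractNth, Fin.val_castSucc, Fin.val_castAdd]
    split_ifs <;> rfl
  have e2 : ∀ i : Fin n, (fun l : Fin m => Fin.contractNth (Fin.castAdd m i).castSucc (· * ·) a
      (Fin.natAdd n l)) = (fun l : Fin m => a ⟨n + 1 + l, by omega⟩) := by
    intro i; ext l
    simp only [Fin.contractNth, Fin.val_castSucc, Fin.val_castAdd, Fin.val_natAdd]
    rw [if_neg (by omega), if_neg (by omega)]
    congr 1; ext; simp; omega
  have e3 : ∀ i : Fin m, (fun l : Fin n => Fin.contractNth (Fin.natAdd n i).castSucc (· * ·) a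
      (Fin.castAdd m l)) = (fun l : Fin n => a ⟨l, by omega⟩) := by
    intro i; ext l
    simp only [Fin.contractNth, Fin.val_castSucc, Fin.val_castAdd, Fin.val_natAdd]
    rw [if_pos (by omega)]
    rfl
  have e4 : ∀ i : Fin m, (fun l : Fin m => Fin.contractNth (Fin.natAdd n i).castSucc (· * ·) a
      (Fin.natAdd n l)) = Fin.contractNth i.castSucc (· * ·) (fun l : Fin (m+1) => a ⟨n + l, by omega⟩) := by
    intro i; ext l
    simp only [Fin.contractNth, Fin.val_castSucc, Fin.val_natAdd, add_lt_add_iff_left,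
      add_right_inj]
    split_ifs <;> rfl
  simp only [e1, e2, e3, e4]
  have t1 : (fun i : Fin n => Fin.tail a (Fin.castAdd m i)) =
    Fin.tail (fun l : Fin (n+1) => a ⟨l, by omega⟩) := rfl
  have t2 : (fun i : Fin m => Fin.tail a (Fin.natAdd n i)) = (fun l : Fin m => a ⟨n + 1 + l, by omega⟩) := by
    ext l; simp only [Fin.tail]; congr 1; ext; simp; omega
  have t3 : (fun i : Fin n => Fin.init a (Fin.castAdd m i)) = (fun l : Fin n => a ⟨l, by omega⟩) := rfl
  have t4 : (fun i : Fin m => Fin.init a (Fin.natAdd n i)) =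
    Fin.init (fun l : Fin (m+1) => a ⟨n + l, by omega⟩) := rfl
  have t5 : Fin.init (fun l : Fin (n+1) => a ⟨l, by omega⟩) = (fun l : Fin n => a ⟨l, by omega⟩) := rfl
  have t6 : Fin.tail (fun l : Fin (m+1) => a ⟨n + l, by omega⟩) = (fun l : Fin m => a ⟨n + 1 + l, by omega⟩) := by
    ext l; simp only [Fin.tail]; congr 1; ext; simp; omega
  have t7 : a (Fin.last (n + m)) = (fun l : Fin (m+1) => a ⟨n + l, by omega⟩) (Fin.last m) := rfl
  have t8 : (fun l : Fin (n+1) => a ⟨l, by omega⟩) (Fin.last n) = (fun l : Fin (m+1) => a ⟨n + l, by omega⟩) 0 := rfl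
  simp only [t1, t2, t3, t4, t5, t6]
  simp only [Algebra.smul_def, Finset.mul_sum, Finset.sum_mul, mul_add, add_mul, Fin.val_castAdd, Fin.val_natAdd, pow_add, map_mul, map_pow, map_neg, map_one, pow_one, Fin.val_last, Fin.val_zero]
  generalize hX : φ (fun l : Fin n => a ⟨l, by omega⟩) = X
  generalize hY : ψ (fun l : Fin m => a ⟨n + 1 + l, by omega⟩) = Y
  simp only [mul_assoc, mul_left_comm]
  have u1 : a ⟨n + 0, by omega⟩ = a ⟨n, by omega⟩ := rfl
  have u2 : a ⟨0, by omega⟩ = a 0 := rfl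
  have u3 : a ⟨n + m, by omega⟩ = a (Fin.last (n + m)) := rfl
  simp only [u1, u2, u3]
  ring


lemma mem_cocycles {n : ℕ} {φ : AugCochain ε n} :
    φ ∈ cocycles k A (Aug ε) n ↔ δ k A (Aug ε) n φ = 0 := Iff.rfl

lemma cup_mem_cocycles {n m : ℕ} {φ : AugCochain ε n} {ψ : AugCochain ε m}
    (hφ : φ ∈ cocycles k A (Aug ε) n) (hψ : ψ ∈ cocycles k A (Aug ε) m) :
    cup φ ψ ∈ cocycles k A (Aug ε) (n + m) := by
  rw [mem_cocycles] at *
  ext a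
  rw [δ_cup, hφ, hψ]
  simp

lemma mem_coboundaries_of_eq {N N' : ℕ} (h : N = N' + 1) (χ : AugCochain ε N)
    (χ' : AugCochain ε N') (H : ∀ a : Fin (N' + 1) → A,
      χ (fun i => a (Fin.cast h i)) = δ k A (Aug ε) N' χ' a) :
    χ ∈ coboundaries k A (Aug ε) N := by
  subst h
  exact ⟨χ', by ext a; exact (H a).symm⟩

lemma cup_mem_coboundaries_left {n m : ℕ} {φ : AugCochain ε n} {ψ : AugCochain ε m}
    (hφ : φ ∈ coboundaries k A (Aug ε) n) (hψ : ψ ∈ cocycles k A (Aug ε) m) :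
    cup φ ψ ∈ coboundaries k A (Aug ε) (n + m) := by
  cases n with
  | zero =>
    obtain rfl : φ = 0 := hφ
    have : cup (0 : AugCochain ε 0) ψ = 0 := by ext a; simp [cup_apply]
    rw [this]; exact zero_mem _
  | succ n =>
    obtain ⟨φ', rfl⟩ := hφ
    refine mem_coboundaries_of_eq (N' := n + m) (by omega) _ (cup φ' ψ) fun a => ?_
    rw [δ_cup, mem_cocycles.1 hψ, cup_apply]
    simp only [zero_apply, mul_zero, smul_zero, add_zero]
    rfl

lemma cup_mem_coboundaries_right {n m : ℕ} {φ : AugCochain ε n} {ψ : AugCochain ε m}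
    (hφ : φ ∈ cocycles k A (Aug ε) n) (hψ : ψ ∈ coboundaries k A (Aug ε) m) :
    cup φ ψ ∈ coboundaries k A (Aug ε) (n + m) := by
  cases m with
  | zero =>
    obtain rfl : ψ = 0 := hψ
    have : cup φ (0 : AugCochain ε 0) = 0 := by ext a; rw [cup_apply]; simp
    rw [this]; exact zero_mem _
  | succ m =>
    obtain ⟨ψ', rfl⟩ := hψ
    refine mem_coboundaries_of_eq (N' := n + m) (by omega) _ ((-1 : k) ^ n • cup φ ψ') fun a => ?_
    rw [map_smul, smul_apply, δ_cup, mem_cocycles.1 hφ, cup_apply]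
    simp only [zero_apply, zero_mul, zero_add, smul_smul, ← mul_pow, neg_mul_neg,
      mul_one, one_pow, one_smul]
    rfl

/-- cup product of cocycles -/
def cupCocycle (n m : ℕ) : cocycles k A (Aug ε) n →ₗ[k] cocycles k A (Aug ε) m →ₗ[k]
    cocycles k A (Aug ε) (n + m) :=
  LinearMap.mk₂ k (fun φ ψ => ⟨cup φ ψ, cup_mem_cocycles φ.2 ψ.2⟩)
    (fun φ φ' ψ => by ext a; simp [cup_apply, add_mul])
    (fun c φ ψ => by ext a; simp [cup_apply])
    (fun φ ψ ψ' => by ext a; simp [cup_apply, mul_add])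
    (fun c φ ψ => by ext a; simp [cup_apply])

lemma coe_cupCocycle {n m : ℕ} (φ : cocycles k A (Aug ε) n) (ψ : cocycles k A (Aug ε) m) :
    (cupCocycle n m φ ψ : AugCochain ε (n + m)) = cup φ ψ := rfl

variable (ε) in
/-- The Hochschild cohomology `H^n(A, k)` with coefficients in the bimodule `k`. -/
abbrev HAug (n : ℕ) : Type u := HH k A (Aug ε) n

/-- The cup product `H^n(A, k) × H^m(A, k) → H^{n+m}(A, k)`. -/
def hcup (n m : ℕ) : HAug ε n →ₗ[k] HAug ε m →ₗ[k] HAug ε (n + m) :=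
  HH.lift
    (LinearMap.flip (HH.lift ((cupCocycle n m).compr₂ HH.mk).flip (by
      intro ψ hψ
      ext φ
      exact (HH.mk_eq_zero _).2 (cup_mem_coboundaries_right φ.2 hψ)))) (by
    intro φ hφ
    refine LinearMap.ext fun x => ?_
    obtain ⟨ψ, rfl⟩ := HH.mk_surjective x
    exact (HH.mk_eq_zero _).2 (cup_mem_coboundaries_left hφ ψ.2))

lemma hcup_mk {n m : ℕ} (φ : cocycles k A (Aug ε) n) (ψ : cocycles k A (Aug ε) m) :
    hcup n m (HH.mk φ) (HH.mk ψ) = HH.mk (cupCocycle n m φ ψ) := rfl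

variable (ε) in
/-- The `0`-cocycle with value `c`. -/
def scalarCocycle : k →ₗ[k] cocycles k A (Aug ε) 0 where
  toFun c := ⟨MultilinearMap.constOfIsEmpty k _ (algebraMap k (Aug ε) c), by
    rw [mem_cocycles]; ext a
    rw [δ_apply]
    simp only [env_mk_smul]
    simp⟩
  map_add' c d := by ext; simp
  map_smul' c d := by ext; simp [Algebra.smul_def]

lemma scalarCocycle_apply (c : k) (a : Fin 0 → A) :
    (scalarCocycle ε c : AugCochain ε 0) a = algebraMap k (Aug ε) c := rfl

lemma gradedMonoid_mk_eq {n m : ℕ} (h : n = m) (φ : cocycles k A (Aug ε) n)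
    (ψ : cocycles k A (Aug ε) m)
    (H : ∀ a : Fin m → A, (φ : AugCochain ε n) (fun i => a (Fin.cast h i)) =
      (ψ : AugCochain ε m) a) :
    GradedMonoid.mk (A := HAug ε) n (HH.mk φ) = GradedMonoid.mk m (HH.mk ψ) := by
  subst h
  congr 2
  ext a
  exact H a

/-- `⨁ₙ H^n(A, k)` is a graded algebra under the cup product. -/
instance : GradedMonoid.GMul (HAug ε) := ⟨fun x y => hcup _ _ x y⟩

instance : GradedMonoid.GOne (HAug ε) := ⟨HH.mk (scalarCocycle ε 1)⟩

instance : GradedMonoid.GMonoid (HAug ε) where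
  one_mul := by
    rintro ⟨n, x⟩
    obtain ⟨φ, rfl⟩ := HH.mk_surjective x
    refine gradedMonoid_mk_eq (zero_add n) (cupCocycle _ _ _ _) _ fun a => ?_
    rw [coe_cupCocycle, cup_apply, scalarCocycle_apply, map_one, one_mul]
    congr 1; ext i; congr 1; ext; simp
  mul_one := by
    rintro ⟨n, x⟩
    obtain ⟨φ, rfl⟩ := HH.mk_surjective x
    refine gradedMonoid_mk_eq (add_zero n) (cupCocycle _ _ _ _) _ fun a => ?_
    rw [coe_cupCocycle, cup_apply, scalarCocycle_apply, map_one, mul_one]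
    rfl
  mul_assoc := by
    rintro ⟨n, x⟩ ⟨m, y⟩ ⟨p, z⟩
    obtain ⟨φ, rfl⟩ := HH.mk_surjective x
    obtain ⟨ψ, rfl⟩ := HH.mk_surjective y
    obtain ⟨χ, rfl⟩ := HH.mk_surjective z
    refine gradedMonoid_mk_eq (add_assoc n m p) (cupCocycle _ _ (cupCocycle _ _ _ _) _)
      (cupCocycle _ _ _ (cupCocycle _ _ _ _)) fun a => ?_
    simp only [coe_cupCocycle, cup_apply, mul_assoc]
    congr 2
    congr 1; ext i; congr 1; ext; simp [add_assoc]

instance : DirectSum.GSemiring (HAug ε) where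
  mul_zero x := map_zero (hcup _ _ x)
  zero_mul {n m} x := by
    change hcup n m 0 x = 0
    rw [map_zero, LinearMap.zero_apply]
  mul_add x y z := map_add (hcup _ _ x) y z
  add_mul {n m} x y z := by
    change hcup n m (x + y) z = hcup n m x z + hcup n m y z
    rw [map_add, LinearMap.add_apply]
  natCast c := HH.mk (scalarCocycle ε c)
  natCast_zero := by simp
  natCast_succ c := by rw [Nat.cast_succ, map_add, map_add]; rfl

instance : DirectSum.GAlgebra k (HAug ε) where
  toFun := (HH.mk ∘ₗ scalarCocycle ε).toAddMonoidHom
  map_one := rfl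
  map_mul r s := by
    refine gradedMonoid_mk_eq (zero_add 0).symm _ (cupCocycle _ _ _ _) fun a => ?_
    rw [coe_cupCocycle, cup_apply]
    rw [scalarCocycle_apply, scalarCocycle_apply, scalarCocycle_apply, map_mul]
  commutes := by
    rintro r ⟨n, x⟩
    obtain ⟨φ, rfl⟩ := HH.mk_surjective x
    refine gradedMonoid_mk_eq (add_comm 0 n) (cupCocycle _ _ _ _) (cupCocycle _ _ _ _) fun a => ?_
    rw [coe_cupCocycle, cup_apply, coe_cupCocycle, cup_apply, scalarCocycle_apply,
      scalarCocycle_apply, mul_comm]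
    congr 2; ext i; congr 1; ext; simp
  smul_def := by
    rintro r ⟨n, x⟩
    obtain ⟨φ, rfl⟩ := HH.mk_surjective x
    refine gradedMonoid_mk_eq (zero_add n).symm (r • φ) (cupCocycle _ _ _ _) fun a => ?_
    rw [coe_cupCocycle, cup_apply, scalarCocycle_apply, ← Algebra.smul_def]
    change r • (φ : AugCochain ε n) _ = r • _
    congr 2; ext i; congr 1; ext; simp

end Augmented
section YonedaAlgebra

variable {k : Type u} [Field k] {C : Type*} [Category.{v} C] [Abelian C] [Linear k C]
  [HasExt.{w} C]

/-- `Ext^n(X, X)`. -/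
abbrev SelfExt (X : C) (n : ℕ) : Type w := Abelian.Ext X X n

lemma gradedMonoid_mk_comp_eq {X : C} {a b c c' : ℕ} (α : SelfExt X a) (β : SelfExt X b)
    (h : a + b = c) (h' : a + b = c') :
    GradedMonoid.mk (A := SelfExt X) c (α.comp β h) = GradedMonoid.mk c' (α.comp β h') := by
  subst h; subst h'; rfl

/-- The Yoneda product `α β = α ∘ β` on `⨁ₙ Extⁿ(X, X)`. -/
instance (X : C) : GradedMonoid.GMul (SelfExt X) := ⟨fun {_ _} α β => β.comp α (add_comm _ _)⟩

instance (X : C) : GradedMonoid.GOne (SelfExt X) := ⟨Abelian.Ext.mk₀ (𝟙 X)⟩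

lemma selfExt_mul {X : C} {a b c : ℕ} (α : SelfExt X a) (β : SelfExt X b) (h : b + a = c) :
    GradedMonoid.mk (A := SelfExt X) a α * GradedMonoid.mk b β =
      GradedMonoid.mk c (β.comp α h) :=
  gradedMonoid_mk_comp_eq _ _ _ _

instance (X : C) : GradedMonoid.GMonoid (SelfExt X) where
  one_mul := by
    rintro ⟨n, α⟩
    refine (selfExt_mul (Abelian.Ext.mk₀ (𝟙 X)) α (add_zero n)).trans ?_
    exact congrArg (GradedMonoid.mk n) (Abelian.Ext.comp_mk₀_id α)
  mul_one := by
    rintro ⟨n, α⟩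
    refine (selfExt_mul α (Abelian.Ext.mk₀ (𝟙 X)) (zero_add n)).trans ?_
    exact congrArg (GradedMonoid.mk n) (Abelian.Ext.mk₀_id_comp α)
  mul_assoc := by
    rintro ⟨a, α⟩ ⟨b, β⟩ ⟨c, γ⟩
    change GradedMonoid.mk a α * GradedMonoid.mk b β * GradedMonoid.mk c γ =
      GradedMonoid.mk a α * (GradedMonoid.mk b β * GradedMonoid.mk c γ)
    rw [selfExt_mul α β rfl, selfExt_mul β γ rfl, selfExt_mul _ γ rfl, selfExt_mul α _ rfl,
      ← Abelian.Ext.comp_assoc γ β α rfl rfl (by omega)]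
    exact gradedMonoid_mk_comp_eq _ _ _ _

instance (X : C) : DirectSum.GSemiring (SelfExt X) where
  mul_zero {i j} α := by
    change (0 : SelfExt X j).comp α (add_comm j i) = 0
    simp
  zero_mul α := Abelian.Ext.comp_zero α _ _ _ _
  mul_add α β γ := Abelian.Ext.add_comp _ _ _ _
  add_mul α β γ := Abelian.Ext.comp_add _ _ _ _
  natCast n := n • Abelian.Ext.mk₀ (𝟙 X)
  natCast_zero := zero_smul _ _
  natCast_succ n := succ_nsmul _ _

instance (X : C) : DirectSum.GAlgebra k (SelfExt X) where
  toFun := (LinearMap.toSpanSingleton k (SelfExt X 0) (Abelian.Ext.mk₀ (𝟙 X))).toAddMonoidHom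
  map_one := one_smul k (Abelian.Ext.mk₀ (𝟙 X))
  map_mul r s := by
    refine Eq.trans ?_ (selfExt_mul _ _ (add_zero 0)).symm
    simp [mul_smul, smul_comm r s]
  commutes := by
    rintro r ⟨n, α⟩
    refine (selfExt_mul _ _ (add_zero n)).trans (Eq.trans ?_ (selfExt_mul _ _ (zero_add n)).symm)
    simp
  smul_def := by
    rintro r ⟨n, α⟩
    refine Eq.trans ?_ (selfExt_mul _ _ (add_zero n)).symm
    change GradedMonoid.mk n (r • α) = _
    simp

variable (k : Type u) [Field k] {A : Type u} [Ring A] [Algebra k A] (ε : A →ₐ[k] k)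

/-- The left `A`-module `k` on which `A` acts through the augmentation. -/
abbrev trivialModule : ModuleCat.{u} A := ModuleCat.of A (Aug ε)

/-- The Yoneda algebra `E(A) = ⨁ₙ Extⁿ_A(k, k)` of an augmented algebra. -/
abbrev YonedaAlgebra : Type u := ⨁ n, SelfExt (trivialModule k ε) n

/-- An augmented algebra is `𝒦₂` if its Yoneda algebra is generated in (cohomological) degrees
`1` and `2` as an algebra over `k`. -/
def IsK2 : Prop :=
  Algebra.adjoin k
    (Set.range (DirectSum.of (SelfExt (trivialModule k ε)) 1) ∪
      Set.range (DirectSum.of (SelfExt (trivialModule k ε)) 2)) =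
    (⊤ : Subalgebra k (YonedaAlgebra k ε))

end YonedaAlgebra

section SuperJordanPlane

variable (k : Type u) [Field k]

/-- The defining relations `x² = 0` and `y²x = xy² + xyx`, with `x = ι 0`, `y = ι 1`. -/
inductive SJRel : FreeAlgebra k (Fin 2) → FreeAlgebra k (Fin 2) → Prop
  | xx : SJRel (FreeAlgebra.ι k 0 * FreeAlgebra.ι k 0) 0
  | yyx : SJRel
      (FreeAlgebra.ι k 1 * FreeAlgebra.ι k 1 * FreeAlgebra.ι k 0)
      (FreeAlgebra.ι k 0 * FreeAlgebra.ι k 1 * FreeAlgebra.ι k 1 +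
        FreeAlgebra.ι k 0 * FreeAlgebra.ι k 1 * FreeAlgebra.ι k 0)

/-- The super Jordan plane `A = k⟨x, y⟩ / (x², y²x - xy² - xyx)`. -/
def SJ : Type u := RingQuot (SJRel k)

instance : Ring (SJ k) := inferInstanceAs (Ring (RingQuot (SJRel k)))

instance : Algebra k (SJ k) := inferInstanceAs (Algebra k (RingQuot (SJRel k)))

namespace SJ

/-- The quotient map from the free algebra. -/
def proj : FreeAlgebra k (Fin 2) →ₐ[k] SJ k := RingQuot.mkAlgHom k (SJRel k)

/-- The generator `x`. -/
def x : SJ k := proj k (FreeAlgebra.ι k 0)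

/-- The generator `y`. -/
def y : SJ k := proj k (FreeAlgebra.ι k 1)

/-- The augmentation `A → k`, sending `x` and `y` to `0`. -/
def aug : SJ k →ₐ[k] k :=
  RingQuot.liftAlgHom k ⟨FreeAlgebra.lift k (fun _ => 0), by
    intro a b h
    cases h <;> simp⟩

@[simp] lemma aug_proj (w : FreeAlgebra k (Fin 2)) :
    aug k (proj k w) = FreeAlgebra.lift k (fun _ => (0 : k)) w :=
  RingQuot.liftAlgHom_mkAlgHom_apply k _ _ _

@[simp] lemma aug_x : aug k (x k) = 0 := by simp [x]

@[simp] lemma aug_y : aug k (y k) = 0 := by simp [y]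

/-- Names of the free generators of the resolution in each degree: `1 ⊗ 1` in degree `0`,
`1 ⊗ xⁿ ⊗ 1` in degree `n ≥ 1`, `1 ⊗ y ⊗ 1` in degree `1`, and
`1 ⊗ y²xⁿ⁻¹ ⊗ 1` in degree `n ≥ 2`. -/
inductive Gen : ℕ → Type
  | one : Gen 0
  | xPow (n : ℕ) : Gen (n + 1)
  | y : Gen 1
  | yyx (n : ℕ) : Gen (n + 2)

/-- The free `A`-bimodule `P_n A` on the generators of degree `n`. -/
abbrev P (n : ℕ) : Type u := Gen n →₀ Env k (SJ k)

variable {k} in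
/-- The element `a ⊗ g ⊗ b` of `P_n A`, for a generator `g`. -/
def el {n : ℕ} (a : SJ k) (g : Gen n) (b : SJ k) : P k n := Finsupp.single g (Env.mk k a b)

/-- The values of the differential of the minimal resolution on the free generators. -/
def dGen : (n : ℕ) → Gen (n + 1) → P k n
  | 0, .xPow 0 => el (x k) .one 1 - el 1 .one (x k)
  | 0, .y => el (y k) .one 1 - el 1 .one (y k)
  | n + 1, .xPow _ => el (x k) (.xPow n) 1 + (-1 : k) ^ n • el 1 (.xPow n) (x k)
  | 1, .yyx 0 =>
      el (y k ^ 2) (.xPow 0) 1 + el (y k) .y (x k) + el 1 .y (y k * x k)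
        - (el (x k * y k) .y 1 + el (x k) .y (y k) + el 1 (.xPow 0) (y k ^ 2))
        - (el (x k * y k) (.xPow 0) 1 + el (x k) .y (x k) + el 1 (.xPow 0) (y k * x k))
  | n + 2, .yyx _ =>
      el (y k ^ 2) (.xPow (n + 1)) 1 + (-1 : k) ^ (n + 1) • el 1 (.yyx n) (x k)
        - (el (x k) (.yyx n) 1 + el (x k * y k) (.xPow (n + 1)) 1
          + el 1 (.xPow (n + 1)) (y k ^ 2) + el 1 (.xPow (n + 1)) (y k * x k))

/-- The differential `P_{n+1} A → P_n A`. -/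
def d (n : ℕ) : P k (n + 1) →ₗ[Env k (SJ k)] P k n :=
  Finsupp.linearCombination (Env k (SJ k)) (dGen k n)

/-- The bimodule map `P_n A → k` with prescribed values on the generators `1 ⊗ g ⊗ 1`. -/
def dual {n : ℕ} (c : Gen n → k) : P k n →ₗ[Env k (SJ k)] Aug (aug k) :=
  Finsupp.linearCombination (Env k (SJ k)) fun g => algebraMap k (Aug (aug k)) (c g)

/-- `ηⁿ(1 ⊗ xⁿ ⊗ 1) = 1` and `ηⁿ` vanishes on the other generator; `η⁰(1 ⊗ 1) = 1`. -/
def etaP (n : ℕ) : P k n →ₗ[Env k (SJ k)] Aug (aug k) :=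
  dual k fun
    | .one => 1
    | .xPow _ => 1
    | .y => 0
    | .yyx _ => 0

/-- `ω¹(1 ⊗ y ⊗ 1) = 1`, `ωⁿ(1 ⊗ y²xⁿ⁻¹ ⊗ 1) = 1` for `n ≥ 2`, and `ωⁿ(1 ⊗ xⁿ ⊗ 1) = 0`.
(There is no `ω⁰`; the map below is zero for `n = 0`.) -/
def omegaP (n : ℕ) : P k n →ₗ[Env k (SJ k)] Aug (aug k) :=
  dual k fun
    | .one => 0
    | .xPow _ => 0
    | .y => 1
    | .yyx _ => 1

lemma map_el {n : ℕ} (L : P k n →ₗ[Env k (SJ k)] Aug (aug k)) (a b : SJ k) (g : Gen n) :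
    L (el a g b) = (aug k a * aug k b) • L (Finsupp.single g 1) := by
  have h : el a g b = Env.mk k a b • Finsupp.single g 1 := by
    simp [el]
  rw [h, map_smul, env_mk_smul]

/-- Minimality. -/
lemma map_d {n : ℕ} (L : P k n →ₗ[Env k (SJ k)] Aug (aug k)) (z : P k (n + 1)) :
    L (d k n z) = 0 := by
  suffices h : L ∘ₗ d k n = 0 from LinearMap.congr_fun h z
  apply Finsupp.lhom_ext'
  intro g
  apply LinearMap.ext_ring
  change L (Finsupp.linearCombination (Env k (SJ k)) (dGen k n) (Finsupp.single g 1)) = 0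
  rw [Finsupp.linearCombination_single, one_smul]
  match n, g with
  | 0, .xPow 0 => simp [dGen, map_el k L]
  | 0, .y => simp [dGen, map_el k L]
  | n + 1, .xPow _ => simp [dGen, map_el k L]
  | 1, .yyx 0 => simp [dGen, map_el k L]
  | n + 2, .yyx _ => simp [dGen, map_el k L]

/-- A comparison morphism: a morphism of complexes of bimodules `f : P_• A → B_• A` with
`f₀ = id : A ⊗ A → A ⊗ A`. -/
structure Comparison where
  f : ∀ n, P k n →ₗ[Env k (SJ k)] Bar k (SJ k) n
  f_zero : f 0 (el 1 .one 1) = barOne k (SJ k) 0 Fin.elim0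
  comm : ∀ n z, barD k (SJ k) n (f (n + 1) z) = f n (d k n z)

variable {k} in
/-- The map `H^n(A, k) → Hom_{Aᵉ}(P_n A, k)` that a comparison morphism `f` induces, sending the
class of a cocycle `φ`, viewed as bimodule map `B_n A → k`, to `φ ∘ f_n`. (The differentials of
`Hom_{Aᵉ}(P_• A, k)` vanish, so the target is the `n`-th cohomology of that complex.) -/
def Comparison.pullback (F : Comparison k) (n : ℕ) :
    HAug (aug k) n →ₗ[k] (P k n →ₗ[Env k (SJ k)] Aug (aug k)) :=
  HH.lift
    { toFun := fun φ => barLift (φ : AugCochain (aug k) n) ∘ₗ F.f n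
      map_add' := fun φ ψ => by
        rw [Submodule.coe_add, barLift_add, LinearMap.add_comp]
      map_smul' := fun c φ => by
        rw [Submodule.coe_smul, barLift_smul, LinearMap.smul_comp]
        rfl } (by
    intro φ hφ
    change barLift (φ : AugCochain (aug k) n) ∘ₗ F.f n = 0
    cases n with
    | zero =>
      have h : (φ : AugCochain (aug k) 0) = 0 := hφ
      have h' := barLift_smul (0 : k) (φ : AugCochain (aug k) 0)
      rw [h, smul_zero, zero_smul] at h'
      rw [h, h', LinearMap.zero_comp]
    | succ n =>
      obtain ⟨ψ, hψ⟩ := hφ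
      refine LinearMap.ext fun z => ?_
      rw [← hψ, LinearMap.comp_apply, ← barLift_comp_barD, F.comm]
      exact map_d k (barLift ψ ∘ₗ F.f n) z)

lemma Comparison.pullback_mk (F : Comparison k) {n : ℕ} (φ : cocycles k (SJ k) (Aug (aug k)) n) :
    F.pullback n (HH.mk φ) = barLift (φ : AugCochain (aug k) n) ∘ₗ F.f n := rfl

end SJ

end SuperJordanPlane

section Presentation

variable (k : Type u) [Field k]

/-- The relations of the presented algebra; `ι 0`, `ι 1`, `ι 2` stand for `η¹`, `ω¹`, `ω²`. -/
inductive PresRel : FreeAlgebra k (Fin 3) → FreeAlgebra k (Fin 3) → Prop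
  | w1w1 : PresRel (FreeAlgebra.ι k 1 * FreeAlgebra.ι k 1) 0
  | w2w2 : PresRel (FreeAlgebra.ι k 2 * FreeAlgebra.ι k 2) 0
  | w1w2 : PresRel (FreeAlgebra.ι k 1 * FreeAlgebra.ι k 2) 0
  | w2w1 : PresRel (FreeAlgebra.ι k 2 * FreeAlgebra.ι k 1) 0
  | w1e1 : PresRel (FreeAlgebra.ι k 1 * FreeAlgebra.ι k 0) 0
  | e1w1 : PresRel (FreeAlgebra.ι k 0 * FreeAlgebra.ι k 1) 0
  | w2e1 : PresRel
      (FreeAlgebra.ι k 2 * FreeAlgebra.ι k 0 + FreeAlgebra.ι k 0 * FreeAlgebra.ι k 2) 0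

/-- The algebra `k⟨η¹, ω¹, ω²⟩` modulo the two-sided ideal generated by
`(ω¹)², (ω²)², ω¹ω², ω²ω¹, ω¹η¹, η¹ω¹, ω²η¹ + η¹ω²`. -/
abbrev Pres : Type u := RingQuot (PresRel k)

/-- The image of the `i`-th free generator. -/
def Pres.gen (i : Fin 3) : Pres k := RingQuot.mkAlgHom k (PresRel k) (FreeAlgebra.ι k i)

end Presentation

end Yoneda

end

/-! ### The super Jordan plane: normal forms and annihilators -/

noncomputable section

namespace Yoneda

namespace SJ

section Algebra

variable {k : Type u} [Field k]

/-! The coefficients are trivial on the right, so everything can be read off the complex of left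
modules Q = P ⊗_A k once Q is known to resolve k; exactness of the bimodule complex P itself is
never used. Exactness of Q (`dQ_exact`) is a statement about annihilators in A. With z = xy + yx,
every element of A has the form p + qx, where p and q are combinations of the y^c z^b, and right
multiplication by x and y on such pairs is explicit. The map `normalForm` reads off the pair, so
that equations such as bx = 0 or ax + by = 0 become equations between polynomials in y and z.

All coefficients of the differentials lie in the augmentation ideal, so maps to k vanish on
boundaries (`map_d`, `map_dQ`). Given f : P → B, choose a chain map G from B to Q. Then Gf is
homotopic to the projection P → Q; minimality kills the homotopy, and pullback along f is
surjective. Likewise the composite B → Q → B ⊗_A k of G with the map induced by f is homotopic to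
the projection; composing with a cocycle that f kills exhibits that cocycle as a coboundary, and
pullback is injective.

For products, capping with a p-cocycle ψ on the last p arguments is a chain map of degree −p on B
⊗_A k, and φ ⌣ ψ is its composite with φ. Up to homotopy it may be replaced by any lift of ψ to Q
(`Comparison.pullback_cup`). Explicit lifts of ηᵖ, of ωᵖ for p ≥ 2 and of ω¹ then give the whole
multiplication table.

On the Ext side the same Q is cut into short exact sequences. Dimension shifting and minimality
identify Extⁿ(k, k) with Hom(Q_n, k), and the Yoneda product obeys the same lifting rule
(`Syzygies.coord_comp_eq`). The rule is recorded in `ComputedBy`, so both algebras have the same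
`ProductTable`. The table forces the presentation: the relations reduce every word to a combination
of ηⁿ, ω¹ and ω²ηⁿ, and these map to a basis. The isomorphism with E(A) is the composite of the two
presentations. -/

lemma x_mul_x : x k * x k = 0 := by
  have h := RingQuot.mkAlgHom_rel k (SJRel.xx (k := k))
  rw [map_mul, map_zero] at h
  exact h

lemma y_mul_y_mul_x : y k * y k * x k = x k * y k * y k + x k * y k * x k := by
  have h := RingQuot.mkAlgHom_rel k (SJRel.yyx (k := k))
  simp only [map_mul, map_add] at h
  exact h

/-- The second relation, solved for the element y² − xy that occurs as a coefficient in the left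
resolution. It serves both d² = 0 and the division by x in the exactness proof. -/
lemma sq_sub_mul_x : (y k ^ 2 - x k * y k) * x k = x k * y k ^ 2 := by
  rw [sub_mul, sq, y_mul_y_mul_x]; noncomm_ring

/-- An induction principle: right multiplication by the generators reaches all of `A`. -/
lemma mul_right_induction {p : SJ k → Prop} (one : p 1) (add : ∀ a b, p a → p b → p (a + b))
    (smul : ∀ (c : k) a, p a → p (c • a)) (mul_x : ∀ a, p a → p (a * x k))
    (mul_y : ∀ a, p a → p (a * y k)) (a : SJ k) : p a := by
  obtain ⟨w, rfl⟩ := RingQuot.mkAlgHom_surjective k (SJRel k) a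
  change p (proj k w)
  suffices h : ∀ a, p a → p (a * proj k w) by simpa using h 1 one
  induction w using FreeAlgebra.induction with
  | grade0 c =>
    intro a ha
    rw [AlgHom.commutes, ← Algebra.commutes, ← Algebra.smul_def]
    exact smul c a ha
  | grade1 i =>
    intro a ha
    fin_cases i
    · exact mul_x a ha
    · exact mul_y a ha
  | mul v w hv hw =>
    intro a ha
    rw [map_mul, ← mul_assoc]
    exact hw _ (hv _ ha)
  | add v w hv hw =>
    intro a ha
    rw [map_add, mul_add]
    exact add _ _ (hv _ ha) (hw _ ha)

variable (k) in
/-- The element `z = xy + yx`. -/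
def z : SJ k := x k * y k + y k * x k

lemma z_mul_x : z k * x k = x k * z k := by
  simp only [z, add_mul, mul_add, mul_assoc, x_mul_x]
  rw [← mul_assoc (x k) (x k), x_mul_x]; simp

lemma z_mul_y : z k * y k = y k * z k - x k * z k := by
  have h := y_mul_y_mul_x (k := k)
  have h1 : x k * z k = x k * y k * x k := by
    simp only [z, mul_add, ← mul_assoc, x_mul_x]; simp
  rw [h1]
  simp only [z, add_mul, mul_add, ← mul_assoc, h]
  abel

/-- Moving y across one z costs −xz, and x commutes with z, so the b corrections add up. The factor
b is the source of the derivative in `normalY`. -/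
lemma z_pow_mul_y (b : ℕ) : z k ^ b * y k = y k * z k ^ b - (b : SJ k) * (z k ^ b * x k) := by
  induction b with
  | zero => simp
  | succ b ih =>
    rw [pow_succ, mul_assoc, z_mul_y, mul_sub, ← mul_assoc, ih, ← z_mul_x, ← mul_assoc,
      ← mul_assoc, mul_assoc (z k ^ b) (z k), z_mul_x]
    simp only [sub_mul, mul_assoc, Nat.cast_succ, add_mul]
    simp only [one_mul]
    abel

open Polynomial

variable (k) in
/-- The underlying space of the right regular representation: `(p, q)` stands for `p + q x`, where
`p`, `q` are combinations of the ordered monomials `y^c z^b`. -/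
abbrev Normal : Type u := k[X][X] × k[X][X]

/-- Right multiplication by `x` in normal form. -/
def normalX : Normal k →ₗ[k] Normal k where
  toFun m := (0, m.1)
  map_add' := by simp
  map_smul' := by simp

/-- Right multiplication by `y` in normal form. -/
def normalY : Normal k →ₗ[k] Normal k where
  -- The inner variable `C X` is y and the outer variable `X` is z. For m = (p, q): py = yp − zp′x
  -- by `z_pow_mul_y`, and qxy = qz − qyx, where the correction to qy disappears because x² = 0.
  toFun m := (C X * m.1 + X * m.2, -(X * derivative m.1) - C X * m.2)
  map_add' m m' := by
    ext1
    · simp only [Prod.fst_add, Prod.snd_add]; ring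
    · simp only [Prod.fst_add, Prod.snd_add, map_add]; ring
  map_smul' c m := by
    ext1 <;> simp [smul_sub, smul_add]

lemma normalX_apply (m : Normal k) : normalX m = (0, m.1) := rfl

lemma normalY_apply (m : Normal k) :
    normalY m = (C X * m.1 + X * m.2, -(X * derivative m.1) - C X * m.2) := rfl

variable (k) in
/-- The action of `A` on normal forms by right multiplication. -/
def normalAct : SJ k →ₐ[k] (Module.End k (Normal k))ᵐᵒᵖ :=
  RingQuot.liftAlgHom k ⟨FreeAlgebra.lift k ![op normalX, op normalY], by
    intro a b h
    cases h
    · simp only [map_mul, FreeAlgebra.lift_ι_apply, map_zero]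
      refine MulOpposite.unop_injective (LinearMap.ext fun m => ?_)
      simp [normalX_apply]
    · simp only [map_mul, map_add, FreeAlgebra.lift_ι_apply]
      refine MulOpposite.unop_injective (LinearMap.ext fun m => ?_)
      simp only [Matrix.cons_val_zero, Matrix.cons_val_one, MulOpposite.unop_mul,
        MulOpposite.unop_add, MulOpposite.unop_op, Module.End.mul_apply, LinearMap.add_apply,
        normalX_apply, normalY_apply]
      ext1
      · simp only [Prod.fst_add, map_zero]
        ring
      · simp only [Prod.snd_add, map_add, map_zero, derivative_mul, derivative_X, derivative_C]
        ring⟩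

/-- The normal form of an element of `A`. -/
def normalForm (a : SJ k) : Normal k := (normalAct k a).unop (1, 0)

lemma normalAct_x : normalAct k (x k) = op normalX := by
  refine (RingQuot.liftAlgHom_mkAlgHom_apply k _ _ _).trans ?_
  rw [FreeAlgebra.lift_ι_apply]
  rfl

lemma normalAct_y : normalAct k (y k) = op normalY := by
  refine (RingQuot.liftAlgHom_mkAlgHom_apply k _ _ _).trans ?_
  rw [FreeAlgebra.lift_ι_apply]
  rfl

lemma normalForm_mul_x (a : SJ k) : normalForm (a * x k) = normalX (normalForm a) := by
  simp [normalForm, normalAct_x]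

lemma normalForm_mul_y (a : SJ k) : normalForm (a * y k) = normalY (normalForm a) := by
  simp [normalForm, normalAct_y]

variable (k) in
/-- `y^c z^b ↦ y^c z^b`. -/
def ofPoly : k[X][X] →ₗ[k] SJ k :=
  Polynomial.lsum fun b => LinearMap.mulRight k (z k ^ b) ∘ₗ (aeval (y k)).toLinearMap

lemma ofPoly_monomial (b : ℕ) (c : k[X]) :
    ofPoly k (monomial b c) = aeval (y k) c * z k ^ b := by
  simp [ofPoly, Polynomial.lsum_apply, Polynomial.sum_monomial_index]

variable (k) in
/-- `(p, q) ↦ p + q x`. -/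
def ofNormal : Normal k →ₗ[k] SJ k :=
  LinearMap.coprod (ofPoly k) (LinearMap.mulRight k (x k) ∘ₗ ofPoly k)

lemma ofNormal_apply (m : Normal k) : ofNormal k m = ofPoly k m.1 + ofPoly k m.2 * x k := rfl

/-- Together with `ofNormal_normalY`, this makes evaluation compatible with the right actions, so
evaluating a normal form returns the element. -/
lemma ofNormal_normalX (m : Normal k) : ofNormal k (normalX m) = ofNormal k m * x k := by
  rw [ofNormal_apply, ofNormal_apply, normalX_apply, add_mul, mul_assoc, x_mul_x]
  simp

lemma ofPoly_mul_y (p : k[X][X]) : ofPoly k p * y k =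
    ofPoly k (C X * p) - ofPoly k (X * derivative p) * x k := by
  induction p using Polynomial.induction_on' with
  | add p q hp hq => simp only [map_add, add_mul, mul_add, hp, hq]; abel
  | monomial b c =>
    have h : X * derivative (monomial b c) = monomial b (c * (b : k[X])) := by
      cases b with
      | zero => simp
      | succ b => rw [derivative_monomial, X_mul_monomial]; simp
    rw [h, C_mul_monomial, ofPoly_monomial, ofPoly_monomial, ofPoly_monomial, mul_assoc,
      z_pow_mul_y, mul_comm X c, map_mul, map_mul, aeval_X, map_natCast]
    noncomm_ring

lemma ofNormal_normalY (m : Normal k) : ofNormal k (normalY m) = ofNormal k m * y k := by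
  have h : x k * y k = z k - y k * x k := by rw [z]; abel
  have hz (p : k[X][X]) : ofPoly k p * z k = ofPoly k (X * p) := by
    induction p using Polynomial.induction_on' with
    | add p q hp hq => simp only [map_add, add_mul, mul_add, hp, hq]
    | monomial b c => rw [X_mul_monomial, ofPoly_monomial, ofPoly_monomial, pow_succ, mul_assoc]
  rw [ofNormal_apply, ofNormal_apply, normalY_apply, add_mul, mul_assoc, h, mul_sub, ← mul_assoc,
    ofPoly_mul_y, ofPoly_mul_y, hz]
  simp only [map_add, map_sub, map_neg, sub_mul, neg_mul, mul_assoc, x_mul_x, mul_zero]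
  abel

/-- Every element is determined by its normal form. -/
lemma ofNormal_normalForm (a : SJ k) : ofNormal k (normalForm a) = a := by
  refine mul_right_induction (p := fun a => ofNormal k (normalForm a) = a) ?_ ?_ ?_ ?_ ?_ a
  · have h : normalForm (1 : SJ k) = (monomial 0 1, 0) := by simp [normalForm]
    rw [h, ofNormal_apply, ofPoly_monomial]
    simp
  · intro a b ha hb
    have h : normalForm (a + b) = normalForm a + normalForm b := by simp [normalForm]
    rw [h, map_add, ha, hb]
  · intro c a ha
    have h : normalForm (c • a) = c • normalForm a := by simp [normalForm]
    rw [h, map_smul, ha]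
  · intro a ha
    rw [normalForm_mul_x, ofNormal_normalX, ha]
  · intro a ha
    rw [normalForm_mul_y, ofNormal_normalY, ha]

/-- Right multiplication by x moves the first coordinate into the second, so the first coordinate of
b is zero and only qx is left. -/
lemma exists_eq_mul_x {b : SJ k} (h : b * x k = 0) : ∃ c, b = c * x k := by
  have h' : (normalForm b).1 = 0 := by
    have := normalForm_mul_x b
    rw [h, normalX_apply] at this
    simpa [normalForm] using (congrArg Prod.snd this).symm
  refine ⟨ofPoly k (normalForm b).2, ?_⟩
  conv_lhs => rw [← ofNormal_normalForm b, ofNormal_apply, h']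
  simp

/-- If p is the first coordinate of b, the first coordinate of bxy is zp, and z can be cancelled in
the polynomial ring. -/
lemma mul_x_eq_zero_of_mul_x_mul_y {b : SJ k} (h : b * x k * y k = 0) : b * x k = 0 := by
  have h' : (normalForm b).1 = 0 := by
    have := normalForm_mul_y (b * x k)
    rw [h, normalForm_mul_x, normalY_apply, normalX_apply] at this
    simpa [normalForm] using (congrArg Prod.fst this).symm
  rw [← ofNormal_normalForm (b * x k), normalForm_mul_x, normalX_apply, h']
  exact map_zero _

/-- The first coordinate of ax is zero, so b = (p, q) satisfies yp + zq = 0. The terms free of z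
show that z divides p; writing p = zr gives q = −yr, and (zr, −yr) is the normal form of rxy. -/
lemma exists_eq_mul_x_mul_y {a b : SJ k} (h : a * x k + b * y k = 0) :
    ∃ c, b = c * x k * y k := by
  have h' : C X * (normalForm b).1 + X * (normalForm b).2 = 0 := by
    have h1 : normalForm (a * x k + b * y k) = normalForm (a * x k) + normalForm (b * y k) := by
      simp [normalForm]
    rw [h, normalForm_mul_x, normalForm_mul_y, normalX_apply, normalY_apply] at h1
    simpa [normalForm] using (congrArg Prod.fst h1).symm
  generalize hp : (normalForm b).1 = p at h'
  generalize hq : (normalForm b).2 = q at h'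
  obtain ⟨r, rfl⟩ : X ∣ p := by
    rw [X_dvd_iff]
    simpa using congrArg (coeff · 0) h'
  have hr : q = - (C X * r) := by
    have : X * (q + C X * r) = 0 := by rw [← h']; ring
    exact eq_neg_of_add_eq_zero_left ((mul_eq_zero.1 this).resolve_left X_ne_zero)
  refine ⟨ofPoly k r, ?_⟩
  have e : normalForm b = normalY (0, r) := by
    rw [normalY_apply]; ext1 <;> simp [hp, hq, hr]
  rw [← ofNormal_normalForm b, e, ofNormal_normalY, ofNormal_apply]
  simp

lemma exists_eq_mul_x_add_mul_y {a : SJ k} (h : aug k a = 0) : ∃ b c, a = b * x k + c * y k := by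
  suffices H : ∃ b c, a = algebraMap k _ (aug k a) + (b * x k + c * y k) by
    simpa [h] using H
  refine mul_right_induction
    (p := fun a => ∃ b c, a = algebraMap k _ (aug k a) + (b * x k + c * y k)) ?_ ?_ ?_ ?_ ?_ a
  · exact ⟨0, 0, by simp⟩
  · rintro a a' ⟨b, c, h⟩ ⟨b', c', h'⟩
    refine ⟨b + b', c + c', ?_⟩
    conv_lhs => rw [h, h']
    simp only [map_add, add_mul]
    abel
  · rintro r a ⟨b, c, h⟩
    refine ⟨r • b, r • c, ?_⟩
    conv_lhs => rw [h]
    simp [Algebra.smul_def, mul_add, mul_assoc]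
  · intro a _
    exact ⟨a, 0, by simp⟩
  · intro a _
    exact ⟨0, a, by simp⟩

end Algebra
end SJ
end Yoneda
end

/-! ### The left resolution Q of k and explicit lifts of the classes -/

noncomputable section

namespace Yoneda

namespace SJ

section LeftResolution

variable (k : Type u) [Field k]

/-- The free left `A`-module `Q_n = P_n A ⊗_A k` on the generators of degree `n`. -/
abbrev Q (n : ℕ) : Type u := Gen n →₀ SJ k

open Finsupp (single)

/-- The values of the differential of `P_• A ⊗_A k` on the free generators. -/
def dQGen : (n : ℕ) → Gen (n + 1) → Q k n
  | 0, .xPow 0 => single .one (x k)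
  | 0, .y => single .one (y k)
  | n + 1, .xPow _ => single (.xPow n) (x k)
  | 1, .yyx 0 => single (.xPow 0) (y k ^ 2 - x k * y k) - single .y (x k * y k)
  | n + 2, .yyx _ => single (.xPow (n + 1)) (y k ^ 2 - x k * y k) - single (.yyx n) (x k)

/-- The differential of the left resolution `P_• A ⊗_A k` of `k`. -/
def dQ (n : ℕ) : Q k (n + 1) →ₗ[SJ k] Q k n :=
  Finsupp.linearCombination (SJ k) (dQGen k n)

variable {k}

lemma dQ_single {n : ℕ} (g : Gen (n + 1)) (a : SJ k) : dQ k n (single g a) = a • dQGen k n g :=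
  Finsupp.linearCombination_single ..

lemma Q.zero_eq (q : Q k 0) : q = single .one (q .one) := by
  ext g; cases g; simp

lemma Q.one_eq (q : Q k 1) : q = single (.xPow 0) (q (.xPow 0)) + single .y (q .y) := by
  ext g; cases g <;> simp

lemma Q.add_two_eq {n : ℕ} (q : Q k (n + 2)) :
    q = single (.xPow (n + 1)) (q (.xPow (n + 1))) + single (.yyx n) (q (.yyx n)) := by
  ext g; cases g <;> simp

lemma Q.hom_ext {n : ℕ} {M : Type*} [AddCommMonoid M] [Module (SJ k) M] {f f' : Q k n →ₗ[SJ k] M}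
    (h : ∀ g, f (single g 1) = f' (single g 1)) : f = f' :=
  Finsupp.lhom_ext' fun g => LinearMap.ext_ring (h g)

lemma dQ_comp_dQ (n : ℕ) : dQ k n ∘ₗ dQ k (n + 1) = 0 := by
  refine Q.hom_ext fun g => ?_
  rw [LinearMap.comp_apply, dQ_single, one_smul, LinearMap.zero_apply]
  match n, g with
  | 0, .xPow _ => simp [dQGen, dQ_single, x_mul_x]
  | 0, .yyx _ =>
    simp only [dQGen, map_sub, dQ_single, Finsupp.smul_single, smul_eq_mul, sq_sub_mul_x]
    rw [mul_assoc, sq, sub_self]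
  | n + 1, .xPow _ => simp [dQGen, dQ_single, x_mul_x]
  | 1, .yyx _ =>
    simp only [dQGen, map_sub, dQ_single, Finsupp.smul_single, smul_eq_mul, sq_sub_mul_x, smul_sub]
    simp [mul_sub, sq, ← mul_assoc, x_mul_x]
  | n + 2, .yyx _ =>
    simp only [dQGen, map_sub, dQ_single, Finsupp.smul_single, smul_eq_mul, sq_sub_mul_x, smul_sub,
      x_mul_x]
    simp [mul_sub, sq, ← mul_assoc, x_mul_x]

lemma exists_dQ_zero_eq {q : Q k 0} (h : aug k (q .one) = 0) : ∃ r, dQ k 0 r = q := by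
  obtain ⟨b, c, e⟩ := exists_eq_mul_x_add_mul_y h
  refine ⟨single (.xPow 0) b + single .y c, ?_⟩
  rw [q.zero_eq, e, map_add, dQ_single, dQ_single]
  simp [dQGen]

/-- Let a and b be the coefficients of q. The annihilator lemmas give b = cxy in degree 1 and b = cx
above, and −c is the coefficient of the y²x-type generator in a preimage. By `sq_sub_mul_x` the
remainder a + c(y² − xy) is killed by x on the right, so it is ex, which is hit by the next power of
x. -/
lemma dQ_exact (n : ℕ) {q : Q k (n + 1)} (h : dQ k n q = 0) : ∃ r, dQ k (n + 1) r = q := by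
  match n with
  | 0 =>
    rw [q.one_eq] at h ⊢
    generalize q (.xPow 0) = a at h ⊢
    generalize q .y = b at h ⊢
    rw [map_add, dQ_single, dQ_single] at h
    simp only [dQGen, Finsupp.smul_single, smul_eq_mul, ← Finsupp.single_add,
      Finsupp.single_eq_zero] at h
    obtain ⟨c, rfl⟩ := exists_eq_mul_x_mul_y h
    have h' : (a + c * (y k ^ 2 - x k * y k)) * x k = 0 := by
      rw [← h, add_mul, mul_assoc c, sq_sub_mul_x]; noncomm_ring
    obtain ⟨e, he⟩ := exists_eq_mul_x h'
    refine ⟨single (.xPow 1) e + single (.yyx 0) (-c), ?_⟩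
    rw [map_add, dQ_single, dQ_single]
    simp only [dQGen, smul_sub, Finsupp.smul_single, smul_eq_mul, ← he, neg_mul,
      Finsupp.single_add, Finsupp.single_neg, mul_assoc]
    abel
  | n + 1 =>
    rw [q.add_two_eq] at h ⊢
    generalize q (.xPow (n + 1)) = a at h ⊢
    generalize q (.yyx n) = b at h ⊢
    have key : b * x k = 0 ∧ a * x k + b * (y k ^ 2 - x k * y k) = 0 := by
      rw [map_add, dQ_single, dQ_single] at h
      cases n with
      | zero =>
        have h1 := DFunLike.congr_fun h (.xPow 0)
        have h2 := DFunLike.congr_fun h .y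
        simp [dQGen] at h1 h2
        -- In degree 2 the equation on the generator y is only bxy = 0; the factor y has to be
        -- cancelled.
        exact ⟨mul_x_eq_zero_of_mul_x_mul_y (by rwa [mul_assoc]), h1⟩
      | succ n =>
        have h1 := DFunLike.congr_fun h (.xPow (n + 1))
        have h2 := DFunLike.congr_fun h (.yyx n)
        simp [dQGen] at h1 h2
        exact ⟨h2, h1⟩
    obtain ⟨c, rfl⟩ := exists_eq_mul_x key.1
    have h' : (a + c * (y k ^ 2 - x k * y k)) * x k = 0 := by
      rw [← key.2, add_mul, mul_assoc c, sq_sub_mul_x]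
      simp [mul_assoc, mul_sub, ← mul_assoc (x k) (x k), x_mul_x]
    obtain ⟨e, he⟩ := exists_eq_mul_x h'
    refine ⟨single (.xPow (n + 2)) e + single (.yyx (n + 1)) (-c), ?_⟩
    rw [map_add, dQ_single, dQ_single]
    simp only [dQGen, smul_sub, Finsupp.smul_single, smul_eq_mul, ← he, neg_mul,
      Finsupp.single_add, Finsupp.single_neg]
    abel

/-- The left module map `Q_n → k` with prescribed values on the generators. -/
def dualQ {n : ℕ} (c : Gen n → k) : Q k n →ₗ[SJ k] Aug (aug k) :=
  Finsupp.linearCombination (SJ k) fun g => algebraMap k (Aug (aug k)) (c g)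

lemma aug_smul_def (a : SJ k) (c : Aug (aug k)) : a • c = (aug k a • c : Aug (aug k)) := rfl

lemma dualQ_single {n : ℕ} (c : Gen n → k) (g : Gen n) (a : SJ k) :
    dualQ c (single g a) = algebraMap k (Aug (aug k)) (aug k a * c g) := by
  rw [dualQ, Finsupp.linearCombination_single, aug_smul_def, map_mul, Algebra.smul_def]

/-- Minimality of the left resolution. -/
lemma map_dQ {n : ℕ} (L : Q k n →ₗ[SJ k] Aug (aug k)) (z : Q k (n + 1)) : L (dQ k n z) = 0 := by
  suffices h : L ∘ₗ dQ k n = 0 from LinearMap.congr_fun h z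
  have hL (g : Gen n) (a : SJ k) : L (single g a) = (aug k a • L (single g 1) : Aug (aug k)) := by
    rw [← aug_smul_def, ← map_smul, Finsupp.smul_single, smul_eq_mul, mul_one]
  refine Q.hom_ext fun g => ?_
  rw [LinearMap.comp_apply, dQ_single, one_smul, LinearMap.zero_apply]
  match n, g with
  | 0, .xPow 0 => rw [dQGen, hL]; simp
  | 0, .y => rw [dQGen, hL]; simp
  | n + 1, .xPow _ => rw [dQGen, hL]; simp
  | 1, .yyx 0 => rw [dQGen, map_sub, hL, hL .y]; simp
  | n + 2, .yyx _ => rw [dQGen, map_sub, hL, hL (.yyx n)]; simp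

/-- The family `g n m : Q_m → Q_n`, relevant for `m = n + p`, is a morphism of complexes of degree
`-p` that lifts the map `Q_p → k` with values `c`. -/
structure IsLift (p : ℕ) (c : Gen p → k) (g : ∀ n m, Q k m →ₗ[SJ k] Q k n) : Prop where
  comm : ∀ n m, m = n + p → dQ k n ∘ₗ g (n + 1) (m + 1) = g n m ∘ₗ dQ k m
  zero : dualQ (fun _ => 1) ∘ₗ g 0 p = dualQ c

variable (k) in
/-- The coordinates of `ηⁿ`. -/
def etaC : (n : ℕ) → Gen n → k
  | _, .one => 1
  | _, .xPow _ => 1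
  | _, .y => 0
  | _, .yyx _ => 0

variable (k) in
/-- The coordinates of `ωⁿ`. -/
def omegaC : (n : ℕ) → Gen n → k
  | _, .one => 0
  | _, .xPow _ => 0
  | _, .y => 1
  | _, .yyx _ => 1

/-- The values of `etaLift` on generators. -/
def etaLiftGen : (n m : ℕ) → Gen m → Q k n
  | 0, _, .xPow _ => single .one 1
  | n + 1, _, .xPow _ => single (.xPow n) 1
  -- The choice satisfies (y − x)y = y² − xy, the coefficient of the x-power in the differential of
  -- y²x^m. Multiplied by x on the left it becomes xy, matching the y-term in the differential of
  -- y²x.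
  | 1, _, .yyx _ => single .y (y k - x k)
  | n + 2, _, .yyx _ => single (.yyx n) 1
  | _, _, _ => 0

variable (k) in
/-- A lift of `ηᵖ`, `p ≥ 1`. -/
def etaLift (n m : ℕ) : Q k m →ₗ[SJ k] Q k n := Finsupp.linearCombination (SJ k) (etaLiftGen n m)

/-- The values of `omegaLift` on generators. -/
def omegaLiftGen : (n m : ℕ) → Gen m → Q k n
  | 0, _, .yyx _ => single .one 1
  -- The y²x-type generators map to one another with coefficient −x, the powers of x with
  -- coefficient x, so the sign alternates. It becomes the sign in ηᵠωᵖ = (−1)ᵠωᵖ⁺ᵠ.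
  | n + 1, _, .yyx _ => single (.xPow n) ((-1) ^ (n + 1))
  | _, _, _ => 0

variable (k) in
/-- A lift of `ωᵖ`, `p ≥ 2`. -/
def omegaLift (n m : ℕ) : Q k m →ₗ[SJ k] Q k n :=
  Finsupp.linearCombination (SJ k) (omegaLiftGen n m)

/-- The values of `omegaOneLift` on generators. -/
def omegaOneLiftGen : (n m : ℕ) → Gen m → Q k n
  | 0, _, .y => single .one 1
  -- This compensates the term −xy on the generator y in the differential of y²x. One degree higher
  -- it gets multiplied by x and vanishes, so the lift stops here.
  | 1, 2, .yyx _ => single .y (-x k)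
  | _, _, _ => 0

variable (k) in
/-- A lift of `ω¹`. -/
def omegaOneLift (n m : ℕ) : Q k m →ₗ[SJ k] Q k n :=
  Finsupp.linearCombination (SJ k) (omegaOneLiftGen n m)

lemma etaLift_single {n m : ℕ} (g : Gen m) (a : SJ k) :
    etaLift k n m (single g a) = a • etaLiftGen n m g := Finsupp.linearCombination_single ..

lemma omegaLift_single {n m : ℕ} (g : Gen m) (a : SJ k) :
    omegaLift k n m (single g a) = a • omegaLiftGen n m g := Finsupp.linearCombination_single ..

lemma omegaOneLift_single {n m : ℕ} (g : Gen m) (a : SJ k) :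
    omegaOneLift k n m (single g a) = a • omegaOneLiftGen n m g :=
  Finsupp.linearCombination_single ..

lemma isLift_etaLift (p : ℕ) : IsLift (p + 1) (etaC k (p + 1)) (etaLift k) where
  comm n m h := by
    obtain ⟨m, rfl⟩ : ∃ l, m = l + 1 := ⟨n + p, h⟩
    refine Q.hom_ext fun g => ?_
    rw [LinearMap.comp_apply, LinearMap.comp_apply, dQ_single, etaLift_single, one_smul, one_smul]
    match n, m, g with
    | 0, m, .xPow _ => simp [dQGen, etaLiftGen, etaLift_single, dQ_single]
    | n + 1, m, .xPow _ => simp [dQGen, etaLiftGen, etaLift_single, dQ_single]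
    | 0, 0, .yyx _ =>
      simp [dQGen, etaLiftGen, etaLift_single, dQ_single, sq, -Finsupp.single_mul]
    | 0, m + 1, .yyx _ =>
      simp [dQGen, etaLiftGen, etaLift_single, dQ_single, sq, -Finsupp.single_mul]
    | 1, m + 1, .yyx _ =>
      simp only [dQGen, etaLiftGen, etaLift_single, dQ_single, map_sub, one_smul, smul_sub,
        Finsupp.smul_single, smul_eq_mul, mul_one, x_mul_x, Finsupp.single_sub,
        Finsupp.single_zero, sub_zero]
    | n + 2, m + 1, .yyx _ =>
      simp [dQGen, etaLiftGen, etaLift_single, dQ_single, -Finsupp.single_mul]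
    | n + 1, 0, .yyx _ => omega
  zero := by
    refine Q.hom_ext fun g => ?_
    rw [LinearMap.comp_apply, etaLift_single, one_smul, dualQ_single]
    cases g <;> simp [etaLiftGen, dualQ_single, etaC]

lemma isLift_omegaLift (p : ℕ) : IsLift (p + 2) (omegaC k (p + 2)) (omegaLift k) where
  comm n m h := by
    obtain ⟨m, rfl⟩ : ∃ l, m = l + 2 := ⟨n + p, h⟩
    refine Q.hom_ext fun g => ?_
    rw [LinearMap.comp_apply, LinearMap.comp_apply, dQ_single, omegaLift_single, one_smul, one_smul]
    match n, g with
    | 0, .xPow _ => simp [dQGen, omegaLiftGen, omegaLift_single]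
    | n + 1, .xPow _ => simp [dQGen, omegaLiftGen, omegaLift_single]
    | 0, .yyx _ =>
      simp [dQGen, omegaLiftGen, omegaLift_single, dQ_single, -Finsupp.single_mul]
    | n + 1, .yyx _ =>
      rcases Nat.even_or_odd n with hn | hn <;>
      simp [dQGen, omegaLiftGen, omegaLift_single, dQ_single, pow_succ, hn.neg_one_pow,
        -Finsupp.single_mul]
  zero := by
    refine Q.hom_ext fun g => ?_
    rw [LinearMap.comp_apply, omegaLift_single, one_smul, dualQ_single]
    cases g <;> simp [omegaLiftGen, dualQ_single, omegaC]

lemma isLift_omegaOneLift : IsLift 1 (omegaC k 1) (omegaOneLift k) where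
  comm n m h := by
    subst h
    refine Q.hom_ext fun g => ?_
    rw [LinearMap.comp_apply, LinearMap.comp_apply, dQ_single, omegaOneLift_single, one_smul,
      one_smul]
    match n, g with
    | 0, .xPow _ => simp [dQGen, omegaOneLiftGen, omegaOneLift_single]
    | n + 1, .xPow _ => simp [dQGen, omegaOneLiftGen, omegaOneLift_single]
    | 0, .yyx _ =>
      simp [dQGen, omegaOneLiftGen, omegaOneLift_single, dQ_single, -Finsupp.single_mul]
    | 1, .yyx _ =>
      simp [dQGen, omegaOneLiftGen, omegaOneLift_single, x_mul_x, -Finsupp.single_mul]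
    | n + 2, .yyx _ =>
      simp [dQGen, omegaOneLiftGen, omegaOneLift_single, -Finsupp.single_mul]
  zero := by
    refine Q.hom_ext fun g => ?_
    rw [LinearMap.comp_apply, omegaOneLift_single, one_smul, dualQ_single]
    cases g <;> simp [omegaOneLiftGen, dualQ_single, omegaC]

end LeftResolution
end SJ
end Yoneda
end

noncomputable section

namespace Yoneda

/-! ### The comparison theorem for complexes of projectives -/

section Comparison

variable {R : Type*} [Ring R]

/-- Projectivity applied to the corestriction of f to its range; f itself need not be surjective. -/
lemma exists_comp_eq_of_projective {M N P : Type*} [AddCommGroup M] [Module R M] [AddCommGroup N]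
    [Module R N] [AddCommGroup P] [Module R P] [Module.Projective R P] (f : M →ₗ[R] N)
    (g : P →ₗ[R] N) (h : ∀ z, ∃ m, f m = g z) : ∃ l : P →ₗ[R] M, f ∘ₗ l = g := by
  obtain ⟨l, hl⟩ := Module.projective_lifting_property f.rangeRestrict
    (g.codRestrict (LinearMap.range f) fun z => h z) f.surjective_rangeRestrict
  refine ⟨l, LinearMap.ext fun z => ?_⟩
  exact congrArg Subtype.val (LinearMap.congr_fun hl z)

variable {P B : ℕ → Type*} [∀ n, AddCommGroup (P n)] [∀ n, Module R (P n)]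
  [∀ n, AddCommGroup (B n)] [∀ n, Module R (B n)] [∀ n, Module.Projective R (P n)]
  (dP : ∀ n, P (n + 1) →ₗ[R] P n) (dB : ∀ n, B (n + 1) →ₗ[R] B n)

/-- Comparison theorem, existence: a map in degree `0` from a complex of projectives to an acyclic
complex extends to a morphism of complexes. -/
lemma exists_chainMap (hP : ∀ n, dP n ∘ₗ dP (n + 1) = 0)
    (hB : ∀ n z, dB n z = 0 → ∃ w, dB (n + 1) w = z)
    (f₀ : P 0 →ₗ[R] B 0) (h₀ : ∀ z, ∃ w, dB 0 w = f₀ (dP 0 z)) :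
    ∃ f : ∀ n, P n →ₗ[R] B n, f 0 = f₀ ∧ ∀ n, dB n ∘ₗ f (n + 1) = f n ∘ₗ dP n := by
  -- The recursion carries two consecutive components and the square between them, since that square
  -- is what makes the next lifting problem solvable.
  have step (n : ℕ) (q : {q : (P n →ₗ[R] B n) × (P (n + 1) →ₗ[R] B (n + 1)) //
      dB n ∘ₗ q.2 = q.1 ∘ₗ dP n}) :
      ∃ g : P (n + 2) →ₗ[R] B (n + 2), dB (n + 1) ∘ₗ g = q.1.2 ∘ₗ dP (n + 1) := by
    refine exists_comp_eq_of_projective _ _ fun z => hB n _ ?_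
    have h := LinearMap.congr_fun q.2 (dP (n + 1) z)
    have h' := LinearMap.congr_fun (hP n) z
    simp only [LinearMap.comp_apply, LinearMap.zero_apply] at h h' ⊢
    rw [h, h', map_zero]
  choose next hnext using step
  obtain ⟨f₁, h₁⟩ := exists_comp_eq_of_projective (dB 0) (f₀ ∘ₗ dP 0) h₀
  let S : ∀ n, {q : (P n →ₗ[R] B n) × (P (n + 1) →ₗ[R] B (n + 1)) // dB n ∘ₗ q.2 = q.1 ∘ₗ dP n} :=
    Nat.rec ⟨(f₀, f₁), h₁⟩ fun n q => ⟨(q.1.2, next n q), hnext n q⟩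
  exact ⟨fun n => (S n).1.1, rfl, fun n => (S n).2⟩

/-- Comparison theorem, uniqueness: a morphism of complexes from a complex of projectives to an
acyclic complex which is null-homotopic in degree `0` is null-homotopic. -/
lemma exists_homotopy (hP : ∀ n, dP n ∘ₗ dP (n + 1) = 0)
    (hB : ∀ n z, dB n z = 0 → ∃ w, dB (n + 1) w = z)
    (u : ∀ n, P n →ₗ[R] B n) (hu : ∀ n, dB n ∘ₗ u (n + 1) = u n ∘ₗ dP n)
    (h₀ : ∀ z, ∃ w, dB 0 w = u 0 z) :
    (∃ h, u 0 = dB 0 ∘ₗ h) ∧ ∀ n, ∃ h h', u (n + 1) = dB (n + 1) ∘ₗ h + h' ∘ₗ dP n := by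
  obtain ⟨h, hh⟩ := exists_comp_eq_of_projective (dB 0) (u 0) h₀
  -- The previous stage is needed only after composition with `dP n`, where the older half of the
  -- homotopy drops out because `dP` squares to zero.
  have step (n : ℕ) (h' : P n →ₗ[R] B (n + 1)) (H : dB n ∘ₗ h' ∘ₗ dP n = u n ∘ₗ dP n) :
      ∃ h, dB (n + 1) ∘ₗ h = u (n + 1) - h' ∘ₗ dP n := by
    refine exists_comp_eq_of_projective _ _ fun z => hB n _ ?_
    have e := LinearMap.congr_fun H z
    have e' := LinearMap.congr_fun (hu n) z
    simp only [LinearMap.comp_apply, LinearMap.sub_apply, map_sub] at e e' ⊢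
    rw [e, e', sub_self]
  have main (n : ℕ) : ∃ h h', u (n + 1) = dB (n + 1) ∘ₗ h + h' ∘ₗ dP n := by
    induction n with
    | zero =>
      obtain ⟨h', e⟩ := step 0 h (by rw [← LinearMap.comp_assoc, hh])
      exact ⟨h', h, by rw [e]; abel⟩
    | succ n ih =>
      obtain ⟨h', h'', e⟩ := ih
      obtain ⟨h₁, e₁⟩ := step (n + 1) h' (by
        rw [e, LinearMap.add_comp, LinearMap.comp_assoc _ (dP n) h'', hP, LinearMap.comp_zero, add_zero,
          LinearMap.comp_assoc])
      exact ⟨h₁, h', by rw [e₁]; abel⟩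
  exact ⟨⟨h, hh.symm⟩, main⟩

end Comparison

/-! ### The contracting homotopy shared by the bar complex and its left version -/

section Hochschild

variable {k : Type u} [Field k] {A : Type u} [Ring A] [Algebra k A]

section Contraction

variable {M : ℕ → Type u} [∀ n, AddCommGroup (M n)] [∀ n, Module k (M n)]
  [∀ n, Module (Env k A) (M n)] [∀ n, IsScalarTower k (Env k A) (M n)]
  (one : ∀ n, Cochain k A (M n) n) (D : ∀ n, M (n + 1) →ₗ[Env k A] M n)
  (s : ∀ n, M n →ₗ[k] M (n + 1))

lemma contractNth_zero_cons {n : ℕ} (a : A) (t : Fin (n + 1) → A) :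
    Fin.contractNth (0 : Fin (n + 1)).castSucc (· * ·) (Fin.cons a t : Fin (n + 2) → A) =
      Fin.cons (a * t 0) (Fin.tail t) := by
  ext l
  refine Fin.cases ?_ (fun l => ?_) l
  · simp [Fin.contractNth]
  · simp [Fin.contractNth, Fin.tail]

lemma contractNth_succ_cons {n : ℕ} (i : Fin n) (a : A) (t : Fin (n + 1) → A) :
    Fin.contractNth i.succ.castSucc (· * ·) (Fin.cons a t : Fin (n + 2) → A) =
      Fin.cons a (Fin.contractNth i.castSucc (· * ·) t) := by
  ext l
  refine Fin.cases ?_ (fun l => ?_) l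
  · simp [Fin.contractNth]
  · simp only [Fin.contractNth, Fin.cons_succ, Fin.val_succ, Fin.val_castSucc]
    simp only [← Fin.succ_castSucc, Fin.cons_succ, add_lt_add_iff_right, add_left_inj]

/-- The contracting homotopy of the bar resolution. -/
lemma bar_contraction
    (hD : ∀ n (a : Fin (n + 1) → A), D n (one (n + 1) a) = δ k A (M n) n (one n) a)
    (hs : ∀ n (a b : A) (t : Fin n → A),
      s n (Env.mk k a b • one n t) = Env.mk k 1 b • one (n + 1) (Fin.cons a t))
    (hM : ∀ n, Submodule.span k {z | ∃ (a b : A) (t : Fin n → A), Env.mk k a b • one n t = z} = ⊤)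
    (n : ℕ) (z : M (n + 1)) : D (n + 1) (s (n + 1) z) + s n (D n z) = z := by
  have h : z ∈ Submodule.span k {z | ∃ (a b : A) (t : Fin (n + 1) → A), Env.mk k a b • one (n + 1) t = z} := by
    rw [hM]; trivial
  induction h using Submodule.span_induction with
  | zero => simp
  | add z w _ _ hz hw =>
    simp only [map_add]
    rw [add_add_add_comm, hz, hw]
  | smul c z _ hz =>
    rw [map_smul, LinearMap.map_smul_of_tower, LinearMap.map_smul_of_tower, map_smul, ← smul_add,
      hz]
  | mem z hz =>
    obtain ⟨a, b, t, rfl⟩ := hz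
    -- In D(s z) the leading term is z itself. The contraction of a with t₀, split off here, cancels
    -- s of the leading term of D z; the remaining terms cancel in pairs with opposite signs.
    rw [hs, map_smul, map_smul, hD, hD, δ_apply, δ_apply, Fin.sum_univ_succ]
    simp only [contractNth_zero_cons, contractNth_succ_cons]
    have e1 : Fin.init (Fin.cons a t : Fin (n + 2) → A) = Fin.cons a (Fin.init t) := by
      ext l
      refine Fin.cases ?_ (fun l => ?_) l
      · rfl
      · rfl
    have e2 : (Fin.cons a t : Fin (n + 2) → A) (Fin.last (n + 1)) = t (Fin.last n) := rfl
    rw [e1, e2]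
    simp only [smul_add, Finset.smul_sum, map_add, map_sum, map_smul,
      smul_comm (Env.mk k _ _) ((-1 : k) ^ _), ← mul_smul (Env.mk k _ _), Env.mk_mul_mk, hs,
      mul_one, one_mul, Fin.cons_zero, Fin.tail_cons, Fin.val_succ, Fin.val_zero]
    simp only [pow_succ, mul_neg, neg_smul, neg_neg, mul_one, Finset.sum_neg_distrib, pow_zero,
      one_smul]
    abel

/-- In degree zero the defect of the contraction is the multiplication a ⊗ b ↦ 1 ⊗ ab. -/
lemma bar_contraction_zero
    (hD : ∀ n (a : Fin (n + 1) → A), D n (one (n + 1) a) = δ k A (M n) n (one n) a)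
    (hs : ∀ n (a b : A) (t : Fin n → A),
      s n (Env.mk k a b • one n t) = Env.mk k 1 b • one (n + 1) (Fin.cons a t))
    (a b : A) (t : Fin 0 → A) :
    D 0 (s 0 (Env.mk k a b • one 0 t)) = Env.mk k a b • one 0 t - Env.mk k 1 (a * b) • one 0 t := by
  rw [hs, map_smul, hD, δ_apply]
  have e (t' : Fin 0 → A) : t' = t := Subsingleton.elim _ _
  simp only [smul_add, ← mul_smul (Env.mk k _ _), Env.mk_mul_mk, mul_one, one_mul,
    e, smul_comm _ ((-1 : k) ^ _)]
  simp [sub_eq_add_neg]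

lemma bar_exact
    (hD : ∀ n (a : Fin (n + 1) → A), D n (one (n + 1) a) = δ k A (M n) n (one n) a)
    (hs : ∀ n (a b : A) (t : Fin n → A),
      s n (Env.mk k a b • one n t) = Env.mk k 1 b • one (n + 1) (Fin.cons a t))
    (hM : ∀ n, Submodule.span k {z | ∃ (a b : A) (t : Fin n → A), Env.mk k a b • one n t = z} = ⊤)
    (n : ℕ) (z : M (n + 1)) (hz : D n z = 0) : ∃ w, D (n + 1) w = z :=
  ⟨s (n + 1) z, by simpa [hz] using bar_contraction one D s hD hs hM n z⟩

end Contraction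

end Hochschild
end Yoneda
end

noncomputable section

namespace Yoneda

section Hochschild

variable {k : Type u} [Field k] {A : Type u} [Ring A] [Algebra k A]

/-- Bimodule maps commute with the Hochschild differential. -/
lemma map_δ {M N : Type u} [AddCommGroup M] [Module k M] [Module (Env k A) M]
    [IsScalarTower k (Env k A) M] [AddCommGroup N] [Module k N] [Module (Env k A) N]
    [IsScalarTower k (Env k A) N] (f : M →ₗ[Env k A] N) {n : ℕ} (φ : Cochain k A M n)
    (ψ : Cochain k A N n) (h : ∀ a, f (φ a) = ψ a) (a : Fin (n + 1) → A) :
    f (δ k A M n φ a) = δ k A N n ψ a := by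
  simp only [δ_apply, map_add, map_sum, map_smul, LinearMap.map_smul_of_tower, h]

namespace Env

/-- An induction principle for the enveloping algebra. -/
lemma induction {p : Env k A → Prop} (zero : p 0) (mk : ∀ a b, p (mk k a b))
    (add : ∀ e e', p e → p e' → p (e + e')) (e : Env k A) : p e :=
  TensorProduct.induction_on e zero (fun a b => mk a b.unop) add

end Env

/-! ### Acyclicity of the bar resolution -/

section BarResolution

lemma barOne_apply {n : ℕ} (t : Fin n → A) : barOne k A n t = 1 ⊗ₜ[k] PiTensorProduct.tprod k t :=
  rfl

lemma smul_barOne {n : ℕ} (e : Env k A) (t : Fin n → A) :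
    e • barOne k A n t = e ⊗ₜ[k] PiTensorProduct.tprod k t := by
  rw [barOne_apply, TensorProduct.smul_tmul', smul_eq_mul, mul_one]

lemma barD_barOne (n : ℕ) (a : Fin (n + 1) → A) :
    barD k A n (barOne k A (n + 1) a) = δ k A (Bar k A n) n (barOne k A n) a :=
  barLift_barOne _ _

lemma span_barOne (n : ℕ) :
    Submodule.span k {z | ∃ (a b : A) (t : Fin n → A), Env.mk k a b • barOne k A n t = z} = ⊤ := by
  refine eq_top_iff.2 fun z _ => ?_
  induction z using TensorProduct.induction_on with
  | zero => exact zero_mem _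
  | add z w hz hw => exact add_mem (hz trivial) (hw trivial)
  | tmul e t =>
    induction t using PiTensorProduct.induction_on with
    | smul_tprod r t =>
      rw [TensorProduct.tmul_smul]
      refine Submodule.smul_mem _ _ ?_
      induction e using Env.induction with
      | zero => rw [TensorProduct.zero_tmul]; exact zero_mem _
      | mk a b => exact Submodule.subset_span ⟨a, b, t, smul_barOne _ _⟩
      | add e e' he he' => rw [TensorProduct.add_tmul]; exact add_mem (he trivial) (he' trivial)
    | add s t hs ht => rw [TensorProduct.tmul_add]; exact add_mem (hs trivial) (ht trivial)

variable (k A) in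
/-- `a ⊗ (t₁ ⊗ ⋯ ⊗ tₙ) ⊗ b ↦ 1 ⊗ (a ⊗ t₁ ⊗ ⋯ ⊗ tₙ) ⊗ b`. -/
def barSection (n : ℕ) : Bar k A n →ₗ[k] Bar k A (n + 1) :=
  TensorProduct.lift (show Env k A →ₗ[k] _ from TensorProduct.lift (LinearMap.mk₂ k
    (fun (a : A) (b : Aᵐᵒᵖ) => Algebra.lsmul k k (Bar k A (n + 1)) (Env.mk k 1 b.unop) ∘ₗ
      PiTensorProduct.lift ((barOne k A (n + 1)).curryLeft a))
    (fun a a' b => by rw [map_add, map_add, LinearMap.comp_add])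
    (fun c a b => by rw [map_smul, map_smul, LinearMap.comp_smul])
    (fun a b b' => by rw [MulOpposite.unop_add, Env.mk_add, map_add, LinearMap.add_comp])
    (fun c a b => by rw [MulOpposite.unop_smul, Env.mk_smul, map_smul, LinearMap.smul_comp])))

lemma barSection_smul_barOne (n : ℕ) (a b : A) (t : Fin n → A) :
    barSection k A n (Env.mk k a b • barOne k A n t) =
      Env.mk k 1 b • barOne k A (n + 1) (Fin.cons a t) := by
  rw [smul_barOne]
  change Env.mk k 1 b • PiTensorProduct.lift ((barOne k A (n + 1)).curryLeft a)
    (PiTensorProduct.tprod k t) = _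
  rw [PiTensorProduct.lift.tprod]
  rfl

lemma barD_exact (n : ℕ) (z : Bar k A (n + 1)) (hz : barD k A n z = 0) :
    ∃ w, barD k A (n + 1) w = z :=
  bar_exact (barOne k A) (barD k A) (barSection k A) barD_barOne barSection_smul_barOne span_barOne
    n z hz

lemma barD_zero_barOne (a : A) : barD k A 0 (barOne k A 1 ![a]) =
    Env.mk k a 1 • barOne k A 0 ![] - Env.mk k 1 a • barOne k A 0 ![] := by
  have h := bar_contraction_zero (barOne k A) (barD k A) (barSection k A) barD_barOne
    barSection_smul_barOne a 1 ![]
  rw [barSection_smul_barOne, Env.mk_one_one, one_smul, mul_one] at h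
  exact h

lemma Bar.hom_ext {n : ℕ} {M : Type*} [AddCommGroup M] [Module (Env k A) M]
    {f g : Bar k A n →ₗ[Env k A] M} (h : ∀ t, f (barOne k A n t) = g (barOne k A n t)) :
    f = g := by
  refine LinearMap.ext fun z => ?_
  induction z using TensorProduct.induction_on with
  | zero => simp
  | add z w hz hw => rw [map_add, map_add, hz, hw]
  | tmul e t =>
    induction t using PiTensorProduct.induction_on with
    | smul_tprod r t =>
      rw [← TensorProduct.smul_tmul, ← smul_barOne, map_smul, map_smul, h]
    | add s t hs ht => rw [TensorProduct.tmul_add, map_add, map_add, hs, ht]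

/-- The contraction avoids the sign bookkeeping. Every generator is in the image of s, and ds = 1 −
sd gives dds = d − dsd = sdd, which vanishes by induction. In the base case the two defects of
`bar_contraction_zero` are both the product of the two entries and cancel. -/
lemma barD_comp_barD (n : ℕ) : barD k A n ∘ₗ barD k A (n + 1) = 0 := by
  have contr := bar_contraction (barOne k A) (barD k A) (barSection k A) barD_barOne
    barSection_smul_barOne span_barOne
  have one_eq (n : ℕ) (t : Fin (n + 1) → A) : barOne k A (n + 1) t =
      barSection k A n (Env.mk k (t 0) 1 • barOne k A n (Fin.tail t)) := by
    rw [barSection_smul_barOne, Fin.cons_self_tail, Env.mk_one_one, one_smul]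
  induction n with
  | zero =>
    refine Bar.hom_ext fun t => ?_
    have h0 := bar_contraction_zero (barOne k A) (barD k A) (barSection k A) barD_barOne
      barSection_smul_barOne
    have ht : Fin.tail t = ![t 1] := by
      ext i
      fin_cases i
      rfl
    rw [LinearMap.comp_apply, one_eq, eq_sub_of_add_eq (contr 0 _), map_sub, map_smul, ht,
      barD_zero_barOne, smul_sub, ← mul_smul, ← mul_smul, Env.mk_mul_mk, Env.mk_mul_mk,
      map_sub (barSection k A 0), map_sub, h0, h0]
    simp
  | succ n ih =>
    refine Bar.hom_ext fun t => ?_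
    have h := LinearMap.congr_fun ih
    simp only [LinearMap.comp_apply, LinearMap.zero_apply] at h ⊢
    rw [one_eq, eq_sub_of_add_eq (contr (n + 1) _), map_sub, eq_sub_of_add_eq (contr n _), h,
      map_zero, sub_zero, sub_self]

end BarResolution

end Hochschild

/-! ### The left bar resolution of k -/

section Augmented

variable {k : Type u} [Field k] {A : Type u} [Ring A] [Algebra k A] (ε : A →ₐ[k] k)

/-- `a ⊗ op b ↦ ε(b) a`. -/
def envLeft : Env k A →ₐ[k] A :=
  (Algebra.TensorProduct.lift (AlgHom.id k A)
    ((Algebra.ofId k A).comp (AlgHom.fromOpposite ε fun _ _ => Commute.all _ _))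
    (fun a _ => Algebra.commute_algebraMap_right _ a) : A ⊗[k] Aᵐᵒᵖ →ₐ[k] A)

lemma envLeft_mk (a b : A) : envLeft ε (Env.mk k a b) = ε b • a := by
  rw [Algebra.smul_def, Algebra.commutes]
  rfl

/-- A bimodule on whose right `A` acts through the augmentation. -/
class RightTrivial (M : Type*) [AddCommGroup M] [Module k M] [Module (Env k A) M] : Prop where
  mk_one_smul : ∀ (b : A) (m : M), Env.mk k 1 b • m = ε b • m

instance : RightTrivial ε (Aug ε) where
  mk_one_smul b m := by rw [env_mk_smul, map_one, one_mul]

/-- The term `A ⊗ A^{⊗n} = B_n A ⊗_A k` of the left bar resolution of `k`. -/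
def LeftBar (_ε : A →ₐ[k] k) (n : ℕ) : Type u := A ⊗[k] (⨂[k] _ : Fin n, A)

instance (n : ℕ) : AddCommGroup (LeftBar ε n) :=
  inferInstanceAs (AddCommGroup (A ⊗[k] (⨂[k] _ : Fin n, A)))

instance (n : ℕ) : Module k (LeftBar ε n) :=
  inferInstanceAs (Module k (A ⊗[k] (⨂[k] _ : Fin n, A)))

instance (n : ℕ) : Module A (LeftBar ε n) :=
  inferInstanceAs (Module A (A ⊗[k] (⨂[k] _ : Fin n, A)))

instance (n : ℕ) : IsScalarTower k A (LeftBar ε n) :=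
  inferInstanceAs (IsScalarTower k A (A ⊗[k] (⨂[k] _ : Fin n, A)))

/-- Letting A act on the right through ε keeps the left complex among bimodules, so the Hochschild
differential and the contraction lemmas apply to it unchanged. -/
instance (n : ℕ) : Module (Env k A) (LeftBar ε n) :=
  Module.compHom _ (envLeft ε).toRingHom

variable {ε} in
lemma LeftBar.env_smul_def {n : ℕ} (e : Env k A) (z : LeftBar ε n) : e • z = envLeft ε e • z := rfl

instance (n : ℕ) : IsScalarTower k (Env k A) (LeftBar ε n) where
  smul_assoc r e z := by
    rw [LeftBar.env_smul_def, LeftBar.env_smul_def, map_smul, smul_assoc]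

instance (n : ℕ) : RightTrivial ε (LeftBar ε n) where
  mk_one_smul b z := by
    rw [LeftBar.env_smul_def, envLeft_mk, smul_assoc, one_smul]

/-- `(a₁,…,aₙ) ↦ 1 ⊗ (a₁ ⊗ ⋯ ⊗ aₙ)`. -/
def leftOne (n : ℕ) : Cochain k A (LeftBar ε n) n :=
  (show (⨂[k] _ : Fin n, A) →ₗ[k] LeftBar ε n from
    TensorProduct.mk k A (⨂[k] _ : Fin n, A) 1).compMultilinearMap (PiTensorProduct.tprod k)

lemma smul_leftOne {n : ℕ} (a : A) (t : Fin n → A) :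
    a • leftOne ε n t = (a ⊗ₜ[k] PiTensorProduct.tprod k t : A ⊗[k] (⨂[k] _ : Fin n, A)) := by
  change a • ((1 : A) ⊗ₜ[k] PiTensorProduct.tprod k t : A ⊗[k] (⨂[k] _ : Fin n, A)) = _
  rw [TensorProduct.smul_tmul', smul_eq_mul, mul_one]

lemma mk_smul_leftOne {n : ℕ} (a b : A) (t : Fin n → A) :
    Env.mk k a b • leftOne ε n t = ε b • a • leftOne ε n t := by
  rw [LeftBar.env_smul_def, envLeft_mk, smul_assoc]

variable {ε} in
lemma LeftBar.induction {n : ℕ} {p : LeftBar ε n → Prop} (zero : p 0)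
    (smul : ∀ (r : k) (a : A) t, p (r • a • leftOne ε n t)) (add : ∀ z w, p z → p w → p (z + w))
    (z : LeftBar ε n) : p z := by
  refine TensorProduct.induction_on (motive := p) z zero (fun a t => ?_) add
  induction t using PiTensorProduct.induction_on with
  | smul_tprod r t =>
    have h := smul r a t
    rw [smul_leftOne] at h
    have e : (a ⊗ₜ[k] (r • PiTensorProduct.tprod k t) : A ⊗[k] (⨂[k] _ : Fin n, A)) =
      r • a ⊗ₜ[k] PiTensorProduct.tprod k t := TensorProduct.tmul_smul _ _ _
    exact Eq.mpr (congrArg p e) h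
  | add s t hs ht =>
    have e : (a ⊗ₜ[k] (s + t) : A ⊗[k] (⨂[k] _ : Fin n, A)) = a ⊗ₜ[k] s + a ⊗ₜ[k] t :=
      TensorProduct.tmul_add _ _ _
    exact Eq.mpr (congrArg p e) (add _ _ hs ht)

variable {ε} in
lemma LeftBar.hom_ext {n : ℕ} {M : Type*} [AddCommGroup M] [Module (Env k A) M]
    {f g : LeftBar ε n →ₗ[Env k A] M}
    (h : ∀ t, f (leftOne ε n t) = g (leftOne ε n t)) : f = g := by
  refine LinearMap.ext fun z => ?_
  induction z using LeftBar.induction with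
  | zero => simp
  | add z w hz hw => rw [map_add, map_add, hz, hw]
  | smul r a t =>
    have e : r • a • leftOne ε n t = Env.mk k (r • a) 1 • leftOne ε n t := by
      rw [mk_smul_leftOne, map_one, one_smul, smul_assoc]
    rw [e, map_smul, map_smul, h]

section Lift

variable {M : Type u} [AddCommGroup M] [Module k M] [Module (Env k A) M]
  [IsScalarTower k (Env k A) M]

/-- The map `A ⊗ A^{⊗n} → M`, `a ⊗ (a₁ ⊗ ⋯ ⊗ aₙ) ↦ a φ(a₁,…,aₙ)`, as a linear map. -/
def leftLiftLinear {n : ℕ} (φ : Cochain k A M n) : LeftBar ε n →ₗ[k] M :=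
  show A ⊗[k] (⨂[k] _ : Fin n, A) →ₗ[k] M from TensorProduct.lift (LinearMap.mk₂ k
    (fun (a : A) (t : ⨂[k] _ : Fin n, A) => Env.mk k a 1 • PiTensorProduct.lift φ t)
    (fun a a' t => by rw [Env.add_mk, add_smul]) (fun c a t => by rw [Env.smul_mk, smul_assoc])
    (fun a t t' => by rw [map_add, smul_add]) (fun c a t => by rw [map_smul, smul_comm]))

lemma leftLiftLinear_smul_leftOne {n : ℕ} (φ : Cochain k A M n) (a : A) (t : Fin n → A) :
    leftLiftLinear ε φ (a • leftOne ε n t) = Env.mk k a 1 • φ t := by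
  rw [smul_leftOne]
  change Env.mk k a 1 • PiTensorProduct.lift φ (PiTensorProduct.tprod k t) = _
  rw [PiTensorProduct.lift.tprod]

variable [RightTrivial ε M]

lemma mk_smul_eq (a b : A) (m : M) : Env.mk k a b • m = ε b • Env.mk k a 1 • m := by
  rw [smul_comm, ← RightTrivial.mk_one_smul (ε := ε), ← mul_smul, Env.mk_mul_mk, mul_one, mul_one]

/-- The map `A ⊗ A^{⊗n} → M`, `a ⊗ (a₁ ⊗ ⋯ ⊗ aₙ) ↦ a φ(a₁,…,aₙ)`. -/
def leftLift {n : ℕ} (φ : Cochain k A M n) : LeftBar ε n →ₗ[Env k A] M where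
  toFun := leftLiftLinear ε φ
  map_add' := map_add _
  map_smul' e z := by
    rw [RingHom.id_apply]
    induction z using LeftBar.induction with
    | zero => rw [smul_zero, map_zero, smul_zero]
    | add z w hz hw => rw [smul_add, map_add, hz, hw, map_add, smul_add]
    | smul r a t =>
      rw [smul_comm e r, map_smul (leftLiftLinear ε φ) r, map_smul (leftLiftLinear ε φ) r,
        smul_comm e r]
      congr 1
      rw [LeftBar.env_smul_def, ← mul_smul, leftLiftLinear_smul_leftOne,
        leftLiftLinear_smul_leftOne]
      generalize φ t = m
      induction e using Env.induction with
      | zero =>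
        have h : Env.mk k (0 : A) 1 = 0 := TensorProduct.zero_tmul _ _
        rw [map_zero, zero_mul, h, zero_smul, zero_smul]
      | add e e' he he' => rw [map_add, add_mul, Env.add_mk, add_smul, he, he', add_smul]
      | mk b c =>
        rw [envLeft_mk, ← mul_smul (Env.mk k _ _), Env.mk_mul_mk, one_mul,
          mk_smul_eq ε _ c, smul_mul_assoc, Env.smul_mk, smul_assoc]

lemma leftLift_leftOne {n : ℕ} (φ : Cochain k A M n) (t : Fin n → A) :
    leftLift ε φ (leftOne ε n t) = φ t := by
  have h := leftLiftLinear_smul_leftOne ε φ 1 t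
  rw [one_smul, Env.mk_one_one, one_smul] at h
  exact h

end Lift

/-- The differential of the left bar resolution. -/
def leftD (n : ℕ) : LeftBar ε (n + 1) →ₗ[Env k A] LeftBar ε n :=
  leftLift ε (δ k A (LeftBar ε n) n (leftOne ε n))

lemma leftD_leftOne (n : ℕ) (a : Fin (n + 1) → A) :
    leftD ε n (leftOne ε (n + 1) a) = δ k A (LeftBar ε n) n (leftOne ε n) a :=
  leftLift_leftOne ε _ _

/-- `a ⊗ (t₁ ⊗ ⋯ ⊗ tₙ) ↦ 1 ⊗ (a ⊗ t₁ ⊗ ⋯ ⊗ tₙ)`. -/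
def leftSection (n : ℕ) : LeftBar ε n →ₗ[k] LeftBar ε (n + 1) :=
  show A ⊗[k] (⨂[k] _ : Fin n, A) →ₗ[k] LeftBar ε (n + 1) from
    TensorProduct.lift ((PiTensorProduct.lift (R := k)).toLinearMap ∘ₗ (leftOne ε (n + 1)).curryLeft)

lemma leftSection_smul_leftOne (n : ℕ) (a b : A) (t : Fin n → A) :
    leftSection ε n (Env.mk k a b • leftOne ε n t) =
      Env.mk k 1 b • leftOne ε (n + 1) (Fin.cons a t) := by
  rw [mk_smul_leftOne, mk_smul_leftOne, one_smul, map_smul, smul_leftOne]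
  congr 1
  change PiTensorProduct.lift ((leftOne ε (n + 1)).curryLeft a) (PiTensorProduct.tprod k t) = _
  rw [PiTensorProduct.lift.tprod]
  rfl

lemma span_leftOne (n : ℕ) :
    Submodule.span k {z | ∃ (a b : A) (t : Fin n → A), Env.mk k a b • leftOne ε n t = z} = ⊤ := by
  refine eq_top_iff.2 fun z _ => ?_
  induction z using LeftBar.induction with
  | zero => exact zero_mem _
  | add z w hz hw => exact add_mem (hz trivial) (hw trivial)
  | smul r a t =>
    exact Submodule.smul_mem _ _ (Submodule.subset_span
      ⟨a, 1, t, by rw [mk_smul_leftOne, map_one, one_smul]⟩)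

lemma leftD_exact (n : ℕ) (z : LeftBar ε (n + 1)) (hz : leftD ε n z = 0) :
    ∃ w, leftD ε (n + 1) w = z :=
  bar_exact (leftOne ε) (leftD ε) (leftSection ε) (leftD_leftOne ε) (leftSection_smul_leftOne ε)
    (span_leftOne ε) n z hz

/-- The augmentation `A → k` of the left bar resolution. -/
def leftAug : LeftBar ε 0 →ₗ[Env k A] Aug ε :=
  leftLift ε (scalarCocycle ε 1 : AugCochain ε 0)

lemma leftAug_leftOne (t : Fin 0 → A) : leftAug ε (leftOne ε 0 t) = 1 := by
  rw [leftAug, leftLift_leftOne, scalarCocycle_apply, map_one]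

/-- For the left complex, the defect of the contraction in degree zero is the augmentation of z
times the generator, so the contraction itself supplies the preimage. -/
lemma exists_leftD_zero_eq (z : LeftBar ε 0) (hz : leftAug ε z = 0) : ∃ w, leftD ε 0 w = z := by
  suffices h : leftD ε 0 (leftSection ε 0 z) =
      z - (show k from leftAug ε z) • leftOne ε 0 ![] by
    refine ⟨_, h.trans ?_⟩
    rw [hz]
    exact (congrArg (z - ·) (zero_smul k _)).trans (sub_zero z)
  clear hz
  induction z using LeftBar.induction with
  | zero => simp only [map_zero, zero_sub]; exact (neg_eq_zero.2 (zero_smul k _)).symm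
  | add z w hz hw =>
    rw [map_add, map_add, hz, hw, map_add]
    refine Eq.trans ?_ (congrArg (z + w - ·) (add_smul (R := k) _ _ _).symm)
    abel
  | smul r a t =>
    have ht : t = ![] := Subsingleton.elim _ _
    subst ht
    have h := bar_contraction_zero (leftOne ε) (leftD ε) (leftSection ε) (leftD_leftOne ε)
      (leftSection_smul_leftOne ε) a 1 ![]
    rw [mk_smul_leftOne, mk_smul_leftOne, map_one, one_smul, one_smul, mul_one] at h
    rw [map_smul, LinearMap.map_smul_of_tower, h, smul_sub]
    congr 1
    have e : leftAug ε (r • a • leftOne ε 0 ![]) = algebraMap k (Aug ε) (r * ε a) := by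
      have e' : a • leftOne ε 0 ![] = Env.mk k a 1 • leftOne ε 0 ![] := by
        rw [mk_smul_leftOne, map_one, one_smul]
      rw [LinearMap.map_smul_of_tower, e', map_smul, leftAug_leftOne, env_mk_smul, map_one, mul_one,
        smul_smul, Algebra.algebraMap_eq_smul_one]
    rw [e, smul_smul]
    rfl

end Augmented
end Yoneda
end

noncomputable section

namespace Yoneda

/-! ### Cup products as chain maps of the left bar resolution -/

section Augmented

variable {k : Type u} [Field k] {A : Type u} [Ring A] [Algebra k A] {ε : A →ₐ[k] k}

section Cap

variable {M : Type u} [AddCommGroup M] [Module k M]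

/-- A value of a cochain with coefficients in `k`, as a scalar. -/
def Aug.toField : Aug ε →ₗ[k] k := LinearMap.id

/-- `(a₁,…,aₙ₊ₚ) ↦ ψ(aₙ₊₁,…,aₙ₊ₚ) φ(a₁,…,aₙ)`. -/
def capCochain {n p N : ℕ} (h : N = n + p) (φ : Cochain k A M n) (ψ : AugCochain ε p) :
    Cochain k A M N :=
  ((show M ⊗[k] Aug ε →ₗ[k] M from (TensorProduct.rid k M).toLinearMap).compMultilinearMap
    (φ.domCoprod ψ)).domDomCongr (finSumFinEquiv.trans (finCongr h.symm))

lemma capCochain_apply {n p N : ℕ} (h : N = n + p) (φ : Cochain k A M n) (ψ : AugCochain ε p)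
    (a : Fin N → A) : capCochain h φ ψ a =
      Aug.toField (ψ fun j => a ⟨n + j, by omega⟩) • φ fun i => a ⟨i, by omega⟩ := rfl

variable [Module (Env k A) M] [IsScalarTower k (Env k A) M] [RightTrivial ε M]

/-- Contractions among the first arguments give those of δφ. The contractions that fall inside ψ and
the final term combine, by the cocycle condition on ψ, into the last term of δφ, where right
multiplication is the scalar ε. As ψ takes the last arguments, no sign appears. -/
lemma δ_capCochain {n p : ℕ} (φ : Cochain k A M n) (ψ : AugCochain ε p)
    (hψ : ψ ∈ cocycles k A (Aug ε) p) (a : Fin (n + p + 1) → A) :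
    δ k A M (n + p) (capCochain rfl φ ψ) a =
      capCochain (add_right_comm n p 1) (δ k A M n φ) ψ a := by
  have hψ' := DFunLike.congr_fun (mem_cocycles.1 hψ) (fun j : Fin (p + 1) => a ⟨n + j, by omega⟩)
  rw [δ_apply] at hψ'
  simp only [env_mk_smul, map_one, one_mul, mul_one] at hψ'
  simp only [capCochain_apply, δ_apply, Fin.sum_univ_add]
  have e1 : ∀ i : Fin n, (fun l : Fin n => Fin.contractNth (Fin.castAdd p i).castSucc (· * ·) a
      ⟨l, by omega⟩) =
      Fin.contractNth i.castSucc (· * ·) (fun l : Fin (n+1) => a ⟨l, by omega⟩) := by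
    intro i; ext l
    simp only [Fin.contractNth, Fin.val_castSucc, Fin.val_castAdd]
    split_ifs <;> rfl
  have e2 : ∀ i : Fin n, (fun l : Fin p => Fin.contractNth (Fin.castAdd p i).castSucc (· * ·) a
      ⟨n + l, by omega⟩) = (fun l : Fin p => a ⟨n + 1 + l, by omega⟩) := by
    intro i; ext l
    simp only [Fin.contractNth, Fin.val_castSucc, Fin.val_castAdd]
    rw [if_neg (by omega), if_neg (by omega)]
    congr 1; ext; simp; omega
  have e3 : ∀ i : Fin p, (fun l : Fin n => Fin.contractNth (Fin.natAdd n i).castSucc (· * ·) a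
      ⟨l, by omega⟩) = (fun l : Fin n => a ⟨l, by omega⟩) := by
    intro i; ext l
    simp only [Fin.contractNth, Fin.val_castSucc, Fin.val_natAdd]
    rw [if_pos (by omega)]
    rfl
  have e4 : ∀ i : Fin p, (fun l : Fin p => Fin.contractNth (Fin.natAdd n i).castSucc (· * ·) a
      ⟨n + l, by omega⟩) =
      Fin.contractNth i.castSucc (· * ·) (fun l : Fin (p+1) => a ⟨n + l, by omega⟩) := by
    intro i; ext l
    simp only [Fin.contractNth, Fin.val_castSucc, Fin.val_natAdd, add_lt_add_iff_left,
      add_right_inj]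
    split_ifs <;> rfl
  have t2 : (fun l : Fin p => Fin.tail a ⟨n + l, by omega⟩) =
      (fun l : Fin p => a ⟨n + 1 + l, by omega⟩) := by
    ext l; simp only [Fin.tail]; congr 1; ext; simp; omega
  have t6 : Fin.tail (fun l : Fin (p+1) => a ⟨n + l, by omega⟩) =
      (fun l : Fin p => a ⟨n + 1 + l, by omega⟩) := by
    ext l; simp only [Fin.tail]; congr 1; ext; simp; omega
  simp only [e1, e2, e3, e4, t2]
  rw [t6] at hψ'
  have hψ'' := congrArg Aug.toField hψ'
  simp only [map_add, map_sum, map_smul, smul_eq_mul, zero_apply, map_zero] at hψ''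
  have r1 : (fun i : Fin n => Fin.init a ⟨i, by omega⟩) = fun i : Fin n => a ⟨i, by omega⟩ := rfl
  have r2 : (fun j : Fin p => Fin.init a ⟨n + j, by omega⟩) =
    Fin.init fun l : Fin (p + 1) => a ⟨n + l, by omega⟩ := rfl
  have r3 : (Fin.init fun i : Fin (n + 1) => a ⟨i, by omega⟩) = fun i : Fin n => a ⟨i, by omega⟩ :=
    rfl
  have r4 : (Fin.tail fun i : Fin (n + 1) => a ⟨i, by omega⟩) =
    fun i : Fin n => Fin.tail a ⟨i, by omega⟩ := rfl
  have r5 : a ⟨n + (Fin.last p : Fin (p + 1)), by omega⟩ = a (Fin.last (n + p)) := rfl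
  have r6 : a ⟨n + (0 : Fin (p + 1)), by omega⟩ = a ⟨(Fin.last n : Fin (n + 1)), by omega⟩ := rfl
  rw [r5, r6] at hψ''
  rw [r1, r2, r3, r4]
  simp only [RightTrivial.mk_one_smul (ε := ε)]
  generalize (φ fun i : Fin n => a ⟨i, by omega⟩) = X at hψ'' ⊢
  generalize Aug.toField (ψ fun l : Fin p => a ⟨n + 1 + l, by omega⟩) = Y at hψ'' ⊢
  -- This is the cocycle identity for ψ on the last p + 1 arguments, multiplied by (−1)ⁿ and solved
  -- for its leading term.
  have key : (∑ i : Fin p, (-1 : k) ^ (n + i + 1) * Aug.toField (ψ (Fin.contractNth i.castSucc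
        (· * ·) fun l : Fin (p + 1) => a ⟨n + l, by omega⟩))) +
      (-1) ^ (n + p + 1) * (ε (a (Fin.last (n + p))) *
        Aug.toField (ψ (Fin.init fun l : Fin (p + 1) => a ⟨n + l, by omega⟩))) =
      Y * ((-1) ^ (n + 1) * ε (a ⟨(Fin.last n : Fin (n + 1)), by omega⟩)) := by
    have e (i : ℕ) : (-1 : k) ^ (n + i + 1) = (-1) ^ n * (-1) ^ (i + 1) := by
      rw [add_assoc, pow_add]
    simp only [e, mul_assoc, ← Finset.mul_sum]
    linear_combination (-1 : k) ^ n * hψ''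
  have key' := congrArg (· • X) key
  simp only [add_smul, Finset.sum_smul, mul_smul] at key'
  simp only [smul_add, Finset.smul_sum, Fin.val_castAdd, Fin.val_natAdd]
  rw [← key']
  have r7 (h : 0 < n + p + 1) : a ⟨0, h⟩ = a 0 := rfl
  simp only [smul_comm Y, Fin.val_zero, r7]
  abel

end Cap

/-- The map of left bar resolutions of degree `-p` defined by a `p`-cochain. -/
def capLeft {n p N : ℕ} (h : N = n + p) (ψ : AugCochain ε p) :
    LeftBar ε N →ₗ[Env k A] LeftBar ε n :=
  leftLift ε (capCochain h (leftOne ε n) ψ)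

lemma leftD_comp_capLeft {n p N : ℕ} (h : N = n + p) (h' : N + 1 = n + 1 + p) (ψ : AugCochain ε p)
    (hψ : ψ ∈ cocycles k A (Aug ε) p) :
    leftD ε n ∘ₗ capLeft h' ψ = capLeft h ψ ∘ₗ leftD ε N := by
  subst h
  refine LeftBar.hom_ext fun a => ?_
  rw [LinearMap.comp_apply, LinearMap.comp_apply, capLeft, leftLift_leftOne, leftD_leftOne,
    map_δ (capLeft rfl ψ) (leftOne ε (n + p)) (capCochain rfl (leftOne ε n) ψ)
      fun a => leftLift_leftOne ε _ _, δ_capCochain _ _ hψ, capCochain_apply, capCochain_apply,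
    LinearMap.map_smul_of_tower, leftD_leftOne]

/-- This turns the cup product into composition with a chain map, which may then be replaced by a
homotopic one. -/
lemma leftLift_comp_capLeft {n p : ℕ} (φ : AugCochain ε n) (ψ : AugCochain ε p) :
    leftLift ε φ ∘ₗ capLeft rfl ψ = leftLift ε (cup φ ψ) := by
  refine LeftBar.hom_ext fun a => ?_
  rw [LinearMap.comp_apply, capLeft, leftLift_leftOne, leftLift_leftOne, capCochain_apply,
    LinearMap.map_smul_of_tower, leftLift_leftOne, cup_apply, mul_comm]
  rfl

lemma leftAug_comp_capLeft {p N : ℕ} (h : N = 0 + p) (ψ : AugCochain ε p) (t : Fin N → A) :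
    leftAug ε (capLeft h ψ (leftOne ε N t)) = ψ fun j => t ⟨j, by omega⟩ := by
  rw [capLeft, leftLift_leftOne, capCochain_apply, LinearMap.map_smul_of_tower, leftAug_leftOne]
  simp only [zero_add]
  exact mul_one (M := k) _

/-- The projection `B_n A → B_n A ⊗_A k`. -/
def barProj (ε : A →ₐ[k] k) (n : ℕ) : Bar k A n →ₗ[Env k A] LeftBar ε n := barLift (leftOne ε n)

lemma barProj_barOne (n : ℕ) (t : Fin n → A) : barProj ε n (barOne k A n t) = leftOne ε n t :=
  barLift_barOne _ _

lemma leftD_comp_barProj (n : ℕ) :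
    leftD ε n ∘ₗ barProj ε (n + 1) = barProj ε n ∘ₗ barD k A n := by
  refine Bar.hom_ext fun t => ?_
  rw [LinearMap.comp_apply, LinearMap.comp_apply, barProj_barOne, leftD_leftOne, barD_barOne,
    map_δ (barProj ε n) (barOne k A n) (leftOne ε n) fun a => barProj_barOne n a]

/-- Bimodule maps to k factor through killing the right action; this is what lets left resolutions
compute the cohomology. -/
lemma leftLift_comp_barProj {n : ℕ} (φ : AugCochain ε n) :
    leftLift ε φ ∘ₗ barProj ε n = barLift φ := by
  refine Bar.hom_ext fun t => ?_
  rw [LinearMap.comp_apply, barProj_barOne, leftLift_leftOne, barLift_barOne]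

/-- A cochain is recovered from the bimodule map it defines. -/
def cochainOfBar {n : ℕ} (f : Bar k A n →ₗ[Env k A] Aug ε) : AugCochain ε n :=
  (show Bar k A n →ₗ[k] Aug ε from
    { f with map_smul' := fun c z => LinearMap.map_smul_of_tower f c z }).compMultilinearMap
    (barOne k A n)

lemma barLift_cochainOfBar {n : ℕ} (f : Bar k A n →ₗ[Env k A] Aug ε) :
    barLift (cochainOfBar f) = f :=
  Bar.hom_ext fun t => barLift_barOne (cochainOfBar f) t

lemma cochain_ext {n : ℕ} {φ ψ : AugCochain ε n} (h : barLift φ = barLift ψ) : φ = ψ := by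
  ext t
  rw [← barLift_barOne φ, h, barLift_barOne]

lemma barLift_δ {n : ℕ} (φ : AugCochain ε n) :
    barLift (δ k A (Aug ε) n φ) = barLift φ ∘ₗ barD k A n :=
  LinearMap.ext fun z => (barLift_comp_barD φ z).symm

lemma leftLift_comp_leftD {n : ℕ} (φ : AugCochain ε n) (hφ : φ ∈ cocycles k A (Aug ε) n) :
    leftLift ε φ ∘ₗ leftD ε n = 0 := by
  refine LeftBar.hom_ext fun t => ?_
  rw [LinearMap.comp_apply, leftD_leftOne, map_δ (leftLift ε φ) (leftOne ε n) φ
    fun a => leftLift_leftOne ε φ a, mem_cocycles.1 hφ]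
  rfl

end Augmented
end Yoneda
end

/-! ### The bimodule complex P and its projection onto Q -/

noncomputable section

namespace Yoneda

set_option linter.unusedSimpArgs false

namespace SJ

open Finsupp (single)

variable {k : Type u} [Field k]

section Projection

lemma el_add_left {n : ℕ} (a a' : SJ k) (g : Gen n) (b : SJ k) :
    el (a + a') g b = el a g b + el a' g b := by
  rw [el, Env.add_mk, Finsupp.single_add]; rfl

lemma el_add_right {n : ℕ} (a : SJ k) (g : Gen n) (b b' : SJ k) :
    el a g (b + b') = el a g b + el a g b' := by
  rw [el, Env.mk_add, Finsupp.single_add]; rfl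

lemma el_zero_left {n : ℕ} (g : Gen n) (b : SJ k) : el 0 g b = 0 := by
  simpa using el_add_left 0 0 g b

lemma el_zero_right {n : ℕ} (a : SJ k) (g : Gen n) : el a g 0 = 0 := by
  simpa using el_add_right a g 0 0

lemma mk_smul_el {n : ℕ} (a b a' b' : SJ k) (g : Gen n) :
    Env.mk k a b • el a' g b' = el (a * a') g (b' * b) := by
  rw [el, Finsupp.smul_single, smul_eq_mul, Env.mk_mul_mk]; rfl

lemma d_el {n : ℕ} (a : SJ k) (g : Gen (n + 1)) (b : SJ k) :
    d k n (el a g b) = Env.mk k a b • dGen k n g :=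
  Finsupp.linearCombination_single ..

lemma d_single_one {n : ℕ} (g : Gen (n + 1)) : d k n (single g 1) = dGen k n g := by
  rw [d, Finsupp.linearCombination_single, one_smul]

lemma P.hom_ext {n : ℕ} {M : Type*} [AddCommMonoid M] [Module (Env k (SJ k)) M]
    {f f' : P k n →ₗ[Env k (SJ k)] M} (h : ∀ g, f (single g 1) = f' (single g 1)) : f = f' :=
  Finsupp.lhom_ext' fun g => LinearMap.ext_ring (h g)

lemma d_comp_d (n : ℕ) : d k n ∘ₗ d k (n + 1) = 0 := by
  have hx : ∀ a : SJ k, x k * (x k * a) = 0 := fun a => by rw [← mul_assoc, x_mul_x, zero_mul]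
  have hy : y k * (y k * x k) = x k * (y k * y k) + x k * (y k * x k) := by
    simpa only [mul_assoc] using y_mul_y_mul_x (k := k)
  have hs (n : ℕ) (c : k) (v : P k (n + 1)) : d k n (c • v) = c • d k n v :=
    LinearMap.map_smul_of_tower _ _ _
  have hp (n : ℕ) : (-1 : k) ^ (n + 1) = -(-1) ^ n := by rw [pow_succ, mul_neg_one]
  refine P.hom_ext fun g => ?_
  rw [LinearMap.comp_apply, d_single_one, LinearMap.zero_apply]
  match n, g with
  | 0, .xPow _ =>
    simp only [dGen, map_add, d_el, smul_sub, mk_smul_el, one_mul, mul_one, x_mul_x, el_zero_left, el_zero_right, pow_zero, one_smul]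
    abel
  | 0, .yyx _ =>
    simp only [dGen, map_add, map_sub, d_el, smul_sub, mk_smul_el, one_mul, mul_one, sq, mul_assoc,
      hy, el_add_left, el_add_right]
    abel
  | n + 1, .xPow _ =>
    simp only [dGen, map_add, map_sub, map_neg, hs, d_el, smul_sub, smul_add, mk_smul_el, one_mul, mul_one,
      sq, mul_assoc, hy, el_add_left, el_add_right, hx, x_mul_x, el_zero_left, el_zero_right,
      mul_zero, hp, pow_zero, neg_smul, one_smul, smul_neg, neg_neg, smul_zero,
      smul_comm (Env.mk k _ _) ((-1 : k) ^ _), zero_add]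
    abel
  | 1, .yyx _ =>
    simp only [dGen, map_add, map_sub, map_neg, hs, d_el, smul_sub, smul_add, mk_smul_el, one_mul, mul_one,
      sq, mul_assoc, hy, el_add_left, el_add_right, hx, x_mul_x, el_zero_left, el_zero_right,
      mul_zero, hp, pow_zero, neg_smul, one_smul, smul_neg, neg_neg, smul_zero,
      smul_comm (Env.mk k _ _) ((-1 : k) ^ _), zero_add]
    abel
  | n + 2, .yyx _ =>
    simp only [dGen, map_add, map_sub, map_neg, hs, d_el, smul_sub, smul_add, mk_smul_el, one_mul, mul_one,
      sq, mul_assoc, hy, el_add_left, el_add_right, hx, x_mul_x, el_zero_left, el_zero_right,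
      mul_zero, hp, pow_zero, neg_smul, one_smul, smul_neg, neg_neg, smul_zero,
      smul_comm (Env.mk k _ _) ((-1 : k) ^ _), zero_add]
    abel

instance (n : ℕ) : Module (Env k (SJ k)) (Q k n) :=
  Module.compHom _ (envLeft (aug k)).toRingHom

lemma Q.env_smul_def {n : ℕ} (e : Env k (SJ k)) (q : Q k n) : e • q = envLeft (aug k) e • q := rfl

instance (n : ℕ) : IsScalarTower k (Env k (SJ k)) (Q k n) where
  smul_assoc r e z := by rw [Q.env_smul_def, Q.env_smul_def, map_smul, smul_assoc]

/-- A left module map `Q_n → N` as a bimodule map. -/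
def Q.envMap {n : ℕ} {N : Type*} [AddCommGroup N] [Module (SJ k) N] [Module (Env k (SJ k)) N]
    (hN : ∀ (e : Env k (SJ k)) (v : N), e • v = envLeft (aug k) e • v) (f : Q k n →ₗ[SJ k] N) :
    Q k n →ₗ[Env k (SJ k)] N where
  toFun := f
  map_add' := map_add f
  map_smul' e q := by rw [Q.env_smul_def, map_smul, RingHom.id_apply, hN]

lemma Aug.env_smul_eq (e : Env k (SJ k)) (c : Aug (aug k)) : e • c = envLeft (aug k) e • c := by
  have h : envAug (aug k) e = aug k (envLeft (aug k) e) := by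
    induction e using Env.induction with
    | zero => simp
    | add e e' he he' => simp [he, he']
    | mk a b =>
      rw [envLeft_mk, map_smul, smul_eq_mul, mul_comm]
      rfl
  rw [env_smul_def, h, aug_smul_def]

/-- The projection `P_n A → P_n A ⊗_A k`. -/
def projP (n : ℕ) : P k n →ₗ[Env k (SJ k)] Q k n :=
  Finsupp.linearCombination (Env k (SJ k)) fun g => single g 1

lemma projP_single_one {n : ℕ} (g : Gen n) : projP (k := k) n (single g 1) = single g 1 := by
  rw [projP, Finsupp.linearCombination_single, one_smul]

lemma projP_el {n : ℕ} (a : SJ k) (g : Gen n) (b : SJ k) :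
    projP n (el a g b) = aug k b • single g a := by
  rw [projP, el, Finsupp.linearCombination_single, Q.env_smul_def, envLeft_mk, smul_assoc,
    Finsupp.smul_single, smul_eq_mul, mul_one]

lemma projP_surjective (n : ℕ) : Function.Surjective (projP (k := k) n) := by
  intro q
  induction q using Finsupp.induction_linear with
  | zero => exact ⟨0, map_zero _⟩
  | add p q hp hq =>
    obtain ⟨p, rfl⟩ := hp
    obtain ⟨q, rfl⟩ := hq
    exact ⟨p + q, map_add _ _ _⟩
  | single g a => exact ⟨el a g 1, by rw [projP_el, map_one, one_smul]⟩

/-- The differential of the left resolution as a bimodule map. -/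
def dQEnv (n : ℕ) : Q k (n + 1) →ₗ[Env k (SJ k)] Q k n := Q.envMap Q.env_smul_def (dQ k n)

/-- `dualQ` as a bimodule map. -/
def dualQEnv {n : ℕ} (c : Gen n → k) : Q k n →ₗ[Env k (SJ k)] Aug (aug k) :=
  Q.envMap Aug.env_smul_eq (dualQ c)

/-- Applying ε to the right coefficients deletes every term with x or y on the right; the rest is
the differential of Q. -/
lemma projP_comp_d (n : ℕ) : projP n ∘ₗ d k n = dQEnv n ∘ₗ projP (n + 1) := by
  refine P.hom_ext fun g => ?_
  rw [LinearMap.comp_apply, LinearMap.comp_apply, d_single_one, projP_single_one]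
  change _ = dQ k n _
  rw [dQ_single, one_smul]
  match n, g with
  | 0, .xPow _ => simp [dGen, dQGen, projP_el]
  | 0, .y => simp [dGen, dQGen, projP_el]
  | n + 1, .xPow _ => simp [dGen, dQGen, projP_el, LinearMap.map_smul_of_tower]
  | 1, .yyx _ =>
    simp only [dGen, dQGen, projP_el, map_sub, map_add, map_mul, map_pow, map_one, aug_x, aug_y,
      Finsupp.single_sub]
    simp
    abel
  | n + 2, .yyx _ =>
    simp only [dGen, dQGen, projP_el, map_sub, map_add, map_mul, map_pow, map_one, aug_x, aug_y,
      Finsupp.single_sub, LinearMap.map_smul_of_tower]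
    simp
    abel

lemma dualQEnv_comp_projP {n : ℕ} (c : Gen n → k) : dualQEnv c ∘ₗ projP n = dual k c := by
  refine P.hom_ext fun g => ?_
  rw [LinearMap.comp_apply, projP_single_one, dual, Finsupp.linearCombination_single, one_smul]
  change dualQ c _ = _
  rw [dualQ_single, map_one, one_mul]

lemma eq_dual {n : ℕ} (L : P k n →ₗ[Env k (SJ k)] Aug (aug k)) :
    L = dual k fun g => Aug.toField (L (single g 1)) := by
  refine P.hom_ext fun g => ?_
  rw [dual, Finsupp.linearCombination_single, one_smul]
  rfl

lemma dual_injective {n : ℕ} {c c' : Gen n → k} (h : dual k c = dual k c') : c = c' := by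
  funext g
  have h' := LinearMap.congr_fun h (single g 1)
  rw [dual, dual, Finsupp.linearCombination_single, Finsupp.linearCombination_single, one_smul,
    one_smul] at h'
  exact h'

lemma etaP_eq_dual (n : ℕ) : etaP k n = dual k (etaC k n) := by
  refine congrArg (dual k) (funext fun g => ?_)
  cases g <;> rfl

lemma omegaP_eq_dual (n : ℕ) : omegaP k n = dual k (omegaC k n) := by
  refine congrArg (dual k) (funext fun g => ?_)
  cases g <;> rfl

end Projection

/-! ### Existence of comparison morphisms -/

section Comparison

/-- P consists of free bimodules and the bar complex is exact in positive degrees, so only degree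
zero needs a hand computation: a ⊗ 1 − 1 ⊗ a is the boundary of 1 ⊗ a ⊗ 1, for a = x and a = y. -/
theorem nonempty_comparison : Nonempty (Comparison k) := by
  obtain ⟨f, hf, hf'⟩ := exists_chainMap (d k) (barD k (SJ k)) d_comp_d barD_exact
    (Finsupp.linearCombination _ fun _ => barOne k (SJ k) 0 ![]) (fun z => by
      induction z using Finsupp.induction_linear with
      | zero => exact ⟨0, by simp⟩
      | add p q hp hq =>
        obtain ⟨v, hv⟩ := hp
        obtain ⟨w, hw⟩ := hq
        exact ⟨v + w, by rw [map_add, map_add, map_add, hv, hw]⟩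
      | single g e =>
        have h : ∃ w, barD k (SJ k) 0 w =
            Finsupp.linearCombination _ (fun _ => barOne k (SJ k) 0 ![]) (dGen k 0 g) := by
          cases g
          · refine ⟨barOne k (SJ k) 1 ![x k], ?_⟩
            rw [barD_zero_barOne, dGen, map_sub, el, el, Finsupp.linearCombination_single,
              Finsupp.linearCombination_single]
          · refine ⟨barOne k (SJ k) 1 ![y k], ?_⟩
            rw [barD_zero_barOne, dGen, map_sub, el, el, Finsupp.linearCombination_single,
              Finsupp.linearCombination_single]
        obtain ⟨w, hw⟩ := h
        refine ⟨e • w, ?_⟩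
        rw [map_smul, hw, d, Finsupp.linearCombination_single, map_smul])
  refine ⟨⟨f, ?_, fun n z => LinearMap.congr_fun (hf' n) z⟩⟩
  rw [hf, el, Finsupp.linearCombination_single, Env.mk_one_one, one_smul]
  exact congrArg _ (Subsingleton.elim _ _)

end Comparison
end SJ
end Yoneda
end

/-! ### Pullback along a comparison morphism -/

noncomputable section

namespace Yoneda

namespace SJ

open Finsupp (single)

variable {k : Type u} [Field k]

section Pullback

lemma dQEnv_exact (n : ℕ) (z : Q k (n + 1)) (h : dQEnv n z = 0) : ∃ w, dQEnv (n + 1) w = z :=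
  dQ_exact n h

lemma dualQ_one_apply (q : Q k 0) :
    dualQ (fun _ => 1) q = algebraMap k (Aug (aug k)) (aug k (q .one)) := by
  conv_lhs => rw [q.zero_eq]
  rw [dualQ_single, mul_one]

lemma exists_dQEnv_zero_eq (z : Q k 0) (h : dualQEnv (fun _ => 1) z = 0) :
    ∃ w, dQEnv 0 w = z := by
  refine exists_dQ_zero_eq ?_
  have h' := (dualQ_one_apply z).symm.trans h
  exact h'

lemma dualQEnv_comp_dQEnv {n : ℕ} (c : Gen n → k) : dualQEnv c ∘ₗ dQEnv n = 0 :=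
  LinearMap.ext fun z => map_dQ (dualQ c) z

/-- By minimality a morphism of complexes `P_• A → P_• A ⊗_A k` that is zero in degree `0` is
killed by bimodule maps to `k`. -/
lemma dualQEnv_comp_eq_zero (u : ∀ n, P k n →ₗ[Env k (SJ k)] Q k n)
    (hu : ∀ n, dQEnv n ∘ₗ u (n + 1) = u n ∘ₗ d k n) (h₀ : u 0 = 0) (n : ℕ) (c : Gen n → k) :
    dualQEnv c ∘ₗ u n = 0 := by
  obtain ⟨-, H⟩ := exists_homotopy (d k) dQEnv d_comp_d dQEnv_exact u hu
    fun z => ⟨0, by rw [h₀, map_zero]; rfl⟩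
  cases n with
  | zero => rw [h₀, LinearMap.comp_zero]
  | succ n =>
    obtain ⟨h, h', e⟩ := H n
    rw [e, LinearMap.comp_add, ← LinearMap.comp_assoc, dualQEnv_comp_dQEnv, LinearMap.zero_comp,
      zero_add]
    exact LinearMap.ext fun z => map_d k (dualQEnv c ∘ₗ h') z

/-- A morphism of complexes from the bar resolution to the minimal left resolution. -/
lemma exists_barToQ : ∃ G : ∀ n, Bar k (SJ k) n →ₗ[Env k (SJ k)] Q k n,
    G 0 (barOne k (SJ k) 0 ![]) = single .one 1 ∧
      ∀ n, dQEnv n ∘ₗ G (n + 1) = G n ∘ₗ barD k (SJ k) n := by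
  let φ : Cochain k (SJ k) (Q k 0) 0 := MultilinearMap.constOfIsEmpty k _ (single .one 1)
  have hφ : dualQEnv (fun _ => 1) ∘ₗ barLift φ =
      barLift (scalarCocycle (aug k) 1 : AugCochain (aug k) 0) := by
    refine Bar.hom_ext fun t => ?_
    rw [LinearMap.comp_apply, barLift_barOne, barLift_barOne, scalarCocycle_apply]
    change dualQ _ (single _ _) = _
    rw [dualQ_single, map_one, mul_one]
  obtain ⟨G, hG, hG'⟩ := exists_chainMap (barD k (SJ k)) dQEnv barD_comp_barD dQEnv_exact
    (barLift φ) fun z => by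
      refine exists_dQEnv_zero_eq _ ?_
      have h := LinearMap.congr_fun hφ (barD k (SJ k) 0 z)
      rw [LinearMap.comp_apply] at h
      rw [h, barLift_comp_barD, mem_cocycles.1 (scalarCocycle (aug k) 1).2]
      have h' := LinearMap.congr_fun (barLift_smul (0 : k) (0 : AugCochain (aug k) 1)) z
      rw [smul_zero, zero_smul] at h'
      exact h'
  refine ⟨G, ?_, hG'⟩
  rw [hG, barLift_barOne]
  rfl

/-- The morphism of left resolutions induced by a comparison morphism. -/
def Comparison.left (F : Comparison k) (n : ℕ) : Q k n →ₗ[Env k (SJ k)] LeftBar (aug k) n :=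
  Q.envMap LeftBar.env_smul_def
    (Finsupp.linearCombination (SJ k) fun g => barProj (aug k) n (F.f n (single g 1)))

lemma Comparison.left_comp_projP (F : Comparison k) (n : ℕ) :
    F.left n ∘ₗ projP n = barProj (aug k) n ∘ₗ F.f n := by
  refine P.hom_ext fun g => ?_
  rw [LinearMap.comp_apply, projP_single_one]
  change Finsupp.linearCombination (SJ k) _ (single g 1) = _
  rw [Finsupp.linearCombination_single, one_smul]
  rfl

lemma Comparison.barD_comp (F : Comparison k) (n : ℕ) :
    barD k (SJ k) n ∘ₗ F.f (n + 1) = F.f n ∘ₗ d k n :=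
  LinearMap.ext (F.comm n)

lemma comp_projP_injective {n : ℕ} {M : Type*} [AddCommGroup M] [Module (Env k (SJ k)) M]
    {f f' : Q k n →ₗ[Env k (SJ k)] M} (h : f ∘ₗ projP n = f' ∘ₗ projP n) : f = f' :=
  (LinearMap.cancel_right (projP_surjective n)).1 h

lemma Comparison.leftD_comp_left (F : Comparison k) (n : ℕ) :
    leftD (aug k) n ∘ₗ F.left (n + 1) = F.left n ∘ₗ dQEnv n := by
  refine comp_projP_injective ?_
  rw [LinearMap.comp_assoc, F.left_comp_projP, LinearMap.comp_assoc _ (dQEnv n), ← projP_comp_d,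
    ← LinearMap.comp_assoc, leftD_comp_barProj, LinearMap.comp_assoc, F.barD_comp,
    ← LinearMap.comp_assoc, ← F.left_comp_projP, LinearMap.comp_assoc]

lemma Comparison.leftLift_comp_left (F : Comparison k) {n : ℕ} (φ : AugCochain (aug k) n)
    (c : Gen n → k) (h : barLift φ ∘ₗ F.f n = dual k c) :
    leftLift (aug k) φ ∘ₗ F.left n = dualQEnv c := by
  refine comp_projP_injective ?_
  rw [LinearMap.comp_assoc, F.left_comp_projP, ← LinearMap.comp_assoc, leftLift_comp_barProj, h,
    dualQEnv_comp_projP]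

lemma Comparison.f_zero' (F : Comparison k) (t : Fin 0 → SJ k) :
    F.f 0 (single .one 1) = barOne k (SJ k) 0 t := by
  have h := F.f_zero
  rw [el, Env.mk_one_one] at h
  rw [h]
  exact congrArg _ (Subsingleton.elim _ _)

lemma barLift_zero (n : ℕ) : barLift (0 : AugCochain (aug k) n) = 0 := by
  have h := barLift_smul (0 : k) (0 : AugCochain (aug k) n)
  rwa [smul_zero, zero_smul] at h

/-- A functional on the generators is transported to the bar resolution by the chain map G. Its
pullback along f is the original functional because the projection P → Q and Gf agree in degree
zero, so minimality kills their difference. -/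
theorem Comparison.pullback_surjective (F : Comparison k) (n : ℕ) :
    Function.Surjective (F.pullback n) := by
  intro L
  obtain ⟨c, rfl⟩ : ∃ c, L = dual k c := ⟨_, eq_dual L⟩
  obtain ⟨G, hG, hG'⟩ := exists_barToQ (k := k)
  have hφ : cochainOfBar (dualQEnv c ∘ₗ G n) ∈ cocycles k (SJ k) (Aug (aug k)) n := by
    refine mem_cocycles.2 (cochain_ext ?_)
    rw [barLift_δ, barLift_cochainOfBar, LinearMap.comp_assoc, ← hG', ← LinearMap.comp_assoc,
      dualQEnv_comp_dQEnv, LinearMap.zero_comp, barLift_zero]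
  refine ⟨HH.mk ⟨_, hφ⟩, ?_⟩
  rw [F.pullback_mk, barLift_cochainOfBar]
  have h := dualQEnv_comp_eq_zero (fun n => projP n - G n ∘ₗ F.f n) (fun n => by
    rw [LinearMap.comp_sub, LinearMap.sub_comp, ← projP_comp_d, LinearMap.comp_assoc, ← F.barD_comp,
      ← LinearMap.comp_assoc, ← LinearMap.comp_assoc, hG']) (by
    refine P.hom_ext fun g => ?_
    cases g
    rw [LinearMap.sub_apply, LinearMap.comp_apply, F.f_zero' ![], hG, projP_single_one, sub_self]
    rfl) n c
  rw [LinearMap.comp_sub, sub_eq_zero, dualQEnv_comp_projP] at h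
  rw [h, LinearMap.comp_assoc]

/-- A cocycle φ killed by f also kills the round trip through Q. That round trip is homotopic to the
projection onto the left bar resolution, so φ equals its own value on the homotopy, composed with
the bar differential. -/
theorem Comparison.pullback_injective (F : Comparison k) (n : ℕ) :
    Function.Injective (F.pullback n) := by
  refine (injective_iff_map_eq_zero _).2 fun ξ hξ => ?_
  obtain ⟨φ, rfl⟩ := HH.mk_surjective ξ
  rw [F.pullback_mk] at hξ
  rw [HH.mk_eq_zero]
  obtain ⟨G, hG, hG'⟩ := exists_barToQ (k := k)
  have hφ := leftLift_comp_leftD (φ : AugCochain (aug k) n) φ.2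
  have hφ' : leftLift (aug k) (φ : AugCochain (aug k) n) ∘ₗ F.left n ∘ₗ G n = 0 := by
    have h : leftLift (aug k) (φ : AugCochain (aug k) n) ∘ₗ F.left n = 0 := by
      refine comp_projP_injective ?_
      rw [LinearMap.comp_assoc, F.left_comp_projP, ← LinearMap.comp_assoc, leftLift_comp_barProj,
        hξ, LinearMap.zero_comp]
    rw [← LinearMap.comp_assoc, h, LinearMap.zero_comp]
  obtain ⟨⟨h₀, e₀⟩, H⟩ := exists_homotopy (barD k (SJ k)) (leftD (aug k)) barD_comp_barD
    (leftD_exact (aug k)) (fun n => barProj (aug k) n - F.left n ∘ₗ G n) (fun n => by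
      rw [LinearMap.comp_sub, LinearMap.sub_comp, leftD_comp_barProj, ← LinearMap.comp_assoc,
        F.leftD_comp_left, LinearMap.comp_assoc, hG', LinearMap.comp_assoc]) (fun z => by
      refine ⟨0, ?_⟩
      suffices h : barProj (aug k) 0 - F.left 0 ∘ₗ G 0 = 0 by rw [h, map_zero]; rfl
      refine Bar.hom_ext fun t => ?_
      have ht : t = ![] := Subsingleton.elim _ _
      subst ht
      rw [LinearMap.sub_apply, LinearMap.comp_apply, hG]
      have h := LinearMap.congr_fun (F.left_comp_projP 0) (single .one 1)
      rw [LinearMap.comp_apply, LinearMap.comp_apply, projP_single_one, F.f_zero' ![]] at h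
      rw [h, sub_self]
      rfl)
  have key : barLift (φ : AugCochain (aug k) n) =
      leftLift (aug k) (φ : AugCochain (aug k) n) ∘ₗ (barProj (aug k) n - F.left n ∘ₗ G n) := by
    rw [LinearMap.comp_sub, leftLift_comp_barProj, hφ', sub_zero]
  cases n with
  | zero =>
    rw [e₀, ← LinearMap.comp_assoc, hφ, LinearMap.zero_comp] at key
    exact cochain_ext (key.trans (barLift_zero 0).symm)
  | succ n =>
    obtain ⟨h, h', e⟩ := H n
    rw [e, LinearMap.comp_add, ← LinearMap.comp_assoc, hφ, LinearMap.zero_comp, zero_add,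
      ← LinearMap.comp_assoc] at key
    refine ⟨cochainOfBar (leftLift (aug k) (φ : AugCochain (aug k) (n + 1)) ∘ₗ h'),
      cochain_ext ?_⟩
    rw [barLift_δ, barLift_cochainOfBar, key]

/-- The cup product is computed on the minimal resolution by lifting the second factor. -/
theorem Comparison.pullback_cup (F : Comparison k) {n p : ℕ} (ξ : HAug (aug k) n)
    (ζ : HAug (aug k) p) (c' : Gen n → k) (c : Gen p → k) (hξ : F.pullback n ξ = dual k c')
    (hζ : F.pullback p ζ = dual k c) (g : ∀ n m, Q k m →ₗ[SJ k] Q k n) (hg : IsLift p c g)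
    (c'' : Gen (n + p) → k) (hc : dualQ c' ∘ₗ g n (n + p) = dualQ c'') :
    F.pullback (n + p) (hcup n p ξ ζ) = dual k c'' := by
  obtain ⟨φ, rfl⟩ := HH.mk_surjective ξ
  obtain ⟨ψ, rfl⟩ := HH.mk_surjective ζ
  rw [F.pullback_mk] at hξ hζ
  rw [hcup_mk, F.pullback_mk, coe_cupCocycle]
  let gE (n m : ℕ) : Q k m →ₗ[Env k (SJ k)] Q k n := Q.envMap Q.env_smul_def (g n m)
  -- Two chain maps of degree −p from P to the left bar resolution are compared: the lift g carried
  -- over by f, and capping with ψ. The source is indexed by p + n so that raising n raises the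
  -- degree definitionally.
  have key (N : ℕ) (hN : N = p + n) (h : N = n + p) :
      leftLift (aug k) (φ : AugCochain (aug k) n) ∘ₗ F.left n ∘ₗ gE n N ∘ₗ projP N =
      leftLift (aug k) (φ : AugCochain (aug k) n) ∘ₗ
        capLeft h (ψ : AugCochain (aug k) p) ∘ₗ barProj (aug k) N ∘ₗ F.f N := by
    subst hN
    have hφ := leftLift_comp_leftD (φ : AugCochain (aug k) n) φ.2
    obtain ⟨⟨h₀, e₀⟩, H⟩ := exists_homotopy (P := fun n => P k (p + n)) (fun n => d k (p + n))
      (leftD (aug k)) (fun n => d_comp_d (p + n)) (leftD_exact (aug k))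
      (fun n => F.left n ∘ₗ gE n (p + n) ∘ₗ projP (p + n) -
        capLeft (add_comm p n) (ψ : AugCochain (aug k) p) ∘ₗ barProj (aug k) (p + n) ∘ₗ
          F.f (p + n)) (fun n => by
        have e1 : dQEnv n ∘ₗ gE (n + 1) (p + n + 1) = gE n (p + n) ∘ₗ dQEnv (p + n) :=
          LinearMap.ext fun z => LinearMap.congr_fun (hg.comm n (p + n) (add_comm _ _)) z
        rw [LinearMap.comp_sub, LinearMap.sub_comp]
        congr 1
        · rw [← LinearMap.comp_assoc, F.leftD_comp_left, LinearMap.comp_assoc,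
            ← LinearMap.comp_assoc _ _ (dQEnv n)]
          change F.left n ∘ₗ (dQEnv n ∘ₗ gE (n + 1) (p + n + 1)) ∘ₗ projP (p + n + 1) = _
          rw [e1, LinearMap.comp_assoc, LinearMap.comp_assoc, LinearMap.comp_assoc, projP_comp_d]
        · rw [← LinearMap.comp_assoc, leftD_comp_capLeft (add_comm p n) _ _ ψ.2]
          change (capLeft _ _ ∘ₗ leftD (aug k) (p + n)) ∘ₗ barProj (aug k) (p + n + 1) ∘ₗ
            F.f (p + n + 1) = _
          rw [LinearMap.comp_assoc, ← LinearMap.comp_assoc _ _ (leftD (aug k) (p + n)),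
            leftD_comp_barProj, LinearMap.comp_assoc, F.barD_comp, LinearMap.comp_assoc,
            LinearMap.comp_assoc]) (fun z => by
        -- In degree zero both maps have the same augmentation, namely ζ in coordinates c, so their
        -- difference consists of boundaries.
        refine exists_leftD_zero_eq (aug k) _ ?_
        have h1 : leftAug (aug k) ∘ₗ F.left 0 = dualQEnv fun _ => 1 := F.leftLift_comp_left _ _ (by
          refine P.hom_ext fun g => ?_
          cases g
          rw [LinearMap.comp_apply, F.f_zero' ![], barLift_barOne, scalarCocycle_apply, dual,
            Finsupp.linearCombination_single, one_smul])
        have h2 : dualQEnv (fun _ => 1) ∘ₗ gE 0 p = dualQEnv c :=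
          LinearMap.ext fun z => LinearMap.congr_fun hg.zero z
        have h3 : leftAug (aug k) ∘ₗ capLeft (add_comm p 0) (ψ : AugCochain (aug k) p) =
            leftLift (aug k) (ψ : AugCochain (aug k) p) := by
          refine LeftBar.hom_ext fun t => ?_
          rw [LinearMap.comp_apply, leftAug_comp_capLeft]
          exact (leftLift_leftOne (aug k) (ψ : AugCochain (aug k) p) t).symm
        have h4 : leftAug (aug k) ∘ₗ (F.left 0 ∘ₗ gE 0 p ∘ₗ projP p -
            capLeft (add_comm p 0) (ψ : AugCochain (aug k) p) ∘ₗ barProj (aug k) p ∘ₗ F.f p) =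
              0 := by
          rw [LinearMap.comp_sub, ← LinearMap.comp_assoc, h1, ← LinearMap.comp_assoc, h2,
            ← LinearMap.comp_assoc, h3, ← LinearMap.comp_assoc, leftLift_comp_barProj, hζ,
            dualQEnv_comp_projP, sub_self]
        exact LinearMap.congr_fun h4 z)
    rw [← sub_eq_zero, ← LinearMap.comp_sub]
    cases n with
    | zero =>
      exact (congrArg (_ ∘ₗ ·) e₀).trans (by rw [← LinearMap.comp_assoc, hφ, LinearMap.zero_comp])
    | succ n =>
      obtain ⟨h, h', e⟩ := H n
      refine (congrArg (_ ∘ₗ ·) e).trans ?_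
      -- One half of the homotopy dies because φ is a cocycle, the other by minimality of P.
      rw [LinearMap.comp_add, ← LinearMap.comp_assoc, hφ, LinearMap.zero_comp, zero_add]
      exact LinearMap.ext fun z =>
        map_d k (leftLift (aug k) (φ : AugCochain (aug k) (n + 1)) ∘ₗ h') z
  have key' := key (n + p) (add_comm n p) rfl
  rw [← LinearMap.comp_assoc, F.leftLift_comp_left _ c' hξ, ← LinearMap.comp_assoc (F.f _),
    ← LinearMap.comp_assoc (F.f _), ← LinearMap.comp_assoc (barProj _ _), leftLift_comp_capLeft,
    leftLift_comp_barProj] at key'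
  rw [← key', ← LinearMap.comp_assoc, ← dualQEnv_comp_projP]
  congr 1
  exact LinearMap.ext fun z => LinearMap.congr_fun hc z

end Pullback
end SJ
end Yoneda
end

noncomputable section

namespace Yoneda

/-! ### Spanning monomials of the presented algebra -/

section Presentation

namespace Pres

variable {k : Type u} [Field k]

lemma w1_mul_w1 : gen k 1 * gen k 1 = 0 := by
  rw [gen, ← map_mul, ← map_zero (RingQuot.mkAlgHom k (PresRel k))]
  exact RingQuot.mkAlgHom_rel k PresRel.w1w1

lemma w2_mul_w2 : gen k 2 * gen k 2 = 0 := by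
  rw [gen, ← map_mul, ← map_zero (RingQuot.mkAlgHom k (PresRel k))]
  exact RingQuot.mkAlgHom_rel k PresRel.w2w2

lemma w1_mul_w2 : gen k 1 * gen k 2 = 0 := by
  rw [gen, gen, ← map_mul, ← map_zero (RingQuot.mkAlgHom k (PresRel k))]
  exact RingQuot.mkAlgHom_rel k PresRel.w1w2

lemma w2_mul_w1 : gen k 2 * gen k 1 = 0 := by
  rw [gen, gen, ← map_mul, ← map_zero (RingQuot.mkAlgHom k (PresRel k))]
  exact RingQuot.mkAlgHom_rel k PresRel.w2w1

lemma w1_mul_e1 : gen k 1 * gen k 0 = 0 := by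
  rw [gen, gen, ← map_mul, ← map_zero (RingQuot.mkAlgHom k (PresRel k))]
  exact RingQuot.mkAlgHom_rel k PresRel.w1e1

lemma e1_mul_w1 : gen k 0 * gen k 1 = 0 := by
  rw [gen, gen, ← map_mul, ← map_zero (RingQuot.mkAlgHom k (PresRel k))]
  exact RingQuot.mkAlgHom_rel k PresRel.e1w1

lemma e1_mul_w2 : gen k 0 * gen k 2 = (-1 : k) • (gen k 2 * gen k 0) := by
  have h : gen k 2 * gen k 0 + gen k 0 * gen k 2 = 0 := by
    rw [gen, gen, ← map_mul, ← map_mul, ← map_add, ← map_zero (RingQuot.mkAlgHom k (PresRel k))]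
    exact RingQuot.mkAlgHom_rel k PresRel.w2e1
  calc gen k 0 * gen k 2 = (-1 + 1 : k) • (gen k 2 * gen k 0) + gen k 0 * gen k 2 := by simp
    _ = (-1 : k) • (gen k 2 * gen k 0) := by rw [add_smul, one_smul, add_assoc, h, add_zero]

lemma e1_pow_mul_w2 (n : ℕ) :
    gen k 0 ^ n * gen k 2 = (-1 : k) ^ n • (gen k 2 * gen k 0 ^ n) := by
  induction n with
  | zero => simp
  | succ n ih =>
    rw [pow_succ, mul_assoc, e1_mul_w2, mul_smul_comm, ← mul_assoc, ih, smul_mul_assoc, smul_smul,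
      mul_assoc, pow_succ (-1 : k), mul_comm (-1 : k)]

variable (k) in
/-- The monomials in degree `n` involving `ω¹` or `ω²`. -/
def omega : ℕ → Pres k
  | 0 => 0
  | 1 => gen k 1
  | n + 2 => gen k 2 * gen k 0 ^ n

/-- An induction principle: right multiplication by the generators reaches the whole algebra. -/
lemma mul_right_induction {p : Pres k → Prop} (one : p 1) (add : ∀ a b, p a → p b → p (a + b))
    (smul : ∀ (c : k) a, p a → p (c • a)) (mul_gen : ∀ a i, p a → p (a * gen k i))
    (a : Pres k) : p a := by
  obtain ⟨w, rfl⟩ := RingQuot.mkAlgHom_surjective k (PresRel k) a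
  suffices h : ∀ a, p a → p (a * RingQuot.mkAlgHom k (PresRel k) w) by simpa using h 1 one
  induction w using FreeAlgebra.induction with
  | grade0 c =>
    intro a ha
    rw [AlgHom.commutes, ← Algebra.commutes, ← Algebra.smul_def]
    exact smul c a ha
  | grade1 i => exact fun a ha => mul_gen a i ha
  | mul v w hv hw =>
    intro a ha
    rw [map_mul, ← mul_assoc]
    exact hw _ (hv _ ha)
  | add v w hv hw =>
    intro a ha
    rw [map_add, mul_add]
    exact add _ _ (hv _ ha) (hw _ ha)

/-- The span contains 1 and is stable under right multiplication by the generators: each relation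
either kills the product or moves η¹ past ω² at the cost of a sign. -/
lemma mem_span_monomials (a : Pres k) :
    a ∈ Submodule.span k (Set.range (fun n : ℕ => gen k 0 ^ n) ∪ Set.range fun n => omega k (n + 1)) := by
  set S := Submodule.span k
    (Set.range (fun n : ℕ => gen k 0 ^ n) ∪ Set.range fun n => omega k (n + 1)) with hS
  have he (n : ℕ) : gen k 0 ^ n ∈ S := Submodule.subset_span (Or.inl ⟨n, rfl⟩)
  have hw (n : ℕ) : omega k (n + 1) ∈ S := Submodule.subset_span (Or.inr ⟨n, rfl⟩)
  refine mul_right_induction (p := fun a => a ∈ S) ?_ (fun _ _ => add_mem)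
    (fun c _ => Submodule.smul_mem S c) (fun a i ha => ?_) a
  · simpa using he 0
  · induction ha using Submodule.span_induction with
    | zero => rw [zero_mul]; exact zero_mem _
    | add a b _ _ ha hb => rw [add_mul]; exact add_mem ha hb
    | smul c a _ ha => rw [smul_mul_assoc]; exact Submodule.smul_mem S c ha
    | mem a ha =>
      rcases ha with ⟨n, rfl⟩ | ⟨n, rfl⟩
      · fin_cases i
        · exact (pow_succ (gen k 0) n) ▸ he (n + 1)
        · cases n with
          | zero => simpa [omega] using hw 0
          | succ n =>
            change gen k 0 ^ (n + 1) * gen k 1 ∈ S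
            rw [pow_succ, mul_assoc, e1_mul_w1, mul_zero]; exact zero_mem _
        · change gen k 0 ^ n * gen k 2 ∈ S
          rw [e1_pow_mul_w2]
          exact Submodule.smul_mem S _ (hw (n + 1))
      · cases n with
        | zero =>
          fin_cases i
          · change gen k 1 * gen k 0 ∈ S
            rw [w1_mul_e1]; exact zero_mem _
          · change gen k 1 * gen k 1 ∈ S
            rw [w1_mul_w1]; exact zero_mem _
          · change gen k 1 * gen k 2 ∈ S
            rw [w1_mul_w2]; exact zero_mem _
        | succ n =>
          fin_cases i
          · change gen k 2 * gen k 0 ^ n * gen k 0 ∈ S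
            rw [mul_assoc, ← pow_succ]
            exact hw (n + 2)
          · change gen k 2 * gen k 0 ^ n * gen k 1 ∈ S
            cases n with
            | zero => rw [pow_zero, mul_one, w2_mul_w1]; exact zero_mem _
            | succ n =>
              rw [pow_succ, mul_assoc, mul_assoc, e1_mul_w1, mul_zero, mul_zero]; exact zero_mem _
          · change gen k 2 * gen k 0 ^ n * gen k 2 ∈ S
            rw [mul_assoc, e1_pow_mul_w2]
            rw [mul_smul_comm, ← mul_assoc, w2_mul_w2, zero_mul, smul_zero]
            exact zero_mem _

end Pres

/-! ### From a multiplication table to a presentation -/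

section Graded

variable {k : Type u} [Field k] {H : ℕ → Type u} [∀ n, AddCommGroup (H n)] [∀ n, Module k (H n)]
  [DirectSum.GSemiring H] [DirectSum.GAlgebra k H]

/-- Bases and multiplication table of a graded algebra with basis `ηⁿ`, `ωⁿ`. -/
structure ProductTable (k : Type u) [Field k] {H : ℕ → Type u} [∀ n, AddCommGroup (H n)]
    [∀ n, Module k (H n)] [DirectSum.GSemiring H] [DirectSum.GAlgebra k H]
    (η ω : ∀ n, H n) : Prop where
  one : DirectSum.of H 0 (η 0) = 1
  linearIndependent_zero : LinearIndependent k ![η 0]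
  span_zero : Submodule.span k {η 0} = ⊤
  linearIndependent : ∀ n, 1 ≤ n → LinearIndependent k ![η n, ω n]
  span : ∀ n, 1 ≤ n → Submodule.span k {η n, ω n} = ⊤
  eta_eta : ∀ p q, 1 ≤ p → 1 ≤ q →
    DirectSum.of H p (η p) * DirectSum.of H q (η q) = DirectSum.of H (p + q) (η (p + q))
  omega_omega : ∀ p q, 1 ≤ p → 1 ≤ q → DirectSum.of H p (ω p) * DirectSum.of H q (ω q) = 0
  omega_one_eta : ∀ q, 1 ≤ q → DirectSum.of H 1 (ω 1) * DirectSum.of H q (η q) = 0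
  eta_omega_one : ∀ q, 1 ≤ q → DirectSum.of H q (η q) * DirectSum.of H 1 (ω 1) = 0
  omega_eta : ∀ p q, 2 ≤ p → 1 ≤ q →
    DirectSum.of H p (ω p) * DirectSum.of H q (η q) = DirectSum.of H (p + q) (ω (p + q))
  eta_omega : ∀ p q, 2 ≤ p → 1 ≤ q → DirectSum.of H (p + q) (ω (p + q)) =
    (-1 : k) ^ q • (DirectSum.of H q (η q) * DirectSum.of H p (ω p))

namespace ProductTable

variable {η ω : ∀ n, H n} (T : ProductTable k η ω)

include T

lemma eta_eq_pow (n : ℕ) : DirectSum.of H n (η n) = DirectSum.of H 1 (η 1) ^ n := by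
  induction n with
  | zero => rw [T.one, pow_zero]
  | succ n ih =>
    rcases Nat.eq_zero_or_pos n with rfl | hn
    · rw [zero_add, pow_one]
    · rw [pow_succ, ← ih, T.eta_eta n 1 hn le_rfl]

lemma omega_eq_mul (n : ℕ) : DirectSum.of H (n + 2) (ω (n + 2)) =
    DirectSum.of H 2 (ω 2) * DirectSum.of H 1 (η 1) ^ n := by
  rw [← T.eta_eq_pow]
  rcases Nat.eq_zero_or_pos n with rfl | hn
  · rw [T.one, mul_one]
  · rw [T.omega_eta 2 n le_rfl hn, add_comm]

lemma mem_of_mem {S : Submodule k (⨁ n, H n)} (he : ∀ n, DirectSum.of H n (η n) ∈ S)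
    (hw : ∀ n, DirectSum.of H (n + 1) (ω (n + 1)) ∈ S) (z : ⨁ n, H n) : z ∈ S := by
  induction z using DirectSum.induction_on with
  | zero => exact zero_mem _
  | add a b ha hb => exact add_mem ha hb
  | of n h =>
    suffices H : (⊤ : Submodule k (H n)) ≤ S.comap (DirectSum.lof k ℕ H n) from H trivial
    cases n with
    | zero =>
      rw [← T.span_zero, Submodule.span_le, Set.singleton_subset_iff]
      exact he 0
    | succ n =>
      rw [← T.span (n + 1) (by omega), Submodule.span_le, Set.insert_subset_iff,
        Set.singleton_subset_iff]
      exact ⟨he _, hw _⟩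

lemma adjoin_eq_top : Algebra.adjoin k
    {DirectSum.of H 1 (η 1), DirectSum.of H 1 (ω 1), DirectSum.of H 2 (ω 2)} = ⊤ := by
  refine eq_top_iff.2 fun z _ => ?_
  set S := Algebra.adjoin k
    {DirectSum.of H 1 (η 1), DirectSum.of H 1 (ω 1), DirectSum.of H 2 (ω 2)}
  have h1 : DirectSum.of H 1 (η 1) ∈ S := Algebra.subset_adjoin (Or.inl rfl)
  have h2 : DirectSum.of H 1 (ω 1) ∈ S := Algebra.subset_adjoin (Or.inr (Or.inl rfl))
  have h3 : DirectSum.of H 2 (ω 2) ∈ S := Algebra.subset_adjoin (Or.inr (Or.inr rfl))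
  refine T.mem_of_mem (S := Subalgebra.toSubmodule S) (fun n => ?_) (fun n => ?_) z
  · change _ ∈ S
    rw [T.eta_eq_pow n]
    exact pow_mem h1 n
  · cases n with
    | zero => exact h2
    | succ n =>
      change _ ∈ S
      rw [T.omega_eq_mul n]
      exact mul_mem h3 (pow_mem h1 n)

/-- The graded algebra has the expected presentation. -/
theorem exists_presentation : ∃ Ψ : Pres k ≃ₐ[k] ⨁ n, H n,
    Ψ (Pres.gen k 0) = DirectSum.of H 1 (η 1) ∧ Ψ (Pres.gen k 1) = DirectSum.of H 1 (ω 1) ∧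
      Ψ (Pres.gen k 2) = DirectSum.of H 2 (ω 2) := by
  let ψ : Pres k →ₐ[k] ⨁ n, H n := RingQuot.liftAlgHom k ⟨FreeAlgebra.lift k
    ![DirectSum.of H 1 (η 1), DirectSum.of H 1 (ω 1), DirectSum.of H 2 (ω 2)], by
      intro a b h
      cases h <;> simp only [map_mul, map_add, map_zero, FreeAlgebra.lift_ι_apply,
        Matrix.cons_val_zero, Matrix.cons_val_one, Matrix.cons_val]
      · exact T.omega_omega 1 1 le_rfl le_rfl
      · exact T.omega_omega 2 2 one_le_two one_le_two
      · exact T.omega_omega 1 2 le_rfl one_le_two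
      · exact T.omega_omega 2 1 one_le_two le_rfl
      · exact T.omega_one_eta 1 le_rfl
      · exact T.eta_omega_one 1 le_rfl
      · rw [T.omega_eta 2 1 le_rfl le_rfl, T.eta_omega 2 1 le_rfl le_rfl]
        simp⟩
  have hψ (i : Fin 3) : ψ (Pres.gen k i) =
      ![DirectSum.of H 1 (η 1), DirectSum.of H 1 (ω 1), DirectSum.of H 2 (ω 2)] i :=
    (RingQuot.liftAlgHom_mkAlgHom_apply k _ _ _).trans (FreeAlgebra.lift_ι_apply _ _)
  have h0 : ψ (Pres.gen k 0) = DirectSum.of H 1 (η 1) := hψ 0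
  have h1 : ψ (Pres.gen k 1) = DirectSum.of H 1 (ω 1) := hψ 1
  have h2 : ψ (Pres.gen k 2) = DirectSum.of H 2 (ω 2) := hψ 2
  have hψe (n : ℕ) : ψ (Pres.gen k 0 ^ n) = DirectSum.of H n (η n) := by
    rw [map_pow, h0, T.eta_eq_pow n]
  have hψw (n : ℕ) : ψ (Pres.omega k (n + 1)) = DirectSum.of H (n + 1) (ω (n + 1)) := by
    cases n with
    | zero => exact h1
    | succ n => rw [Pres.omega, map_mul, map_pow, h0, h2, T.omega_eq_mul n]
  -- The inverse is built only as a linear map, degree by degree on the basis. Multiplicativity is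
  -- not needed, since both composites are checked on spanning sets.
  have hΛ (n : ℕ) : ∃ l : H n →ₗ[k] Pres k, l (η n) = Pres.gen k 0 ^ n ∧
      (1 ≤ n → l (ω n) = Pres.omega k n) := by
    rcases Nat.eq_zero_or_pos n with rfl | hn
    · let b := Module.Basis.mk T.linearIndependent_zero (by
        rw [Matrix.range_cons, Matrix.range_empty, Set.union_empty, T.span_zero])
      refine ⟨b.constr k fun _ => 1, ?_, fun h => absurd h (by simp)⟩
      have hb : η 0 = b 0 := by simp [b]
      rw [hb, Module.Basis.constr_basis, pow_zero]
    · let b := Module.Basis.mk (T.linearIndependent n hn) (by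
        rw [Matrix.range_cons, Matrix.range_cons, Matrix.range_empty, Set.union_empty,
          Set.singleton_union, T.span n hn])
      have hb : η n = b 0 := by simp [b]
      have hb' : ω n = b 1 := by simp [b]
      refine ⟨b.constr k ![Pres.gen k 0 ^ n, Pres.omega k n], ?_, fun _ => ?_⟩
      · rw [hb, Module.Basis.constr_basis]; rfl
      · rw [hb', Module.Basis.constr_basis]; rfl
  choose l hl hl' using hΛ
  let Λ : (⨁ n, H n) →ₗ[k] Pres k := DirectSum.toModule k ℕ (Pres k) l
  have hΛe (n : ℕ) : Λ (DirectSum.of H n (η n)) = Pres.gen k 0 ^ n :=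
    (DirectSum.toModule_lof k n (η n)).trans (hl n)
  have hΛw (n : ℕ) : Λ (DirectSum.of H (n + 1) (ω (n + 1))) = Pres.omega k (n + 1) :=
    (DirectSum.toModule_lof k (n + 1) (ω (n + 1))).trans (hl' (n + 1) (by omega))
  have hψΛ (z : ⨁ n, H n) : ψ (Λ z) = z :=
    T.mem_of_mem (S := LinearMap.eqLocus (ψ.toLinearMap ∘ₗ Λ) LinearMap.id)
      (fun n => by
        change ψ (Λ _) = _
        rw [hΛe, hψe]
        rfl)
      (fun n => by
        change ψ (Λ _) = _
        rw [hΛw, hψw]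
        rfl) z
  have hΛψ (a : Pres k) : Λ (ψ a) = a := by
    have h := Pres.mem_span_monomials a
    induction h using Submodule.span_induction with
    | zero => simp
    | add a b _ _ ha hb => rw [map_add, map_add, ha, hb]
    | smul c a _ ha => rw [map_smul, map_smul, ha]
    | mem a ha =>
      rcases ha with ⟨n, rfl⟩ | ⟨n, rfl⟩
      · exact (congrArg Λ (hψe n)).trans (hΛe n)
      · exact (congrArg Λ (hψw n)).trans (hΛw n)
  exact ⟨AlgEquiv.ofBijective ψ ⟨Function.LeftInverse.injective hΛψ,
    Function.RightInverse.surjective hψΛ⟩, h0, h1, h2⟩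

end ProductTable

end Graded

end Presentation
end Yoneda
end

noncomputable section

namespace Yoneda

namespace SJ

open Finsupp (single)

variable {k : Type u} [Field k]

/-! ### The multiplication table read off the lifts -/

section Table

lemma dualQ_comp_etaLift (n m : ℕ) :
    dualQ (etaC k n) ∘ₗ etaLift k n (m + 1) = dualQ (etaC k (m + 1)) := by
  refine Q.hom_ext fun g => ?_
  rw [LinearMap.comp_apply, etaLift_single, one_smul, dualQ_single]
  match n, m, g with
  | 0, _, .xPow _ => simp [etaLiftGen, dualQ_single, etaC]
  | n + 1, _, .xPow _ => simp [etaLiftGen, dualQ_single, etaC]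
  | 0, _, .y => simp [etaLiftGen, etaC]
  | 1, _, .y => simp [etaLiftGen, etaC]
  | n + 2, _, .y => simp [etaLiftGen, etaC]
  | 0, _, .yyx _ => simp [etaLiftGen, etaC]
  | 1, _, .yyx _ => simp [etaLiftGen, dualQ_single, etaC]
  | n + 2, _, .yyx _ => simp [etaLiftGen, dualQ_single, etaC]

lemma dualQ_omegaC_comp_etaLift (n m : ℕ) :
    dualQ (omegaC k (n + 2)) ∘ₗ etaLift k (n + 2) (m + 2) = dualQ (omegaC k (m + 2)) := by
  refine Q.hom_ext fun g => ?_
  rw [LinearMap.comp_apply, etaLift_single, one_smul, dualQ_single]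
  cases g <;> simp [etaLiftGen, dualQ_single, omegaC]

/-- The only component of this lift along the generator y has coefficient y − x, which the
augmentation kills. Hence ω¹ηᵠ = 0. -/
lemma dualQ_omegaC_one_comp_etaLift (m : ℕ) :
    dualQ (omegaC k 1) ∘ₗ etaLift k 1 m = dualQ 0 := by
  refine Q.hom_ext fun g => ?_
  rw [LinearMap.comp_apply, etaLift_single, one_smul, dualQ_single]
  cases g <;> simp [etaLiftGen, dualQ_single, omegaC]

lemma dualQ_etaC_comp_omegaLift (n m : ℕ) :
    dualQ (etaC k n) ∘ₗ omegaLift k n (m + 2) = dualQ ((-1 : k) ^ n • omegaC k (m + 2)) := by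
  refine Q.hom_ext fun g => ?_
  rw [LinearMap.comp_apply, omegaLift_single, one_smul, dualQ_single]
  cases n <;> cases g <;> simp [omegaLiftGen, dualQ_single, omegaC, etaC]

/-- In positive degree the lift takes values only on powers of x, where ωⁿ vanishes. -/
lemma dualQ_omegaC_comp_omegaLift (n m : ℕ) :
    dualQ (omegaC k n) ∘ₗ omegaLift k n m = dualQ 0 := by
  refine Q.hom_ext fun g => ?_
  rw [LinearMap.comp_apply, omegaLift_single, one_smul, dualQ_single]
  cases n <;> cases g <;> simp [omegaLiftGen, dualQ_single, omegaC]

/-- Above degree zero the only nonzero value of the lift has coefficient −x, which no map to k sees.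
So every positive class times ω¹ is zero. -/
lemma dualQ_comp_omegaOneLift {n : ℕ} (c : Gen (n + 1) → k) (m : ℕ) :
    dualQ c ∘ₗ omegaOneLift k (n + 1) m = dualQ 0 := by
  refine Q.hom_ext fun g => ?_
  rw [LinearMap.comp_apply, omegaOneLift_single, one_smul, dualQ_single]
  match n, m, g with
  | 0, _, .one => simp [omegaOneLiftGen]
  | 0, _, .y => simp [omegaOneLiftGen]
  | 0, _, .xPow _ => simp [omegaOneLiftGen]
  | 0, _, .yyx 0 => simp [omegaOneLiftGen, dualQ_single]
  | 0, _, .yyx (m + 1) => simp [omegaOneLiftGen]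
  | n + 1, _, _ => simp [omegaOneLiftGen]

/-- The graded algebra `H` is computed by the minimal resolution: its degree `n` part is
`Hom_A(Q_n, k)`, with product given by lifting the second factor. -/
structure ComputedBy (H : ℕ → Type u) [∀ n, AddCommGroup (H n)] [∀ n, Module k (H n)]
    [DirectSum.GSemiring H] (pb : ∀ n, H n ≃ₗ[k] (Gen n → k)) : Prop where
  one : pb 0 GradedMonoid.GOne.one = fun _ => 1
  mul : ∀ (n p : ℕ) (ξ : H n) (ζ : H p) (g : ∀ n m, Q k m →ₗ[SJ k] Q k n) (c : Gen (n + p) → k),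
    IsLift p (pb p ζ) g → dualQ (pb n ξ) ∘ₗ g n (n + p) = dualQ c →
      pb (n + p) (GradedMonoid.GMul.mul ξ ζ) = c

lemma span_etaC_zero : Submodule.span k {etaC k 0} = ⊤ := by
  refine eq_top_iff.2 fun c _ => Submodule.mem_span_singleton.2 ⟨c .one, ?_⟩
  funext g
  cases g
  simp [etaC]

lemma span_etaC_omegaC (n : ℕ) : Submodule.span k {etaC k (n + 1), omegaC k (n + 1)} = ⊤ := by
  refine eq_top_iff.2 fun c _ => Submodule.mem_span_pair.2 ?_
  cases n with
  | zero =>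
    refine ⟨c (.xPow 0), c .y, ?_⟩
    funext g
    cases g <;> simp [etaC, omegaC]
  | succ n =>
    refine ⟨c (.xPow (n + 1)), c (.yyx n), ?_⟩
    funext g
    cases g <;> simp [etaC, omegaC]

lemma linearIndependent_etaC_zero : LinearIndependent k ![etaC k 0] := by
  refine linearIndependent_unique_iff.2 ?_
  exact fun h => one_ne_zero (congrFun h .one)

lemma linearIndependent_etaC_omegaC (n : ℕ) :
    LinearIndependent k ![etaC k (n + 1), omegaC k (n + 1)] := by
  refine LinearIndependent.pair_iff.2 fun s t h => ?_
  cases n with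
  | zero =>
    have h1 := congrFun h (.xPow 0)
    have h2 := congrFun h .y
    simp [etaC, omegaC] at h1 h2
    exact ⟨h1, h2⟩
  | succ n =>
    have h1 := congrFun h (.xPow (n + 1))
    have h2 := congrFun h (.yyx n)
    simp [etaC, omegaC] at h1 h2
    exact ⟨h1, h2⟩

lemma linearIndependent_of_equiv {ι M N : Type*} [AddCommGroup M] [Module k M] [AddCommGroup N]
    [Module k N] (e : M ≃ₗ[k] N) {v : ι → M} {w : ι → N} (h : ∀ i, e (v i) = w i)
    (hw : LinearIndependent k w) : LinearIndependent k v :=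
  LinearIndependent.of_comp e.toLinearMap ((funext h : e ∘ v = w) ▸ hw)

lemma span_eq_top_of_equiv {M N : Type*} [AddCommGroup M] [Module k M] [AddCommGroup N]
    [Module k N] (e : M ≃ₗ[k] N) {s : Set M} (h : Submodule.span k (e '' s) = ⊤) :
    Submodule.span k s = ⊤ :=
  Submodule.map_injective_of_injective (f := e.toLinearMap) e.injective (by
    rw [Submodule.map_span, Submodule.map_top, LinearEquiv.range]
    exact h)

theorem ComputedBy.productTable {H : ℕ → Type u} [∀ n, AddCommGroup (H n)] [∀ n, Module k (H n)]
    [DirectSum.GSemiring H] [DirectSum.GAlgebra k H] {pb : ∀ n, H n ≃ₗ[k] (Gen n → k)}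
    (C : ComputedBy H pb) (η ω : ∀ n, H n) (hη : ∀ n, pb n (η n) = etaC k n)
    (hω : ∀ n, pb n (ω n) = omegaC k n) : ProductTable k η ω := by
  have key (n p : ℕ) (ξ : H n) (ζ : H p) (χ : H (n + p)) (g : ∀ n m, Q k m →ₗ[SJ k] Q k n)
      (hg : IsLift p (pb p ζ) g) (h : dualQ (pb n ξ) ∘ₗ g n (n + p) = dualQ (pb (n + p) χ)) :
      DirectSum.of H n ξ * DirectSum.of H p ζ = DirectSum.of H (n + p) χ := by
    rw [DirectSum.of_mul_of, (pb (n + p)).injective (C.mul n p ξ ζ g _ hg h)]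
  have lift_η (p : ℕ) : IsLift (p + 1) (pb (p + 1) (η (p + 1))) (etaLift k) := by
    rw [hη]; exact isLift_etaLift p
  have lift_ω (p : ℕ) : IsLift (p + 2) (pb (p + 2) (ω (p + 2))) (omegaLift k) := by
    rw [hω]; exact isLift_omegaLift p
  have lift_ω₁ : IsLift 1 (pb 1 (ω 1)) (omegaOneLift k) := by
    rw [hω]; exact isLift_omegaOneLift
  refine ⟨?_, ?_, ?_, ?_, ?_, ?_, ?_, ?_, ?_, ?_, ?_⟩
  · refine congrArg (DirectSum.of H 0) ((pb 0).injective ?_)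
    rw [hη, C.one]
    funext g
    cases g
    rfl
  · exact linearIndependent_of_equiv (pb 0) (fun i => by fin_cases i; exact hη 0)
      linearIndependent_etaC_zero
  · refine span_eq_top_of_equiv (pb 0) ?_
    rw [Set.image_singleton, hη]
    exact span_etaC_zero
  · rintro (- | n) hn
    · omega
    refine linearIndependent_of_equiv (pb (n + 1)) (fun i => ?_) (linearIndependent_etaC_omegaC n)
    fin_cases i
    · exact hη _
    · exact hω _
  · rintro (- | n) hn
    · omega
    refine span_eq_top_of_equiv (pb (n + 1)) ?_
    rw [Set.image_pair, hη, hω]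
    exact span_etaC_omegaC n
  · rintro p (- | q) hp hq
    · omega
    refine key _ _ _ _ _ _ (lift_η q) ?_
    rw [hη, hη]
    exact dualQ_comp_etaLift _ _
  · intro p q hp hq
    suffices h : DirectSum.of H p (ω p) * DirectSum.of H q (ω q) = DirectSum.of H (p + q) 0 by
      rw [h, map_zero]
    match p, q with
    | 0, _ => omega
    | _, 0 => omega
    | p + 1, 1 =>
      refine key _ _ _ _ _ _ lift_ω₁ ?_
      rw [map_zero]
      exact dualQ_comp_omegaOneLift _ _
    | p + 1, q + 2 =>
      refine key _ _ _ _ _ _ (lift_ω q) ?_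
      rw [map_zero, hω]
      exact dualQ_omegaC_comp_omegaLift _ _
  · rintro (- | q) hq
    · omega
    rw [key 1 (q + 1) (ω 1) (η (q + 1)) 0 _ (lift_η q) (by
      rw [map_zero, hω]
      exact dualQ_omegaC_one_comp_etaLift _), map_zero]
  · rintro (- | q) hq
    · omega
    rw [key (q + 1) 1 (η (q + 1)) (ω 1) 0 _ lift_ω₁ (by
      rw [map_zero]
      exact dualQ_comp_omegaOneLift _ _), map_zero]
  · rintro (- | - | p) (- | q) hp hq <;> try omega
    have h : dualQ (omegaC k (p + 2)) ∘ₗ etaLift k (p + 2) (p + 2 + (q + 1)) =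
        dualQ (omegaC k (p + 2 + (q + 1))) := by
      have e : p + 2 + (q + 1) = p + q + 1 + 2 := by omega
      rw [e]
      exact dualQ_omegaC_comp_etaLift _ _
    exact key _ _ _ _ _ _ (lift_η q) (by rw [hω, hω]; exact h)
  · rintro (- | - | p) q hp hq <;> try omega
    -- The lift of ω gives ηᵠωᵖ⁺² with its sign on the right-hand side; squaring the sign moves it
    -- to the other side.
    have h := key q (p + 2) (η q) (ω (p + 2)) ((-1 : k) ^ q • ω (q + (p + 2))) _ (lift_ω p) (by
      rw [map_smul, hη, hω]
      exact dualQ_etaC_comp_omegaLift _ _)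
    have hs : DirectSum.of H (q + (p + 2)) ((-1 : k) ^ q • ω (q + (p + 2))) =
        (-1 : k) ^ q • DirectSum.of H (q + (p + 2)) (ω (q + (p + 2))) :=
      (DirectSum.lof k ℕ H _).map_smul _ _
    rw [h, hs, smul_smul, ← mul_pow, neg_one_mul, neg_neg, one_pow, one_smul, add_comm]

end Table

/-! ### The table for Hochschild cohomology -/

section HochschildTable

/-- The values of bimodule maps `P_n A → k` on the generators. -/
def dualEquiv (n : ℕ) : (P k n →ₗ[Env k (SJ k)] Aug (aug k)) ≃ₗ[k] (Gen n → k) where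
  toFun L g := Aug.toField (L (single g 1))
  map_add' _ _ := rfl
  map_smul' _ _ := rfl
  invFun := dual k
  left_inv L := (eq_dual L).symm
  right_inv c := dual_injective (eq_dual (dual k c)).symm

lemma dualEquiv_dual {n : ℕ} (c : Gen n → k) : dualEquiv n (dual k c) = c :=
  (dualEquiv n).right_inv c

lemma dual_dualEquiv {n : ℕ} (L : P k n →ₗ[Env k (SJ k)] Aug (aug k)) :
    dual k (dualEquiv n L) = L := (dualEquiv n).left_inv L

/-- The coordinates of Hochschild cohomology classes on the minimal resolution. -/
def Comparison.coord (F : Comparison k) (n : ℕ) : HAug (aug k) n ≃ₗ[k] (Gen n → k) :=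
  (LinearEquiv.ofBijective (F.pullback n) ⟨F.pullback_injective n, F.pullback_surjective n⟩).trans
    (dualEquiv n)

lemma Comparison.coord_eq (F : Comparison k) {n : ℕ} {ξ : HAug (aug k) n} {c : Gen n → k}
    (h : F.pullback n ξ = dual k c) : F.coord n ξ = c := by
  change dualEquiv n (F.pullback n ξ) = c
  rw [h, dualEquiv_dual]

lemma Comparison.pullback_eq_dual_coord (F : Comparison k) {n : ℕ} (ξ : HAug (aug k) n) :
    F.pullback n ξ = dual k (F.coord n ξ) :=
  (dual_dualEquiv _).symm

theorem Comparison.computedBy (F : Comparison k) : ComputedBy (HAug (aug k)) F.coord where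
  one := by
    refine F.coord_eq ?_
    change F.pullback 0 (HH.mk (scalarCocycle (aug k) 1)) = _
    rw [F.pullback_mk]
    refine P.hom_ext fun g => ?_
    cases g
    rw [LinearMap.comp_apply, F.f_zero' ![], barLift_barOne, scalarCocycle_apply, dual,
      Finsupp.linearCombination_single, one_smul]
  mul n p ξ ζ g c hg hc :=
    F.coord_eq (F.pullback_cup ξ ζ _ _ (F.pullback_eq_dual_coord ξ) (F.pullback_eq_dual_coord ζ)
      g hg c hc)

end HochschildTable
end SJ
end Yoneda
end

/-! ### Self-extensions from a minimal chain of syzygies -/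

noncomputable section

namespace Yoneda

open Abelian

/-- Iterated syzygies `Z n` of `Z 0`, given by projective covers `Pr n ⟶ Z n` with kernels
`Z (n + 1)`, that are minimal for maps to `Z 0`. -/
structure Syzygies (C : Type*) [Category.{v} C] [Abelian C] where
  Z : ℕ → C
  Pr : ℕ → C
  i (n : ℕ) : Z (n + 1) ⟶ Pr n
  π (n : ℕ) : Pr n ⟶ Z n
  i_π (n : ℕ) : i n ≫ π n = 0
  shortExact (n : ℕ) : (ShortComplex.mk (i n) (π n) (i_π n)).ShortExact
  projective (n : ℕ) : Projective (Pr n)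
  minimal (n : ℕ) (f : Pr n ⟶ Z 0) : i n ≫ f = 0

namespace Syzygies

variable {C : Type*} [Category.{v} C] [Abelian C] (R : Syzygies C)

instance (n : ℕ) : Projective (R.Pr n) := R.projective n

instance (n : ℕ) : Epi (R.π n) := (R.shortExact n).epi_g

lemma exists_π_comp_eq {n : ℕ} {Y : C} (f : R.Pr n ⟶ Y) (hf : R.i n ≫ f = 0) :
    ∃ f', R.π n ≫ f' = f :=
  have := (R.shortExact n).epi_g
  ⟨(R.shortExact n).exact.desc f hf, (R.shortExact n).exact.g_desc f hf⟩

variable [HasExt.{w} C]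

/-- The class of `0 → Z (n + 1) → Pr n → Z n → 0`. -/
def σ (n : ℕ) : Ext (R.Z n) (R.Z (n + 1)) 1 := (R.shortExact n).extClass

/-- The iterated extension class in `Extⁿ(Z 0, Z n)`. -/
def s : (n : ℕ) → Ext (R.Z 0) (R.Z n) n
  | 0 => Ext.mk₀ (𝟙 _)
  | n + 1 => (s n).comp (R.σ n) rfl

/-- Dimension shifting in the long exact sequence. Surjectivity, and injectivity for j > 0, come
from the vanishing of higher Ext out of a projective; for j = 0 injectivity is minimality, as maps Z
(n + 1) → Z 0 that extend to Pr n are zero. -/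
lemma σ_comp_bijective (n j N : ℕ) (h : 1 + j = N) :
    Function.Bijective (fun x : Ext (R.Z (n + 1)) (R.Z 0) j => (R.σ n).comp x h) := by
  constructor
  · intro x x' hx
    have hx0 : (R.shortExact n).extClass.comp (x - x') h = 0 := by
      have h' : (R.σ n).comp x h = (R.σ n).comp x' h := hx
      rw [sub_eq_add_neg, Ext.comp_add, Ext.comp_neg, ← sub_eq_add_neg, sub_eq_zero]
      exact h'
    obtain ⟨z, hz⟩ := Ext.contravariant_sequence_exact₁ (R.shortExact n) (R.Z 0) (x - x') h hx0
    rw [← sub_eq_zero, ← hz]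
    cases j with
    | zero =>
      obtain ⟨f, rfl⟩ := (Ext.mk₀_bijective _ _).2 z
      change (Ext.mk₀ (R.i n)).comp (Ext.mk₀ f) _ = 0
      rw [Ext.mk₀_comp_mk₀, R.minimal, Ext.mk₀_zero]
    | succ j =>
      have : z = 0 := Ext.eq_zero_of_projective (P := R.Pr n) z
      rw [this, Ext.comp_zero]
  · intro y
    subst h
    refine Ext.contravariant_sequence_exact₃ (R.shortExact n) (R.Z 0) y ?_ rfl
    have h : ∀ (N : ℕ) (_ : 1 + j = N) (z : Ext (R.Pr n) (R.Z 0) N), z = 0 := by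
      intro N h z
      obtain rfl : N = j + 1 := by omega
      exact Ext.eq_zero_of_projective z
    exact h _ rfl _

lemma s_comp_bijective (n : ℕ) : ∀ (j N : ℕ) (h : n + j = N),
    Function.Bijective (fun x : Ext (R.Z n) (R.Z 0) j => (R.s n).comp x h) := by
  induction n with
  | zero =>
    intro j N h
    obtain rfl : j = N := by omega
    convert! Function.bijective_id (α := Ext (R.Z 0) (R.Z 0) j) with x
    exact Ext.mk₀_id_comp x
  | succ n ih =>
    intro j N h
    have e : (fun x : Ext (R.Z (n + 1)) (R.Z 0) j => (R.s (n + 1)).comp x h) =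
        (fun y => (R.s n).comp y (by omega)) ∘ fun x => (R.σ n).comp x rfl := by
      funext x
      exact Ext.comp_assoc (R.s n) (R.σ n) x rfl rfl (by omega)
    rw [e]
    exact (ih _ _ _).comp (R.σ_comp_bijective n j _ rfl)

variable (k : Type*) [Field k] [Linear k C]

/-- Maps out of `Z n` are maps out of `Pr n`. -/
def homEquiv (n : ℕ) : (R.Z n ⟶ R.Z 0) ≃ₗ[k] (R.Pr n ⟶ R.Z 0) :=
  LinearEquiv.ofBijective (Linear.leftComp k (R.Z 0) (R.π n)) <| by
    constructor
    · intro f f' h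
      exact (cancel_epi (R.π n)).1 h
    · intro f
      exact R.exists_π_comp_eq f (R.minimal n f)

/-- `Ext^n(Z 0, Z 0)` as maps out of `Z n`. -/
def extEquiv (n : ℕ) : (R.Z n ⟶ R.Z 0) ≃ₗ[k] Ext (R.Z 0) (R.Z 0) n :=
  LinearEquiv.ofBijective
    { toFun f := (R.s n).comp (Ext.mk₀ f) (add_zero n)
      map_add' f f' := by rw [Ext.mk₀_add, Ext.comp_add]
      map_smul' c f := by rw [Ext.mk₀_smul, Ext.comp_smul]; rfl } <|
    (R.s_comp_bijective n 0 n (add_zero n)).comp (Ext.mk₀_bijective _ _)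

/-- `Ext^n(Z 0, Z 0)` is the space of maps `Pr n ⟶ Z 0`. -/
def coord (n : ℕ) : Ext (R.Z 0) (R.Z 0) n ≃ₗ[k] (R.Pr n ⟶ R.Z 0) :=
  (R.extEquiv k n).symm.trans (R.homEquiv k n)

variable {k R}

lemma coord_comp {n : ℕ} (f : R.Z n ⟶ R.Z 0) :
    R.coord k n ((R.s n).comp (Ext.mk₀ f) (add_zero n)) = R.π n ≫ f := by
  have h : (R.s n).comp (Ext.mk₀ f) (add_zero n) = R.extEquiv k n f := rfl
  rw [h, coord, LinearEquiv.trans_apply, LinearEquiv.symm_apply_apply]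
  rfl

lemma exists_eq_comp {n : ℕ} (α : Ext (R.Z 0) (R.Z 0) n) :
    ∃ f : R.Z n ⟶ R.Z 0, (R.s n).comp (Ext.mk₀ f) (add_zero n) = α :=
  ((R.s_comp_bijective n 0 n (add_zero n)).comp (Ext.mk₀_bijective _ _)).2 α

lemma coord_id : R.coord k 0 (Ext.mk₀ (𝟙 (R.Z 0))) = R.π 0 := by
  have h : Ext.mk₀ (𝟙 (R.Z 0)) = (R.s 0).comp (Ext.mk₀ (𝟙 (R.Z 0))) (add_zero 0) :=
    (Ext.mk₀_id_comp _).symm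
  rw [h, coord_comp, Category.comp_id]

/-- The Yoneda product is computed by lifting the first factor to a chain map. -/
theorem coord_comp_eq {n p : ℕ} (β : Ext (R.Z 0) (R.Z 0) p) (α : Ext (R.Z 0) (R.Z 0) n)
    (g : ∀ j, R.Pr (p + j) ⟶ R.Pr j) (h0 : g 0 ≫ R.π 0 = R.coord k p β)
    (hg : ∀ j, (R.π (p + j + 1) ≫ R.i (p + j)) ≫ g j = g (j + 1) ≫ R.π (j + 1) ≫ R.i j) :
    R.coord k (p + n) (β.comp α rfl) = g n ≫ R.coord k n α := by
  have hz (j : ℕ) : R.i (p + j) ≫ g j ≫ R.π j = 0 := by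
    rw [← cancel_epi (R.π (p + j + 1)), Limits.comp_zero]
    have := hg j =≫ R.π j
    simp only [Category.assoc, R.i_π, Limits.comp_zero] at this
    exact this
  -- The chain map descends to the syzygies, giving morphisms of the short exact sequences, to which
  -- naturality of the extension class applies.
  choose gb hgb using fun j => R.exists_π_comp_eq (g j ≫ R.π j) (hz j)
  have hi (j : ℕ) : R.i (p + j) ≫ g j = gb (j + 1) ≫ R.i j := by
    rw [← cancel_epi (R.π (p + j + 1)), ← Category.assoc, hg, ← Category.assoc, ← Category.assoc]
    exact congrArg (· ≫ R.i j) (hgb (j + 1)).symm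
  have hσ (j : ℕ) : (R.σ (p + j)).comp (Ext.mk₀ (gb (j + 1))) (add_zero 1) =
      (Ext.mk₀ (gb j)).comp (R.σ j) (zero_add 1) :=
    ShortComplex.ShortExact.extClass_naturality (R.shortExact (p + j)) (R.shortExact j)
      { τ₁ := gb (j + 1), τ₂ := g j, τ₃ := gb j, comm₁₂ := (hi j).symm, comm₂₃ := (hgb j).symm }
  -- Since `gb 0` represents β, this slides β past the iterated extension class one step at a time,
  -- leaving an honest morphism of syzygies.
  have hs (j : ℕ) : ((R.s p).comp (Ext.mk₀ (gb 0)) (add_zero p)).comp (R.s j) rfl =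
      (R.s (p + j)).comp (Ext.mk₀ (gb j)) (add_zero (p + j)) := by
    induction j with
    | zero => exact Ext.comp_mk₀_id _
    | succ j ih =>
      have e : (((R.s p).comp (Ext.mk₀ (gb 0)) (add_zero p)).comp (R.s (j + 1)) rfl) =
          (((R.s p).comp (Ext.mk₀ (gb 0)) (add_zero p)).comp (R.s j) rfl).comp (R.σ j)
            (add_assoc p j 1) :=
        (Ext.comp_assoc _ (R.s j) (R.σ j) rfl rfl (by omega)).symm
      rw [e, ih, Ext.comp_assoc_of_second_deg_zero, ← hσ]
      exact (Ext.comp_assoc_of_third_deg_zero (R.s (p + j)) (R.σ (p + j)) _ rfl).symm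
  obtain ⟨a, rfl⟩ := exists_eq_comp α
  have hβ : β = (R.s p).comp (Ext.mk₀ (gb 0)) (add_zero p) := by
    apply (R.coord k p).injective
    rw [coord_comp, ← h0]
    exact (hgb 0).symm
  have e : β.comp ((R.s n).comp (Ext.mk₀ a) (add_zero n)) rfl =
      (R.s (p + n)).comp (Ext.mk₀ (gb n ≫ a)) (add_zero (p + n)) := by
    rw [← Ext.comp_assoc_of_third_deg_zero, hβ, hs, Ext.comp_assoc_of_third_deg_zero,
      Ext.mk₀_comp_mk₀]
  rw [e, coord_comp, coord_comp, ← Category.assoc, hgb, Category.assoc]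

end Syzygies

end Yoneda
end

/-! ### The Yoneda algebra of the trivial module -/

noncomputable section

namespace Yoneda

namespace SJ

open Finsupp (single)

variable (k : Type u) [Field k]

/-- The syzygies of the trivial module in the resolution `Q`. -/
def syzygy : ℕ → ModuleCat.{u} (SJ k)
  | 0 => trivialModule k (aug k)
  | n + 1 => ModuleCat.of (SJ k) (LinearMap.range (dQ k n))

/-- The projection of `Q_n` onto the syzygy. -/
def syzygyπ : (n : ℕ) → ModuleCat.of (SJ k) (Q k n) ⟶ syzygy k n
  | 0 => ModuleCat.ofHom (dualQ fun _ => 1)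
  | n + 1 => ModuleCat.ofHom (dQ k n).rangeRestrict

/-- The inclusion of a syzygy into `Q_n`. -/
def syzygyι (n : ℕ) : syzygy k (n + 1) ⟶ ModuleCat.of (SJ k) (Q k n) :=
  ModuleCat.ofHom (LinearMap.range (dQ k n)).subtype

/-- Exactness of Q with the augmentation included, in a form uniform in n. -/
lemma syzygyπ_apply_eq_zero_iff (n : ℕ) (z : Q k n) :
    (syzygyπ k n).hom z = 0 ↔ z ∈ LinearMap.range (dQ k n) := by
  cases n with
  | zero =>
    constructor
    · intro h
      have h' : algebraMap k (Aug (aug k)) (aug k (z .one)) = 0 := by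
        rw [← dualQ_one_apply]
        exact h
      exact exists_dQ_zero_eq h'
    · rintro ⟨w, rfl⟩
      exact map_dQ (dualQ fun _ => 1) w
  | succ n =>
    constructor
    · intro h
      exact dQ_exact n (congrArg Subtype.val h)
    · rintro ⟨w, rfl⟩
      exact Subtype.ext (LinearMap.congr_fun (dQ_comp_dQ n) w)

lemma syzygyπ_surjective (n : ℕ) : Function.Surjective (syzygyπ k n).hom := by
  cases n with
  | zero =>
    intro (c : k)
    refine ⟨single .one (algebraMap k (SJ k) c), ?_⟩
    change dualQ (fun _ => 1) (single .one (algebraMap k (SJ k) c)) = c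
    rw [dualQ_one_apply, Finsupp.single_eq_same, AlgHom.commutes]
    rfl
  | succ n => exact (dQ k n).surjective_rangeRestrict

/-- The minimal resolution of the trivial module, cut into short exact sequences. -/
def syzygies : Syzygies (ModuleCat.{u} (SJ k)) where
  Z := syzygy k
  Pr n := ModuleCat.of (SJ k) (Q k n)
  i := syzygyι k
  π := syzygyπ k
  i_π n := by
    ext z
    exact (syzygyπ_apply_eq_zero_iff k n z.1).2 z.2
  shortExact n :=
    { exact := by
        rw [ShortComplex.moduleCat_exact_iff]
        intro z hz
        exact ⟨⟨z, (syzygyπ_apply_eq_zero_iff k n z).1 hz⟩, rfl⟩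
      mono_f := (ModuleCat.mono_iff_injective _).2 Subtype.val_injective
      epi_g := (ModuleCat.epi_iff_surjective _).2 (syzygyπ_surjective k n) }
  projective n := (IsProjective.iff_projective (Q k n)).1 inferInstance
  minimal n f := by
    ext ⟨_, w, rfl⟩
    exact map_dQ f.hom w

variable {k}

/-- Module maps `Q_n → k` are determined by their values on the generators. -/
def homDualEquiv (n : ℕ) :
    (ModuleCat.of (SJ k) (Q k n) ⟶ trivialModule k (aug k)) ≃ₗ[k] (Gen n → k) where
  toFun f g := Aug.toField (f.hom (single g 1))
  map_add' _ _ := rfl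
  map_smul' c f := by
    funext g
    have h (a : Aug (aug k)) : Aug.toField (algebraMap k (SJ k) c • a) = c • Aug.toField a := by
      rw [aug_smul_def, AlgHom.commutes, map_smul]
      rfl
    exact h (f.hom (single g 1))
  invFun c := ModuleCat.ofHom (dualQ c)
  left_inv f := by
    refine ModuleCat.hom_ext (Q.hom_ext fun g => ?_)
    rw [ModuleCat.hom_ofHom, dualQ_single, map_one, one_mul]
    rfl
  right_inv c := by
    funext g
    change Aug.toField (dualQ c (single g 1)) = c g
    rw [dualQ_single, map_one, one_mul]
    rfl

/-- The coordinates of self-extensions of the trivial module on the minimal resolution. -/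
def extCoord (n : ℕ) : SelfExt (trivialModule k (aug k)) n ≃ₗ[k] (Gen n → k) :=
  ((syzygies k).coord k n).trans (homDualEquiv n)

lemma coord_eq_dualQ {n : ℕ} (α : SelfExt (trivialModule k (aug k)) n) :
    (syzygies k).coord k n α = ModuleCat.ofHom (dualQ (extCoord n α)) :=
  ((homDualEquiv n).left_inv _).symm

lemma extCoord_eq {n : ℕ} {α : SelfExt (trivialModule k (aug k)) n} {c : Gen n → k}
    (h : (syzygies k).coord k n α = ModuleCat.ofHom (dualQ c)) : extCoord n α = c := by
  refine (congrArg (homDualEquiv n) h).trans ((homDualEquiv n).right_inv c)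

/-- The product αβ is α ∘ β, that is `Ext.comp` with β first, so it is again the second factor that
gets lifted. This agreement with the cup product makes the final map an isomorphism rather than an
anti-isomorphism. -/
theorem extCoord_computedBy : ComputedBy (SelfExt (trivialModule k (aug k))) extCoord where
  one := extCoord_eq (syzygies k).coord_id
  mul n p α β g c hg hc := by
    -- Composition naturally lands in degree p + n, the product in n + p; a free N absorbs the
    -- difference.
    suffices h : ∀ (N : ℕ) (h : p + n = N) (c : Gen N → k),
        dualQ (extCoord n α) ∘ₗ g n N = dualQ c → extCoord N (β.comp α h) = c from
      h _ (add_comm p n) c hc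
    rintro N rfl c hc
    refine extCoord_eq ?_
    refine (Syzygies.coord_comp_eq (R := syzygies k) β α
      (fun j => ModuleCat.ofHom (g j (p + j))) ?_ fun j => ?_).trans ?_
    · rw [coord_eq_dualQ]
      exact congrArg ModuleCat.ofHom hg.zero
    · exact congrArg ModuleCat.ofHom (hg.comm j (p + j) (add_comm p j)).symm
    · rw [coord_eq_dualQ]
      exact congrArg ModuleCat.ofHom hc

end SJ
end Yoneda
end

/-! ### Gradedness and dimensions from the table -/

noncomputable section

namespace Yoneda

namespace ProductTable

variable {k : Type u} [Field k] {H H' : ℕ → Type u} [∀ n, AddCommGroup (H n)]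
  [∀ n, Module k (H n)] [DirectSum.GSemiring H] [DirectSum.GAlgebra k H]
  [∀ n, AddCommGroup (H' n)] [∀ n, Module k (H' n)] [DirectSum.GSemiring H']
  [DirectSum.GAlgebra k H'] {η ω : ∀ n, H n} {η' ω' : ∀ n, H' n}

/-- An algebra map that matches the generators is graded. -/
lemma exists_map_of_eq (T : ProductTable k η ω) (T' : ProductTable k η' ω')
    (Φ : (⨁ n, H n) →ₐ[k] ⨁ n, H' n)
    (hη : Φ (DirectSum.of H 1 (η 1)) = DirectSum.of H' 1 (η' 1))
    (hω : Φ (DirectSum.of H 1 (ω 1)) = DirectSum.of H' 1 (ω' 1))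
    (hω₂ : Φ (DirectSum.of H 2 (ω 2)) = DirectSum.of H' 2 (ω' 2)) (n : ℕ) (x : H n) :
    ∃ α : H' n, Φ (DirectSum.of H n x) = DirectSum.of H' n α := by
  have he (n : ℕ) : Φ (DirectSum.of H n (η n)) = DirectSum.of H' n (η' n) := by
    rw [T.eta_eq_pow n, map_pow, hη, T'.eta_eq_pow n]
  have hw : ∀ n, Φ (DirectSum.of H (n + 1) (ω (n + 1))) = DirectSum.of H' (n + 1) (ω' (n + 1))
    | 0 => hω
    | n + 1 => by rw [T.omega_eq_mul n, map_mul, map_pow, hη, hω₂, T'.omega_eq_mul n]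
  let S : Submodule k (H n) := (LinearMap.range (DirectSum.lof k ℕ H' n)).comap
    (Φ.toLinearMap ∘ₗ DirectSum.lof k ℕ H n)
  suffices h : (⊤ : Submodule k (H n)) ≤ S by
    obtain ⟨α, hα⟩ := h (Submodule.mem_top (x := x))
    exact ⟨α, hα.symm⟩
  cases n with
  | zero =>
    rw [← T.span_zero, Submodule.span_le, Set.singleton_subset_iff]
    exact ⟨η' 0, (he 0).symm⟩
  | succ n =>
    rw [← T.span (n + 1) (by omega), Submodule.span_le, Set.insert_subset_iff,
      Set.singleton_subset_iff]
    exact ⟨⟨η' _, (he _).symm⟩, ⟨ω' _, (hw _).symm⟩⟩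

lemma finrank_eq_two (T : ProductTable k η ω) {n : ℕ} (hn : 1 ≤ n) :
    Module.finrank k (H n) = 2 := by
  let b := Module.Basis.mk (T.linearIndependent n hn) (by
    rw [Matrix.range_cons, Matrix.range_cons, Matrix.range_empty, Set.union_empty,
      Set.singleton_union, T.span n hn])
  rw [Module.finrank_eq_card_basis b, Fintype.card_fin]

end ProductTable

end Yoneda
end

/-! ### Assembly of the two tables -/

theorem mainTheorem2 (k : Type u) [Field k] [CharZero k] :
    Nonempty (Yoneda.SJ.Comparison k) ∧
    ∀ F : Yoneda.SJ.Comparison k,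
      -- every bimodule cochain on the minimal resolution represents a unique class
      (∀ n, Function.Bijective (F.pullback n)) ∧
      ∀ η ω : ∀ n, Yoneda.HAug (Yoneda.SJ.aug k) n,
        (∀ n, F.pullback n (η n) = Yoneda.SJ.etaP k n) →
        (∀ n, F.pullback n (ω n) = Yoneda.SJ.omegaP k n) →
        -- `E` is the class of `ηⁿ` and `W` the class of `ωⁿ` in the cohomology algebra
        ∀ E W : ℕ → ⨁ n, Yoneda.HAug (Yoneda.SJ.aug k) n,
        (∀ n, E n = DirectSum.of (Yoneda.HAug (Yoneda.SJ.aug k)) n (η n)) →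
        (∀ n, W n = DirectSum.of (Yoneda.HAug (Yoneda.SJ.aug k)) n (ω n)) →
        -- bases
        (E 0 = 1 ∧ LinearIndependent k ![η 0] ∧ Submodule.span k {η 0} = ⊤) ∧
        (∀ n, 1 ≤ n → LinearIndependent k ![η n, ω n] ∧ Submodule.span k {η n, ω n} = ⊤) ∧
        -- products
        (∀ p q, 1 ≤ p → 1 ≤ q → E p * E q = E (p + q)) ∧
        (∀ p q, 1 ≤ p → 1 ≤ q → W p * W q = 0) ∧
        (∀ q, 1 ≤ q → W 1 * E q = 0 ∧ E q * W 1 = 0) ∧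
        (∀ p q, 2 ≤ p → 1 ≤ q →
          W p * E q = W (p + q) ∧ W (p + q) = (-1 : k) ^ q • (E q * W p)) ∧
        -- generation and presentation of the cohomology algebra
        Algebra.adjoin k {E 1, W 1, W 2} = ⊤ ∧
        (∃ Ψ : Yoneda.Pres k ≃ₐ[k] ⨁ n, Yoneda.HAug (Yoneda.SJ.aug k) n,
          Ψ (Yoneda.Pres.gen k 0) = E 1 ∧ Ψ (Yoneda.Pres.gen k 1) = W 1 ∧
            Ψ (Yoneda.Pres.gen k 2) = W 2) ∧
        -- the Yoneda algebra
        (∀ n, 1 ≤ n → Module.finrank k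
          (Yoneda.SelfExt (Yoneda.trivialModule k (Yoneda.SJ.aug k)) n) = 2) ∧
        (∃ Φ : (⨁ n, Yoneda.HAug (Yoneda.SJ.aug k) n) ≃ₐ[k]
            Yoneda.YonedaAlgebra k (Yoneda.SJ.aug k),
          (∀ n x, ∃ α : Yoneda.SelfExt (Yoneda.trivialModule k (Yoneda.SJ.aug k)) n,
            Φ (DirectSum.of (Yoneda.HAug (Yoneda.SJ.aug k)) n x) =
              DirectSum.of (Yoneda.SelfExt (Yoneda.trivialModule k (Yoneda.SJ.aug k))) n α) ∧
          Algebra.adjoin k {Φ (E 1), Φ (W 1), Φ (W 2)} = ⊤ ∧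
          ∃ Θ : Yoneda.Pres k ≃ₐ[k] Yoneda.YonedaAlgebra k (Yoneda.SJ.aug k),
            Θ (Yoneda.Pres.gen k 0) = Φ (E 1) ∧ Θ (Yoneda.Pres.gen k 1) = Φ (W 1) ∧
              Θ (Yoneda.Pres.gen k 2) = Φ (W 2)) ∧
        Yoneda.IsK2 k (Yoneda.SJ.aug k) := by

  refine ⟨Yoneda.SJ.nonempty_comparison, fun F =>
    ⟨fun n => ⟨F.pullback_injective n, F.pullback_surjective n⟩, ?_⟩⟩
  intro η ω hη hω E W hE hW
  have T := F.computedBy.productTable η ω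
    (fun n => F.coord_eq ((hη n).trans (Yoneda.SJ.etaP_eq_dual n)))
    (fun n => F.coord_eq ((hω n).trans (Yoneda.SJ.omegaP_eq_dual n)))
  -- The Ext classes are chosen to have the same coordinates on the minimal resolution as ηⁿ and ωⁿ.
  have T' := (Yoneda.SJ.extCoord_computedBy (k := k)).productTable
    (fun n => (Yoneda.SJ.extCoord n).symm (Yoneda.SJ.etaC k n))
    (fun n => (Yoneda.SJ.extCoord n).symm (Yoneda.SJ.omegaC k n))
    (fun _ => LinearEquiv.apply_symm_apply _ _) (fun _ => LinearEquiv.apply_symm_apply _ _)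
  obtain ⟨Ψ, h0, h1, h2⟩ := T.exists_presentation
  obtain ⟨Θ, h0', h1', h2'⟩ := T'.exists_presentation
  have g0 : Θ (Ψ.symm (E 1)) = Θ (Yoneda.Pres.gen k 0) := by
    rw [hE, ← h0, AlgEquiv.symm_apply_apply]
  have g1 : Θ (Ψ.symm (W 1)) = Θ (Yoneda.Pres.gen k 1) := by
    rw [hW, ← h1, AlgEquiv.symm_apply_apply]
  have g2 : Θ (Ψ.symm (W 2)) = Θ (Yoneda.Pres.gen k 2) := by
    rw [hW, ← h2, AlgEquiv.symm_apply_apply]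
  refine ⟨⟨?_, T.linearIndependent_zero, T.span_zero⟩,
    fun n hn => ⟨T.linearIndependent n hn, T.span n hn⟩, ?_, ?_, ?_, ?_, ?_, ⟨Ψ, ?_, ?_, ?_⟩,
    fun n hn => T'.finrank_eq_two hn,
    ⟨Ψ.symm.trans Θ, ?_, ?_, Θ, g0.symm, g1.symm, g2.symm⟩, ?_⟩
  · rw [hE]
    exact T.one
  · intro p q hp hq
    rw [hE, hE, hE]
    exact T.eta_eta p q hp hq
  · intro p q hp hq
    rw [hW, hW]
    exact T.omega_omega p q hp hq
  · intro q hq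
    rw [hE, hW]
    exact ⟨T.omega_one_eta q hq, T.eta_omega_one q hq⟩
  · intro p q hp hq
    rw [hE, hW, hW]
    exact ⟨T.omega_eta p q hp hq, T.eta_omega p q hp hq⟩
  · rw [hE, hW, hW]
    exact T.adjoin_eq_top
  · rw [hE, h0]
  · rw [hW, h1]
  · rw [hW, h2]
  · refine T.exists_map_of_eq T' (Ψ.symm.trans Θ).toAlgHom ?_ ?_ ?_
    · rw [← hE]
      exact g0.trans h0'
    · rw [← hW]
      exact g1.trans h1'
    · rw [← hW]
      exact g2.trans h2'
  · have e : ({(Ψ.symm.trans Θ) (E 1), (Ψ.symm.trans Θ) (W 1), (Ψ.symm.trans Θ) (W 2)} : Set _) =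
        {Θ (Yoneda.Pres.gen k 0), Θ (Yoneda.Pres.gen k 1), Θ (Yoneda.Pres.gen k 2)} := by
      rw [← g0, ← g1, ← g2]
      rfl
    rw [e, h0', h1', h2']
    exact T'.adjoin_eq_top
  -- The three generators are homogeneous of degrees 1, 1 and 2, so they already lie in the set
  -- whose span as an algebra defines 𝒦₂.
  · refine top_le_iff.1 (T'.adjoin_eq_top.symm.le.trans (Algebra.adjoin_mono ?_))
    rintro _ (rfl | rfl | rfl)
    · exact Or.inl ⟨_, rfl⟩
    · exact Or.inl ⟨_, rfl⟩
    · exact Or.inr ⟨_, rfl⟩
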